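/- \textbf{Setting.} Let $X$ (states) and $A$ (actions) be finite, $u_{a,x}\in\mathbb R$, $\bar\kappa,\chi,\rho>0$, and let $\mathcal P(X)$ be the probability simplex. Put $\hat u(q)=\max_{a\in A}\sum_x q_x u_{a,x}$. Let $H:\mathcal P(X)\to\mathbb R_+$ be strongly convex, continuous, and twice continuously differentiable on the relative interior of $\mathcal P(X)$. Let $\bar q_0\in\mathcal P(X)$ satisfy $$\hat u(\bar q_0)-\tfrac{\bar\kappa}{\chi}H(\bar q_0)>\sum_{x}\bar q_{0,x}\bigl(\hat u(e_x)-\tfrac{\bar\kappa}{\chi}H(e_x)\bigr),$$ where $e_x$ is the point belief on $x$. \emph{Principal's problem.} Let $\Omega$ be the set of càdlàg functions $[0,\infty)\to\mathcal P(X)$, $q$ the canonical process, $(\mathcal F_t)$ its natural filtration. A policy $(P,I,\tau)$ is admissible if $P$ is a probability measure on $\Omega$ under which $q$ is a martingale with $q_0=\bar q_0$ a.s., $\tau$ is an a.s. finite stopping time, and $I$ is an adapted, a.s. increasing process with $I_0=0$ that up to $\tau$ is the cumulative information acquired and grows at most at rate $\chi$: for all $s\le t$, a.s., $$\mathbb E^P[H(q_{t\wedge\tau})-H(q_{s\wedge\tau})\mid\mathcal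 F_s]=\mathbb E^P[I_{t\wedge\tau}-I_{s\wedge\tau}\mid\mathcal F_s],$$ and a.s. $I_t-I_s\le\chi(t-s)$ for all $s\le t\le\tau$. A solution of the principal's problem is a policy that maximizes $\rho\,\mathbb E^P[I_\tau]$ among the admissible policies for which $\tau$ maximizes $\mathbb E^P[\hat u(q_{\tau'})-\bar\kappa\tau']$ over all stopping times $\tau'$ (a stopping time of infinite expectation having payoff $-\infty$). \emph{Relaxed problem.} $\Pi^*$ is the set of maximizers of $\rho\,\mathbb E^\pi[H(q)-H(\bar q_0)]$ over the Borel probability measures $\pi$ on $\mathcal P(X)$ with $\mathbb E^\pi[q]=\bar q_0$ and $\frac{\bar\kappa}{\chi}\mathbb E^\pi[H(q)-H(\bar q_0)]\le\mathbb E^\pi[\hat u(q)-\hat u(\bar q_0)]$. \emph{Suspensive and decisive beliefs.} Let $V_R(q,\pi)$ be the maximum of $\mathbb E^{\pi'}[\hat u(q')-\hat u(q)-\frac{\bar\kappa}{\chi}(H(q')-H(q))]$ over the probability measures $\pi'$ on $\mathrm{Supp}(\pi)$ with $\mathbb E^{\pi'}[q']=q$. The belief $q$ is decisive given $\pi$ if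 $q\in\mathrm{Supp}(\pi)$, and suspensive given $\pi$, written $q\in\Delta(\pi)$, if $q\in\mathrm{Conv}(\mathrm{Supp}(\pi))\setminus\mathrm{Supp}(\pi)$ and $V_R(q,\pi)\ge0$. \textbf{Proposition.} Let $(P,I,\tau)$ be any solution of the principal's problem. Then: (1) $P$-almost surely, for all $t\in[0,\tau)$, the belief is suspensive given some solution of the relaxed problem: $q_t\in\bigcup_{\pi^*\in\Pi^*}\Delta(\pi^*)$. Moreover, for every $t$, the topological support of the law of $q_t$ on the event $\{t<\tau\}$ is contained in $\bigcup_{\pi^*\in\Pi^*}\bigl(\Delta(\pi^*)\cup\mathrm{Supp}(\pi^*)\bigr)$. (2) At the stopping time beliefs are decisive given some solution of the relaxed problem: the topological support of the law of $q_\tau$ is contained in $\bigcup_{\pi^*\in\Pi^*}\mathrm{Supp}(\pi^*)$. -/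

import Mathlib

open MeasureTheory ProbabilityTheory Filter Topology
open scoped NNReal ENNReal

noncomputable section

namespace Engagement

/-- Beliefs: the probability simplex over the finite set `X` of states, as a subtype of `X → ℝ`
(with the topology and the Borel sigma-algebra induced from `X → ℝ`). -/
abbrev Belief (X : Type*) [Fintype X] : Type _ := stdSimplex ℝ X

/-- The belief that puts full weight on the state `x`. -/
def pointBelief {X : Type*} [Fintype X] [DecidableEq X] (x : X) : Belief X :=
  ⟨Pi.single x 1, single_mem_stdSimplex ℝ x⟩

/-- The primitives of the model: utilities `u a x`, the agent's flow cost of delay, the agent's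
information processing capacity, the principal's profit rate and the generalized entropy function
`H` (only its values on the simplex matter). -/
structure Model (X A : Type*) where
  u : A → X → ℝ
  /-- flow cost of delay (written `κ` with a bar) -/
  κ : ℝ
  /-- capacity -/
  χ : ℝ
  /-- profit per unit of attention -/
  ρ : ℝ
  H : (X → ℝ) → ℝ

section StaticPart

variable {X A : Type*} [Fintype X] [Fintype A] [Nonempty A]

/-- The payoff of an optimal action under the belief `q`. -/
def Model.uhat (M : Model X A) (q : Belief X) : ℝ :=
  Finset.univ.sup' Finset.univ_nonempty (fun a : A => ∑ x, q.1 x * M.u a x)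

/-- `π` is a probability measure on beliefs with barycenter `q₀` (Bayes consistency). -/
structure IsBayesPlausible (q₀ : Belief X) (π : Measure (Belief X)) : Prop where
  prob : IsProbabilityMeasure π
  mean : ∀ x, ∫ q, q.1 x ∂π = q₀.1 x

/-- Feasibility in the relaxed problem at the prior `q₀`: Bayes consistency and the combined
participation and capacity constraint. -/
structure Model.IsRelaxedFeasible (M : Model X A) (q₀ : Belief X) (π : Measure (Belief X)) :
    Prop where
  plausible : IsBayesPlausible q₀ π
  constraint : M.κ / M.χ * ∫ q, (M.H q.1 - M.H q₀.1) ∂π ≤ ∫ q, (M.uhat q - M.uhat q₀) ∂π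

/-- `π` solves the relaxed problem at the prior `q₀`. -/
structure Model.IsRelaxedSolution (M : Model X A) (q₀ : Belief X) (π : Measure (Belief X)) :
    Prop where
  feasible : M.IsRelaxedFeasible q₀ π
  optimal : ∀ π' : Measure (Belief X), M.IsRelaxedFeasible q₀ π' →
    M.ρ * ∫ q, (M.H q.1 - M.H q₀.1) ∂π' ≤ M.ρ * ∫ q, (M.H q.1 - M.H q₀.1) ∂π

/-- The set of solutions of the relaxed problem at the prior `q₀`. -/
def Model.relaxedSolutions (M : Model X A) (q₀ : Belief X) : Set (Measure (Belief X)) :=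
  {π | M.IsRelaxedSolution q₀ π}

/-- The restricted value of information `V_R(q, π)`: the largest net gain over Bayes-consistent
distributions of posteriors concentrated on the topological support of `π`. -/
def Model.restrictedValue (M : Model X A) (q : Belief X) (π : Measure (Belief X)) : ℝ :=
  sSup {v : ℝ | ∃ π' : Measure (Belief X), IsBayesPlausible q π' ∧ π' (π.support)ᶜ = 0 ∧
    v = ∫ q', (M.uhat q' - M.uhat q - M.κ / M.χ * (M.H q'.1 - M.H q.1)) ∂π'}

/-- The set of suspensive beliefs given `π`. -/
def Model.suspensive (M : Model X A) (π : Measure (Belief X)) : Set (Belief X) :=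
  {q | q.1 ∈ convexHull ℝ (Subtype.val '' π.support) ∧ q ∉ π.support ∧
    0 ≤ M.restrictedValue q π}

/-- The set of decisive beliefs given `π`. -/
def decisive (π : Measure (Belief X)) : Set (Belief X) := π.support

end StaticPart

section DynamicPart

/-- The set of càdlàg functions from `[0, ∞)` to the simplex, with the sigma-algebra generated by
the coordinate maps (the one induced from the product sigma-algebra). -/
abbrev BeliefPath (X : Type*) [Fintype X] : Type _ :=
  {w : ℝ≥0 → Belief X // ∀ t, ContinuousWithinAt w (Set.Ici t) t ∧
    ∃ l, Tendsto w (𝓝[<] t) (𝓝 l)}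

variable {X A : Type*} [Fintype X] [Fintype A] [Nonempty A]

/-- The canonical process. -/
def canon (t : ℝ≥0) (w : BeliefPath X) : Belief X := w.1 t

theorem stronglyMeasurable_canon (t : ℝ≥0) :
    StronglyMeasurable (canon t : BeliefPath X → Belief X) :=
  ((measurable_pi_apply t).comp measurable_subtype_coe).stronglyMeasurable

/-- The (raw) natural filtration of the canonical process. -/
def canonFiltration (X : Type*) [Fintype X] :
    Filtration ℝ≥0 (inferInstance : MeasurableSpace (BeliefPath X)) :=
  Filtration.natural (fun t => (canon t : BeliefPath X → Belief X)) stronglyMeasurable_canon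

/-- The belief at the stopping time (the value on the event that `τ` is infinite is irrelevant: only
almost surely finite stopping times are used below). -/
def stoppedBelief (τ : BeliefPath X → ℝ≥0∞) (w : BeliefPath X) : Belief X :=
  canon (τ w).toNNReal w

/-- The truncated time `t ∧ τ`. -/
def truncTime (τ : BeliefPath X → ℝ≥0∞) (t : ℝ≥0) (w : BeliefPath X) : ℝ≥0 :=
  (min (t : ℝ≥0∞) (τ w)).toNNReal

/-- The agent's expected payoff from the stopping time `τ` under the law `P`. -/
def Model.agentPayoff (M : Model X A) (P : Measure (BeliefPath X)) (τ : BeliefPath X → ℝ≥0∞) : ℝ :=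
  ∫ w, (M.uhat (stoppedBelief τ w) - M.κ * (τ w).toReal) ∂P

/-- `τ` is an optimal stopping time of the agent under `P`. A stopping time with infinite
expectation has payoff `-∞` and is never optimal, so only those with finite expectation are compared. -/
structure Model.IsAgentOptimal (M : Model X A) (P : Measure (BeliefPath X))
    (τ : BeliefPath X → ℝ≥0∞) : Prop where
  stopping : IsStoppingTime (canonFiltration X) τ
  integrable : ∫⁻ w, τ w ∂P ≠ ∞
  optimal : ∀ τ' : BeliefPath X → ℝ≥0∞, IsStoppingTime (canonFiltration X) τ' →
    ∫⁻ w, τ' w ∂P ≠ ∞ → M.agentPayoff P τ' ≤ M.agentPayoff P τ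

/-- The policies `(P, I, τ)` available to the principal at the prior `q₀`: the canonical process is
a martingale under `P` started at `q₀`, and, up to the stopping time `τ`, the increasing adapted
process `I` is the cumulative information acquired and grows at most at the rate `χ`. The law of
motion of `I` is written in integrated form: on every time interval, stopped at `τ`, the conditional
expected increments of `H` along the belief process and of `I` agree. -/
structure Model.IsAdmissible (M : Model X A) (q₀ : Belief X) (P : Measure (BeliefPath X))
    (I : ℝ≥0 → BeliefPath X → ℝ) (τ : BeliefPath X → ℝ≥0∞) : Prop where
  prob : IsProbabilityMeasure P
  martingale : Martingale (fun t (w : BeliefPath X) => (canon t w).1) (canonFiltration X) P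
  start : ∀ᵐ w ∂P, canon 0 w = q₀
  adapted : StronglyAdapted (canonFiltration X) I
  increasing : ∀ᵐ w ∂P, Monotone (fun t => I t w)
  start_info : ∀ᵐ w ∂P, I 0 w = 0
  stopping : IsStoppingTime (canonFiltration X) τ
  finite : ∀ᵐ w ∂P, τ w < ∞
  cumulative : ∀ s t : ℝ≥0, s ≤ t →
    P[fun w => M.H (canon (truncTime τ t w) w).1 - M.H (canon (truncTime τ s w) w).1 |
        canonFiltration X s]
      =ᵐ[P] P[fun w => I (truncTime τ t w) w - I (truncTime τ s w) w | canonFiltration X s]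
  capacity : ∀ᵐ w ∂P, ∀ s t : ℝ≥0, s ≤ t → (t : ℝ≥0∞) ≤ τ w →
    I t w - I s w ≤ M.χ * ((t : ℝ) - (s : ℝ))

/-- The principal's payoff (engagement). -/
def Model.engagement (M : Model X A) (P : Measure (BeliefPath X))
    (I : ℝ≥0 → BeliefPath X → ℝ) (τ : BeliefPath X → ℝ≥0∞) : ℝ :=
  M.ρ * ∫ w, I (τ w).toNNReal w ∂P

/-- `(P, I, τ)` solves the principal's problem at the prior `q₀`: it maximizes engagement among the
admissible policies whose stopping time is optimal for the agent. -/
structure Model.IsPrincipalSolution (M : Model X A) (q₀ : Belief X) (P : Measure (BeliefPath X))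
    (I : ℝ≥0 → BeliefPath X → ℝ) (τ : BeliefPath X → ℝ≥0∞) : Prop where
  admissible : M.IsAdmissible q₀ P I τ
  incentive : M.IsAgentOptimal P τ
  optimal : ∀ (P' : Measure (BeliefPath X)) (I' : ℝ≥0 → BeliefPath X → ℝ)
    (τ' : BeliefPath X → ℝ≥0∞), M.IsAdmissible q₀ P' I' τ' → M.IsAgentOptimal P' τ' →
    M.engagement P' I' τ' ≤ M.engagement P I τ

end DynamicPart

end Engagement

end

/-! One measure serves for all three claims: the law `π` of the belief at `τ`. Write `g` for
`netValue`, the payoff net of the entropy cost `κ/χ · H`.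

The law `π` solves the relaxed problem. It is feasible because the expected entropy gain equals
`E[I_τ]`, which is at most `χ E[τ]`, while the option of stopping at once bounds `κ E[τ]` by the
expected gain in `uhat`. It is optimal because every feasible value is reached by an obedient
policy: wait at `q₀` for an exponential time, then jump once to the desired posterior.
Memorylessness makes waiting worthwhile at every date before the jump if it is so at date 0
(`exists_policy_of_feasible`).

The participation constraint binds (`Model.IsRelaxedSolution.binding`): with slack one could mix in
full information, and perfect learning is too costly for this to be unprofitable. Binding forces
equality in the chain above, so capacity is exhausted: `I_τ = χ τ` almost surely
(`Model.IsAdmissible.info_eq_capacity`).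

Varying the density of `π` yields a multiplier `θ ≥ 0` such that `H + θ g` agrees with an affine
function `ℓ` on the support of `π` (`Model.IsRelaxedSolution.first_order`). Let `Γ = ℓ - θ g - H`.
Optional stopping preserves `ℓ`, obedience raises `g` in conditional mean, and exhausted capacity
turns entropy into time; hence `χ E[τ - s | F_s] ≤ Γ(q_s)` while `s ≤ τ`. A maximal inequality then
prevents `Γ(q_t) = 0` at any `t < τ`, so the belief avoids the support of `π`, where `Γ` vanishes,
before stopping (`ae_forall_ne_zero_of_remaining_time_le`).

Finally, the conditional mean of `(q_τ, g(q_τ))` given the past lies in the convex hull of the graph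
of `g` over the support, with first component `q_s` and second at least `g(q_s)`. Thus `q_s` belongs
to the closed set `worthwhile`, at all dates at once by right-continuity
(`Model.IsAdmissible.ae_mem_worthwhile`, `ae_forall_mem_of_isClosed`). A worthwhile belief off the
support is suspensive. -/

namespace Engagement

/-! ### Convex hulls of compact sets -/

/-- By Carathéodory, affinely independent combinations suffice, so the number of points is at most
the dimension plus one. The hull is then a finite union of continuous images of the compact sets
simplex × `K^n`. -/
theorem isCompact_convexHull_of_isCompact {E : Type*} [NormedAddCommGroup E] [NormedSpace ℝ E]
    [FiniteDimensional ℝ E] {K : Set E} (hK : IsCompact K) : IsCompact (convexHull ℝ K) := by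
  let F : ∀ n : ℕ, (Fin n → ℝ) × (Fin n → E) → E := fun n p => ∑ i, p.1 i • p.2 i
  have hF : ∀ n, Continuous (F n) := fun n => by fun_prop
  have hC : ∀ n, IsCompact (F n '' (stdSimplex ℝ (Fin n) ×ˢ Set.univ.pi fun _ => K)) := fun n =>
    ((isCompact_stdSimplex ℝ (Fin n)).prod (isCompact_univ_pi fun _ => hK)).image (hF n)
  have hEq : convexHull ℝ K = ⋃ n ∈ Finset.range (Module.finrank ℝ E + 2),
      F n '' (stdSimplex ℝ (Fin n) ×ˢ Set.univ.pi fun _ => K) := by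
    apply Set.Subset.antisymm
    · intro x hx
      obtain ⟨ι, hι, z, w, hz, hind, hw, hsum, rfl⟩ := eq_pos_convex_span_of_mem_convexHull hx
      have hcard := hind.card_le_finrank_succ
      have hle : Module.finrank ℝ (vectorSpan ℝ (Set.range z)) ≤ Module.finrank ℝ E :=
        Submodule.finrank_le _
      let e := Fintype.equivFin ι
      refine Set.mem_biUnion (x := Fintype.card ι) ?_ ⟨(w ∘ e.symm, z ∘ e.symm), ⟨⟨?_, ?_⟩, ?_⟩, ?_⟩
      · simp only [Finset.coe_range, Set.mem_Iio]; omega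
      · exact fun i => (hw _).le
      · rw [← hsum]; exact e.symm.sum_comp w
      · exact fun i _ => hz ⟨_, rfl⟩
      · exact e.symm.sum_comp fun i => w i • z i
    · refine Set.iUnion₂_subset fun n _ => ?_
      rintro _ ⟨⟨w, z⟩, ⟨hw, hz⟩, rfl⟩
      exact (convex_convexHull ℝ K).sum_mem (fun i _ => hw.1 i) hw.2
        fun i _ => subset_convexHull ℝ K (hz i trivial)
  rw [hEq]
  exact Finset.isCompact_biUnion _ fun n _ => hC n

/-! ### Integrals of continuous functions of the belief -/

section Static

variable {X A : Type*} [Fintype X]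

theorem integrable_of_continuous (π : Measure (Belief X)) [IsFiniteMeasure π] {φ : Belief X → ℝ}
    (hφ : Continuous φ) : Integrable φ π :=
  hφ.integrable_of_hasCompactSupport (HasCompactSupport.of_compactSpace φ)

theorem integrable_mul_of_continuous (π : Measure (Belief X)) [IsFiniteMeasure π]
    {φ ψ : Belief X → ℝ} (hφ : Continuous φ) (hψ : Continuous ψ) :
    Integrable (fun q => φ q * ψ q) π :=
  integrable_of_continuous π (hφ.mul hψ)

theorem continuous_coord (x : X) : Continuous fun q : Belief X => q.1 x :=
  (continuous_apply x).comp continuous_subtype_val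

theorem sum_coord (q : Belief X) : ∑ x, q.1 x = 1 := q.2.2

/-- The `L²(π)`-projection on the space of affine functions. -/
theorem exists_orthogonal_affine (π : Measure (Belief X)) [IsFiniteMeasure π]
    {φ : Belief X → ℝ} (hφ : Continuous φ) :
    ∃ c : X → ℝ, ∀ x, ∫ q, q.1 x * (φ q - ∑ y, c y * q.1 y) ∂π = 0 := by
  let T := ContinuousMap.toLp (α := Belief X) (E := ℝ) 2 π ℝ
  let e : X → C(Belief X, ℝ) := fun x => ⟨fun q => q.1 x, continuous_coord x⟩
  -- On beliefs the coordinates sum to one, so their span contains the constants and hence all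
  -- affine functions.
  let V : Submodule ℝ (Lp ℝ 2 π) := Submodule.span ℝ (Set.range fun x => T (e x))
  have : FiniteDimensional ℝ V := FiniteDimensional.span_of_finite ℝ (Set.finite_range _)
  let f : C(Belief X, ℝ) := ⟨φ, hφ⟩
  obtain ⟨c, hc⟩ := (Submodule.mem_span_range_iff_exists_fun ℝ).1
    (Submodule.starProjection_apply_mem V (T f))
  refine ⟨c, fun x => ?_⟩
  have h := Submodule.starProjection_inner_eq_zero (K := V) (T f) (T (e x))
    (Submodule.subset_span ⟨x, rfl⟩)
  have h2 : T f - V.starProjection (T f) = T (f - ∑ y, c y • e y) := by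
    rw [← hc, map_sub, map_sum]; simp
  rw [h2, ContinuousMap.inner_toLp] at h
  simpa [e, f] using h

theorem eqOn_support_of_integral_sq_eq_zero {π : Measure (Belief X)} [IsFiniteMeasure π]
    {h : Belief X → ℝ} (hh : Continuous h) (h0 : ∫ q, h q * h q ∂π = 0) :
    ∀ q ∈ π.support, h q = 0 := by
  have h1 : (fun q => h q * h q) =ᵐ[π] 0 :=
    (integral_eq_zero_iff_of_nonneg (fun q => mul_self_nonneg _)
      (integrable_mul_of_continuous π hh hh)).1 h0
  have hcl : IsClosed {q | h q = 0} := isClosed_eq hh continuous_const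
  have hsub := Measure.support_subset_of_isClosed (μ := π) hcl
    (h1.mono fun q hq => by simpa using hq)
  exact fun q hq => hsub hq

/-- First-order conditions: if no perturbation that keeps the barycenter and does not lower the
integral of `g` raises the integral of `H`, then a combination `H + θ g` with `θ ≥ 0` is affine on
the support. -/
theorem exists_affine_eq_on_support {π : Measure (Belief X)} [IsFiniteMeasure π]
    {H g : Belief X → ℝ} (hH : Continuous H) (hg : Continuous g)
    (hopt : ∀ h : Belief X → ℝ, Continuous h → (∀ x, ∫ q, q.1 x * h q ∂π = 0) →
      0 ≤ ∫ q, g q * h q ∂π → ∫ q, H q * h q ∂π ≤ 0) :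
    ∃ (c : X → ℝ) (θ : ℝ), 0 ≤ θ ∧ ∀ q ∈ π.support, H q + θ * g q = ∑ x, c x * q.1 x := by
  obtain ⟨a, ha⟩ := exists_orthogonal_affine π hH
  obtain ⟨b, hb⟩ := exists_orthogonal_affine π hg
  have hAc : ∀ c : X → ℝ, Continuous fun q : Belief X => ∑ y, c y * q.1 y := fun c =>
    continuous_finsetSum _ fun y _ => continuous_const.mul (continuous_coord y)
  -- Residuals modulo affine functions. Admissible directions `h` are orthogonal to affine
  -- functions, so they see only these residuals.
  set Hp : Belief X → ℝ := fun q => H q - ∑ y, a y * q.1 y with hHp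
  set gp : Belief X → ℝ := fun q => g q - ∑ y, b y * q.1 y with hgp
  have cHp : Continuous Hp := hH.sub (hAc a)
  have cgp : Continuous gp := hg.sub (hAc b)
  -- orthogonality to affine functions
  have horth : ∀ (c : X → ℝ) (h : Belief X → ℝ), Continuous h →
      (∀ x, ∫ q, q.1 x * h q ∂π = 0) → ∫ q, (∑ y, c y * q.1 y) * h q ∂π = 0 := by
    intro c h ch h0
    have : (fun q : Belief X => (∑ y, c y * q.1 y) * h q)
        = fun q => ∑ y, c y * (q.1 y * h q) := by
      ext q; rw [Finset.sum_mul]; exact Finset.sum_congr rfl fun y _ => by ring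
    rw [this, integral_finsetSum _ fun y _ =>
      (integrable_mul_of_continuous π (continuous_coord y) ch).const_mul _]
    exact Finset.sum_eq_zero fun y _ => by rw [integral_const_mul, h0, mul_zero]
  have hHs : ∀ h : Belief X → ℝ, Continuous h → (∀ x, ∫ q, q.1 x * h q ∂π = 0) →
      ∫ q, H q * h q ∂π = ∫ q, Hp q * h q ∂π := by
    intro h ch h0
    have e1 : (fun q => H q * h q) = fun q => Hp q * h q + (∑ y, a y * q.1 y) * h q := by
      ext q; simp only [hHp]; ring
    rw [e1, integral_add (integrable_mul_of_continuous π cHp ch)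
      (integrable_mul_of_continuous π (hAc a) ch), horth a h ch h0, add_zero]
  have hgs : ∀ h : Belief X → ℝ, Continuous h → (∀ x, ∫ q, q.1 x * h q ∂π = 0) →
      ∫ q, g q * h q ∂π = ∫ q, gp q * h q ∂π := by
    intro h ch h0
    have e1 : (fun q => g q * h q) = fun q => gp q * h q + (∑ y, b y * q.1 y) * h q := by
      ext q; simp only [hgp]; ring
    rw [e1, integral_add (integrable_mul_of_continuous π cgp ch)
      (integrable_mul_of_continuous π (hAc b) ch), horth b h ch h0, add_zero]
  have hopt' : ∀ h : Belief X → ℝ, Continuous h → (∀ x, ∫ q, q.1 x * h q ∂π = 0) →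
      0 ≤ ∫ q, gp q * h q ∂π → ∫ q, Hp q * h q ∂π ≤ 0 := fun h ch h0 h1 => by
    rw [← hHs h ch h0]; exact hopt h ch h0 (by rwa [hgs h ch h0])
  -- Degenerate case: `g` is affine on the support, so the inequality constraint is vacuous, `Hp`
  -- itself is an admissible direction, and `θ = 0` works.
  by_cases hG : ∫ q, gp q * gp q ∂π = 0
  · have h1 := eqOn_support_of_integral_sq_eq_zero cgp hG
    have h2 : ∫ q, gp q * Hp q ∂π = 0 := by
      rw [← integral_zero (Belief X) ℝ (μ := π)]
      refine integral_congr_ae ?_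
      filter_upwards [Measure.support_mem_ae (μ := π)] with q hq
      simp [h1 q hq]
    have h3 : ∫ q, Hp q * Hp q ∂π = 0 :=
      le_antisymm (hopt' Hp cHp ha h2.ge) (integral_nonneg fun q => mul_self_nonneg _)
    refine ⟨a, 0, le_rfl, fun q hq => ?_⟩
    have := eqOn_support_of_integral_sq_eq_zero cHp h3 q hq
    simp only [hHp] at this; linarith
  · have hGpos : 0 < ∫ q, gp q * gp q ∂π :=
      lt_of_le_of_ne (integral_nonneg fun q => mul_self_nonneg _) (Ne.symm hG)
    have h1 : ∫ q, Hp q * gp q ∂π ≤ 0 := hopt' gp cgp hb hGpos.le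
    -- Minus the regression coefficient of `Hp` on `gp`, so that `Hp + θ gp` is orthogonal to `gp`.
    -- It is nonnegative because `gp` is an admissible direction.
    set θ : ℝ := -(∫ q, Hp q * gp q ∂π) / ∫ q, gp q * gp q ∂π with hθ
    have hθ0 : 0 ≤ θ := div_nonneg (by linarith) hGpos.le
    have hθe : θ * ∫ q, gp q * gp q ∂π = -∫ q, Hp q * gp q ∂π := by
      rw [hθ, div_mul_cancel₀ _ hG]
    have ch : Continuous fun q => Hp q + θ * gp q := cHp.add (continuous_const.mul cgp)
    have horthh : ∀ x, ∫ q, q.1 x * (Hp q + θ * gp q) ∂π = 0 := by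
      intro x
      have e1 : (fun q : Belief X => q.1 x * (Hp q + θ * gp q))
          = fun q => q.1 x * Hp q + θ * (q.1 x * gp q) := by ext q; ring
      rw [e1, integral_add (integrable_mul_of_continuous π (continuous_coord x) cHp)
        ((integrable_mul_of_continuous π (continuous_coord x) cgp).const_mul _),
        integral_const_mul, ha x, hb x]; simp
    have hgh : ∫ q, gp q * (Hp q + θ * gp q) ∂π = 0 := by
      have e1 : (fun q : Belief X => gp q * (Hp q + θ * gp q))
          = fun q => Hp q * gp q + θ * (gp q * gp q) := by ext q; ring
      rw [e1, integral_add (integrable_mul_of_continuous π cHp cgp)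
        ((integrable_mul_of_continuous π cgp cgp).const_mul _), integral_const_mul, hθe]
      ring
    have h2 := hopt' _ ch horthh hgh.ge
    -- By orthogonality to `gp`, the squared norm of `Hp + θ gp` equals its pairing with `Hp`, which
    -- optimality makes nonpositive.
    have h3 : ∫ q, (Hp q + θ * gp q) * (Hp q + θ * gp q) ∂π = 0 := by
      refine le_antisymm ?_ (integral_nonneg fun q => mul_self_nonneg _)
      have e1 : (fun q : Belief X => (Hp q + θ * gp q) * (Hp q + θ * gp q))
          = fun q => Hp q * (Hp q + θ * gp q) + θ * (gp q * (Hp q + θ * gp q)) := by ext q; ring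
      rw [e1, integral_add (integrable_mul_of_continuous π cHp ch)
        ((integrable_mul_of_continuous π cgp ch).const_mul _), integral_const_mul, hgh]
      linarith
    refine ⟨fun x => a x + θ * b x, θ, hθ0, fun q hq => ?_⟩
    have := eqOn_support_of_integral_sq_eq_zero ch h3 q hq
    have e2 : ∑ x, (a x + θ * b x) * q.1 x = ∑ x, a x * q.1 x + θ * ∑ x, b x * q.1 x := by
      rw [Finset.mul_sum, ← Finset.sum_add_distrib]
      exact Finset.sum_congr rfl fun x _ => by ring
    rw [e2]; simp only [hHp, hgp] at this; linarith

variable [Fintype A] [Nonempty A]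

/-! ### The relaxed problem -/

/-- The gross payoff net of the cost of information. -/
noncomputable def Model.netValue (M : Model X A) (q : Belief X) : ℝ :=
  M.uhat q - M.κ / M.χ * M.H q.1

theorem Model.continuous_uhat (M : Model X A) : Continuous M.uhat := by
  unfold Model.uhat
  exact Continuous.finset_sup'_apply _ fun a _ =>
    continuous_finsetSum _ fun x _ => (continuous_coord x).mul continuous_const

theorem Model.continuous_H (M : Model X A) (hH : ContinuousOn M.H (stdSimplex ℝ X)) :
    Continuous fun q : Belief X => M.H q.1 :=
  hH.comp_continuous continuous_subtype_val fun q => q.2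

theorem Model.continuous_netValue (M : Model X A) (hH : ContinuousOn M.H (stdSimplex ℝ X)) :
    Continuous M.netValue :=
  M.continuous_uhat.sub (continuous_const.mul (M.continuous_H hH))

theorem integral_sub_const (π : Measure (Belief X)) [IsProbabilityMeasure π] {φ : Belief X → ℝ}
    (hφ : Continuous φ) (a : ℝ) : ∫ q, (φ q - a) ∂π = (∫ q, φ q ∂π) - a := by
  rw [integral_sub (integrable_of_continuous π hφ) (integrable_const _)]; simp

theorem Model.isRelaxedFeasible_iff (M : Model X A) (hH : ContinuousOn M.H (stdSimplex ℝ X))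
    {q₀ : Belief X} {π : Measure (Belief X)} :
    M.IsRelaxedFeasible q₀ π ↔ IsBayesPlausible q₀ π ∧ M.netValue q₀ ≤ ∫ q, M.netValue q ∂π := by
  have key : IsBayesPlausible q₀ π →
      (M.κ / M.χ * ∫ q, (M.H q.1 - M.H q₀.1) ∂π ≤ ∫ q, (M.uhat q - M.uhat q₀) ∂π ↔
        M.netValue q₀ ≤ ∫ q, M.netValue q ∂π) := by
    intro h
    have := h.prob
    rw [integral_sub_const π (M.continuous_H hH), integral_sub_const π M.continuous_uhat]
    unfold Model.netValue
    rw [integral_sub (integrable_of_continuous π M.continuous_uhat)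
      ((integrable_of_continuous π (M.continuous_H hH)).const_mul _), integral_const_mul]
    constructor <;> intro h <;> linarith
  exact ⟨fun h => ⟨h.plausible, (key h.plausible).1 h.constraint⟩,
    fun h => ⟨h.1, (key h.1).2 h.2⟩⟩

theorem Model.IsRelaxedSolution.integral_le {M : Model X A}
    (hH : ContinuousOn M.H (stdSimplex ℝ X)) (hρ : 0 < M.ρ) {q₀ : Belief X}
    {π : Measure (Belief X)} (h : M.IsRelaxedSolution q₀ π) {π' : Measure (Belief X)}
    (h' : M.IsRelaxedFeasible q₀ π') : ∫ q, M.H q.1 ∂π' ≤ ∫ q, M.H q.1 ∂π := by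
  have hle := le_of_mul_le_mul_left (h.optimal π' h') hρ
  have := h.feasible.plausible.prob
  have := h'.plausible.prob
  rw [integral_sub_const _ (M.continuous_H hH), integral_sub_const _ (M.continuous_H hH)] at hle
  linarith

/-! ### First-order conditions for the relaxed problem -/

/-- Reweighting of a measure by a density of the form `1 + h` with `|h| ≤ 1`. -/
theorem integral_reweight (π : Measure (Belief X)) [IsFiniteMeasure π] {h φ : Belief X → ℝ}
    (ch : Continuous h) (h1 : ∀ q, |h q| ≤ 1) (cφ : Continuous φ) :
    ∫ q, φ q ∂(π.withDensity fun q => ENNReal.ofReal (1 + h q))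
      = (∫ q, φ q ∂π) + ∫ q, φ q * h q ∂π := by
  rw [integral_withDensity_eq_integral_toReal_smul (by fun_prop) (by simp),
    ← integral_add (integrable_of_continuous π cφ) (integrable_mul_of_continuous π cφ ch)]
  refine integral_congr_ae (ae_of_all _ fun q => ?_)
  have := (abs_le.1 (h1 q)).1
  simp only [smul_eq_mul]
  rw [ENNReal.toReal_ofReal (by linarith)]; ring

/-- A bounded direction `h`, scaled down, gives the competitor with density `1 + h / N'`. If `h`
keeps the barycenter and does not lower the integral of `netValue`, the competitor is feasible and
cannot raise the integral of `H`; this is the hypothesis of `exists_affine_eq_on_support`. -/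
theorem Model.IsRelaxedSolution.first_order {M : Model X A}
    (hH : ContinuousOn M.H (stdSimplex ℝ X)) (hρ : 0 < M.ρ) {q₀ : Belief X}
    {π : Measure (Belief X)} (hπ : M.IsRelaxedSolution q₀ π) :
    ∃ (c : X → ℝ) (θ : ℝ), 0 ≤ θ ∧
      ∀ q ∈ π.support, M.H q.1 + θ * M.netValue q = ∑ x, c x * q.1 x := by
  have := hπ.feasible.plausible.prob
  have hf := (M.isRelaxedFeasible_iff hH).1 hπ.feasible
  refine exists_affine_eq_on_support (M.continuous_H hH) (M.continuous_netValue hH) ?_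
  intro h ch h0 hg
  obtain ⟨N, hN⟩ := isCompact_univ.exists_bound_of_continuousOn (f := h) ch.continuousOn
  -- The maximum with 1 keeps the divisor positive even when `h` vanishes.
  set N' := max N 1
  have hN' : 0 < N' := lt_of_lt_of_le one_pos (le_max_right _ _)
  have ch' : Continuous fun q => h q / N' := ch.div_const _
  have hb : ∀ q, |h q / N'| ≤ 1 := fun q => by
    rw [abs_div, abs_of_pos hN', div_le_one hN']
    exact (hN q trivial).trans (le_max_left _ _)
  have hint : ∀ φ : Belief X → ℝ, ∫ q, φ q * (h q / N') ∂π = (∫ q, φ q * h q ∂π) / N' := fun φ => by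
    rw [← integral_div]; exact integral_congr_ae (ae_of_all _ fun q => by ring)
  set π' := π.withDensity fun q => ENNReal.ofReal (1 + h q / N') with hπ'
  have hmean : ∀ x, ∫ q, q.1 x ∂π' = q₀.1 x := fun x => by
    rw [hπ', integral_reweight π ch' hb (continuous_coord x), hint, h0, hf.1.mean]; simp
  -- Since coordinates sum to one, preserving the barycenter also preserves the total mass.
  have hone : ∫ q, h q ∂π = 0 := by
    have : ∀ q, h q = ∑ x, q.1 x * h q := fun q => by
      rw [← Finset.sum_mul, sum_coord, one_mul]
    rw [integral_congr_ae (ae_of_all _ this), integral_finsetSum _ fun y _ =>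
      integrable_mul_of_continuous π (continuous_coord y) ch]
    exact Finset.sum_eq_zero fun x _ => h0 x
  have hprob : IsProbabilityMeasure π' := by
    constructor
    rw [hπ', withDensity_apply _ MeasurableSet.univ, Measure.restrict_univ,
      ← ofReal_integral_eq_lintegral_ofReal
        (f := fun q => 1 + h q / N') (integrable_of_continuous π (continuous_const.add ch'))
        (ae_of_all _ fun q => by have := (abs_le.1 (hb q)).1; simp only [Pi.zero_apply]; linarith),
      integral_add (integrable_const _) (integrable_of_continuous π ch'), integral_div, hone]
    simp
  have hfeas : M.IsRelaxedFeasible q₀ π' := by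
    rw [M.isRelaxedFeasible_iff hH]
    refine ⟨⟨hprob, hmean⟩, ?_⟩
    rw [hπ', integral_reweight π ch' hb (M.continuous_netValue hH), hint]
    have := div_nonneg hg hN'.le
    linarith [hf.2]
  have h3 := hπ.integral_le hH hρ hfeas
  rw [hπ', integral_reweight π ch' hb (M.continuous_H hH), hint] at h3
  by_contra hcon
  have := div_pos (not_le.1 hcon) hN'
  linarith

/-! ### Full information and the binding participation constraint -/

theorem Model.uhat_le_sum_pointBelief [DecidableEq X] (M : Model X A) (q : Belief X) :
    M.uhat q ≤ ∑ x, q.1 x * M.uhat (pointBelief x) := by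
  refine Finset.sup'_le _ _ fun a _ => Finset.sum_le_sum fun x _ => ?_
  refine mul_le_mul_of_nonneg_left ?_ (q.2.1 x)
  refine le_trans (le_of_eq ?_) (Finset.le_sup' (fun a : A => ∑ y, (pointBelief x).1 y * M.u a y)
    (Finset.mem_univ a))
  simp [pointBelief, Pi.single_apply]

theorem integral_le_sum_pointBelief [DecidableEq X] {q₀ : Belief X} {π : Measure (Belief X)}
    (hπ : IsBayesPlausible q₀ π) {φ : Belief X → ℝ} (cφ : Continuous φ) (b : X → ℝ)
    (hφ : ∀ q : Belief X, φ q ≤ ∑ x, q.1 x * b x) : ∫ q, φ q ∂π ≤ ∑ x, q₀.1 x * b x := by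
  have := hπ.prob
  have hi : ∀ x, Integrable (fun q : Belief X => q.1 x * b x) π := fun x =>
    (integrable_of_continuous π (continuous_coord x)).mul_const _
  calc ∫ q, φ q ∂π ≤ ∫ q, ∑ x, q.1 x * b x ∂π :=
        integral_mono (integrable_of_continuous π cφ) (integrable_finsetSum _ fun x _ => hi x) hφ
    _ = ∑ x, q₀.1 x * b x := by
        rw [integral_finsetSum _ fun x _ => hi x]
        exact Finset.sum_congr rfl fun x _ => by rw [integral_mul_const, hπ.mean]

/-- The distribution of beliefs when the state is fully revealed. -/
noncomputable def fullInfo [DecidableEq X] (q₀ : Belief X) : Measure (Belief X) :=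
  ∑ x, ENNReal.ofReal (q₀.1 x) • Measure.dirac (pointBelief x)

theorem integral_fullInfo [DecidableEq X] (q₀ : Belief X) (φ : Belief X → ℝ) :
    ∫ q, φ q ∂(fullInfo q₀) = ∑ x, q₀.1 x * φ (pointBelief x) := by
  unfold fullInfo
  rw [integral_finsetSum_measure]
  · refine Finset.sum_congr rfl fun x _ => ?_
    rw [integral_smul_measure, integral_dirac, ENNReal.toReal_ofReal (q₀.2.1 x), smul_eq_mul]
  · exact fun x _ => (integrable_dirac (by simp)).smul_measure ENNReal.ofReal_ne_top

theorem isBayesPlausible_fullInfo [DecidableEq X] (q₀ : Belief X) :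
    IsBayesPlausible q₀ (fullInfo q₀) := by
  refine ⟨⟨?_⟩, fun x => ?_⟩
  · simp only [fullInfo, Measure.coe_finsetSum, Finset.sum_apply, Measure.smul_apply,
      measure_univ, smul_eq_mul, mul_one]
    rw [← ENNReal.ofReal_sum_of_nonneg fun x _ => q₀.2.1 x, sum_coord, ENNReal.ofReal_one]
  · rw [integral_fullInfo]
    simp [pointBelief, Pi.single_apply]

theorem integral_mix {π π' : Measure (Belief X)} [IsFiniteMeasure π] [IsFiniteMeasure π']
    {ε : ℝ} (h0 : 0 ≤ ε) (h1 : ε ≤ 1) {φ : Belief X → ℝ} (cφ : Continuous φ) :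
    ∫ q, φ q ∂(ENNReal.ofReal (1 - ε) • π + ENNReal.ofReal ε • π')
      = (1 - ε) * ∫ q, φ q ∂π + ε * ∫ q, φ q ∂π' := by
  rw [integral_add_measure ((integrable_of_continuous π cφ).smul_measure ENNReal.ofReal_ne_top)
    ((integrable_of_continuous π' cφ).smul_measure ENNReal.ofReal_ne_top),
    integral_smul_measure, integral_smul_measure, ENNReal.toReal_ofReal (by linarith),
    ENNReal.toReal_ofReal h0, smul_eq_mul, smul_eq_mul]

theorem IsBayesPlausible.mix {q₀ : Belief X} {π π' : Measure (Belief X)}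
    (hπ : IsBayesPlausible q₀ π) (hπ' : IsBayesPlausible q₀ π') {ε : ℝ} (h0 : 0 ≤ ε)
    (h1 : ε ≤ 1) : IsBayesPlausible q₀ (ENNReal.ofReal (1 - ε) • π + ENNReal.ofReal ε • π') := by
  have := hπ.prob
  have := hπ'.prob
  refine ⟨⟨?_⟩, fun x => ?_⟩
  · simp only [Measure.coe_add, Measure.coe_smul, Pi.add_apply, Pi.smul_apply, measure_univ,
      smul_eq_mul, mul_one]
    rw [← ENNReal.ofReal_add (by linarith) h0]; simp
  · rw [integral_mix h0 h1 (continuous_coord x), hπ.mean, hπ'.mean]; ring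

/-- When full information is too costly, the participation constraint binds. -/
theorem Model.IsRelaxedSolution.binding [DecidableEq X] {M : Model X A}
    (hκχ : 0 < M.κ / M.χ) (hH : ContinuousOn M.H (stdSimplex ℝ X)) (hρ : 0 < M.ρ)
    {q₀ : Belief X}
    (h_imperfect : ∑ x, q₀.1 x * (M.uhat (pointBelief x)
        - M.κ / M.χ * M.H (pointBelief x).1) < M.uhat q₀ - M.κ / M.χ * M.H q₀.1)
    {π : Measure (Belief X)} (hπ : M.IsRelaxedSolution q₀ π) :
    ∫ q, M.netValue q ∂π = M.netValue q₀ := by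
  have hf := (M.isRelaxedFeasible_iff hH).1 hπ.feasible
  have := hf.1.prob
  have hF := isBayesPlausible_fullInfo q₀
  have := hF.prob
  refine le_antisymm (not_lt.1 fun hlt => ?_) hf.2
  have cg := M.continuous_netValue hH
  have cH := M.continuous_H hH
  have hgF : ∫ q, M.netValue q ∂(fullInfo q₀) < M.netValue q₀ := by
    rw [integral_fullInfo]; exact h_imperfect
  set d := ∫ q, M.netValue q ∂π with hd
  set dF := ∫ q, M.netValue q ∂(fullInfo q₀) with hdF
  -- the largest share of full information compatible with the constraint
  set ε := (d - M.netValue q₀) / (d - dF) with hε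
  have hden : 0 < d - dF := by linarith
  have hε0 : 0 < ε := div_pos (by linarith) hden
  have hε1 : ε ≤ 1 := (div_le_one hden).2 (by linarith)
  have hεe : ε * (d - dF) = d - M.netValue q₀ := div_mul_cancel₀ _ hden.ne'
  have hmix : M.IsRelaxedFeasible q₀
      (ENNReal.ofReal (1 - ε) • π + ENNReal.ofReal ε • fullInfo q₀) := by
    rw [M.isRelaxedFeasible_iff hH]
    refine ⟨hf.1.mix hF hε0.le hε1, ?_⟩
    rw [integral_mix hε0.le hε1 cg]
    nlinarith
  have h1 := hπ.integral_le hH hρ hmix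
  rw [integral_mix hε0.le hε1 cH] at h1
  -- The mixture gives positive weight `ε` to full information; if full information had more entropy
  -- than `π`, the mixture would beat `π`.
  have hle : ∫ q, M.H q.1 ∂(fullInfo q₀) ≤ ∫ q, M.H q.1 ∂π := by
    by_contra hcon
    nlinarith [mul_pos hε0 (sub_pos.2 (not_le.1 hcon))]
  rw [integral_fullInfo] at hle
  -- Full information maximizes expected `uhat`. Being no costlier than `π`, it would have net value
  -- at least `d`, whereas `dF < M.netValue q₀ < d`.
  have hu := integral_le_sum_pointBelief hf.1 M.continuous_uhat _ M.uhat_le_sum_pointBelief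
  have hde : d = ∫ q, M.uhat q ∂π - M.κ / M.χ * ∫ q, M.H q.1 ∂π := by
    rw [hd]; unfold Model.netValue
    rw [integral_sub (integrable_of_continuous π M.continuous_uhat)
      ((integrable_of_continuous π cH).const_mul _), integral_const_mul]
  have hdFe : dF = ∑ x, q₀.1 x * M.uhat (pointBelief x)
      - M.κ / M.χ * ∑ x, q₀.1 x * M.H (pointBelief x).1 := by
    rw [hdF, integral_fullInfo, Finset.mul_sum, ← Finset.sum_sub_distrib]
    exact Finset.sum_congr rfl fun x _ => by unfold Model.netValue; ring
  have := mul_le_mul_of_nonneg_left hle hκχ.le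
  linarith

/-! ### The set of beliefs at which continuing on a set of posteriors is worthwhile -/

/-- Beliefs at which some distribution of posteriors on `K` has a nonnegative net value. -/
def Model.worthwhile (M : Model X A) (K : Set (Belief X)) : Set (Belief X) :=
  {q | ∃ v : ℝ, M.netValue q ≤ v ∧
    (q.1, v) ∈ convexHull ℝ ((fun q' : Belief X => (q'.1, M.netValue q')) '' K)}

theorem Model.isCompact_graph_hull (M : Model X A) (hH : ContinuousOn M.H (stdSimplex ℝ X))
    {K : Set (Belief X)} (hK : IsClosed K) :
    IsCompact (convexHull ℝ ((fun q' : Belief X => (q'.1, M.netValue q')) '' K)) :=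
  isCompact_convexHull_of_isCompact (hK.isCompact.image
    (continuous_subtype_val.prodMk (M.continuous_netValue hH)))

/-- It is the projection of a compact set of pairs `(q, v)`: beliefs form a compact space, and `v`
ranges over a compact projection of the hull of the graph. -/
theorem Model.isClosed_worthwhile (M : Model X A) (hH : ContinuousOn M.H (stdSimplex ℝ X))
    {K : Set (Belief X)} (hK : IsClosed K) : IsClosed (M.worthwhile K) := by
  have hC := M.isCompact_graph_hull hH hK
  set C := convexHull ℝ ((fun q' : Belief X => (q'.1, M.netValue q')) '' K) with hCdef
  have hS : IsCompact ((Set.univ : Set (Belief X)) ×ˢ (Prod.snd '' C)) :=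
    isCompact_univ.prod (hC.image continuous_snd)
  have hT : IsClosed {p : Belief X × ℝ | M.netValue p.1 ≤ p.2 ∧ (p.1.1, p.2) ∈ C} :=
    (isClosed_le ((M.continuous_netValue hH).comp continuous_fst) continuous_snd).inter
      (hC.isClosed.preimage (by fun_prop))
  have : M.worthwhile K = Prod.fst '' (((Set.univ : Set (Belief X)) ×ˢ (Prod.snd '' C)) ∩
      {p : Belief X × ℝ | M.netValue p.1 ≤ p.2 ∧ (p.1.1, p.2) ∈ C}) := by
    ext q
    constructor
    · rintro ⟨v, h1, h2⟩
      exact ⟨(q, v), ⟨⟨trivial, ⟨_, h2, rfl⟩⟩, h1, h2⟩, rfl⟩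
    · rintro ⟨⟨q', v⟩, ⟨-, h1, h2⟩, rfl⟩
      exact ⟨v, h1, h2⟩
  rw [this]
  exact ((hS.inter_right hT).image continuous_fst).isClosed

/-- A point of the hull is a finite mixture of points of the graph. Its weights define a finitely
supported distribution of posteriors with barycenter `q` and nonnegative net gain. -/
theorem Model.mem_suspensive_of_worthwhile (M : Model X A)
    (hH : ContinuousOn M.H (stdSimplex ℝ X)) {π : Measure (Belief X)} {q : Belief X}
    (hq : q ∈ M.worthwhile π.support) (hns : q ∉ π.support) : q ∈ M.suspensive π := by
  obtain ⟨v, hv, hmem⟩ := hq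
  have hsub : ∀ q' : Belief X, M.uhat q' - M.uhat q - M.κ / M.χ * (M.H q'.1 - M.H q.1)
      = M.netValue q' - M.netValue q := fun q' => by unfold Model.netValue; ring
  refine ⟨?_, hns, ?_⟩
  · have h1 : q.1 ∈ LinearMap.fst ℝ (X → ℝ) ℝ ''
        convexHull ℝ ((fun q' : Belief X => (q'.1, M.netValue q')) '' π.support) :=
      ⟨_, hmem, rfl⟩
    rw [LinearMap.image_convexHull, Set.image_image] at h1
    exact h1
  · unfold Model.restrictedValue
    obtain ⟨N, hN⟩ := isCompact_univ.exists_bound_of_continuousOn (f := M.netValue)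
      (M.continuous_netValue hH).continuousOn
    -- The real `sSup` dominates its members only for a set that is bounded above; here compactness
    -- of the space of beliefs supplies the bound.
    have hbdd : BddAbove {v : ℝ | ∃ π' : Measure (Belief X), IsBayesPlausible q π' ∧
        π' (π.support)ᶜ = 0 ∧
        v = ∫ q', (M.uhat q' - M.uhat q - M.κ / M.χ * (M.H q'.1 - M.H q.1)) ∂π'} := by
      refine ⟨N + N, ?_⟩
      rintro _ ⟨π', hp, -, rfl⟩
      have := hp.prob
      simp only [hsub]
      rw [integral_sub_const π' (M.continuous_netValue hH)]
      have h1 : ∫ q', M.netValue q' ∂π' ≤ ∫ _, N ∂π' :=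
        integral_mono (integrable_of_continuous π' (M.continuous_netValue hH))
          (integrable_const _) fun q' => (abs_le.1 (hN q' trivial)).2
      simp at h1
      linarith [(abs_le.1 (hN q trivial)).1]
    rw [mem_convexHull_iff_exists_fintype] at hmem
    obtain ⟨ι, _, w, z, hw0, hw1, hz, hsum⟩ := hmem
    choose k hk hkz using hz
    have hfst : ∀ x, ∑ i, w i * (k i).1 x = q.1 x := by
      intro x
      have := congrFun (congrArg Prod.fst hsum) x
      simpa [← hkz, Prod.fst_sum, Finset.sum_apply] using this
    have hsnd : ∑ i, w i * M.netValue (k i) = v := by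
      have := congrArg Prod.snd hsum
      simpa [← hkz, Prod.snd_sum] using this
    let π' : Measure (Belief X) := ∑ i, ENNReal.ofReal (w i) • Measure.dirac (k i)
    have hint : ∀ φ : Belief X → ℝ, ∫ q', φ q' ∂π' = ∑ i, w i * φ (k i) := by
      intro φ
      rw [integral_finsetSum_measure]
      · refine Finset.sum_congr rfl fun x _ => ?_
        rw [integral_smul_measure, integral_dirac, ENNReal.toReal_ofReal (hw0 x), smul_eq_mul]
      · exact fun x _ => (integrable_dirac (by simp)).smul_measure ENNReal.ofReal_ne_top
    have hpl : IsBayesPlausible q π' := by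
      refine ⟨⟨?_⟩, fun x => by rw [hint, hfst]⟩
      simp only [π', Measure.coe_finsetSum, Finset.sum_apply, Measure.smul_apply,
        measure_univ, smul_eq_mul, mul_one]
      rw [← ENNReal.ofReal_sum_of_nonneg fun x _ => hw0 x, hw1, ENNReal.ofReal_one]
    have hsupp : π' (π.support)ᶜ = 0 := by
      simp only [π', Measure.coe_finsetSum, Finset.sum_apply, Measure.smul_apply, smul_eq_mul]
      exact Finset.sum_eq_zero fun i _ => by
        rw [Measure.dirac_apply' _ Measure.isClosed_support.measurableSet.compl]
        simp [hk i]
    have := hpl.prob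
    refine le_csSup_of_le hbdd ⟨π', hpl, hsupp, rfl⟩ ?_
    simp only [hsub]
    rw [integral_sub_const π' (M.continuous_netValue hH), hint, hsnd]
    linarith

end Static

section Paths

variable {X A : Type*} [Fintype X]

/-! ### Dyadic approximation of random times -/

/-- The largest multiple of `2⁻ⁿ` below `r`. -/
noncomputable def lowerDyadic (n : ℕ) (r : ℝ≥0) : ℝ≥0 := (⌊2 ^ n * r⌋₊ : ℝ≥0) / 2 ^ n

/-- The smallest multiple of `2⁻ⁿ` strictly above `r`. -/
noncomputable def upperDyadic (n : ℕ) (r : ℝ≥0) : ℝ≥0 := ((⌊2 ^ n * r⌋₊ + 1 : ℕ) : ℝ≥0) / 2 ^ n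

theorem two_pow_pos (n : ℕ) : (0 : ℝ≥0) < 2 ^ n := by positivity

theorem lowerDyadic_le (n : ℕ) (r : ℝ≥0) : lowerDyadic n r ≤ r := by
  unfold lowerDyadic
  rw [div_le_iff₀ (two_pow_pos n), mul_comm r]
  exact Nat.floor_le zero_le

theorem lt_upperDyadic (n : ℕ) (r : ℝ≥0) : r < upperDyadic n r := by
  unfold upperDyadic
  rw [lt_div_iff₀ (two_pow_pos n), mul_comm r]
  exact_mod_cast Nat.lt_floor_add_one (2 ^ n * r)

theorem upperDyadic_eq (n : ℕ) (r : ℝ≥0) :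
    upperDyadic n r = lowerDyadic n r + (1 / 2) ^ n := by
  unfold upperDyadic lowerDyadic
  rw [Nat.cast_add, add_div, Nat.cast_one, one_div_pow]

theorem tendsto_half_pow : Tendsto (fun n : ℕ => (1 / 2 : ℝ≥0) ^ n) atTop (𝓝 0) :=
  NNReal.tendsto_pow_atTop_nhds_zero_of_lt_one (NNReal.half_lt_self one_ne_zero)

theorem tendsto_upperDyadic (r : ℝ≥0) : Tendsto (fun n => upperDyadic n r) atTop (𝓝 r) := by
  refine tendsto_of_tendsto_of_tendsto_of_le_of_le tendsto_const_nhds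
    (h := fun n => r + (1 / 2) ^ n) ?_ (fun n => (lt_upperDyadic n r).le) fun n => ?_
  · simpa using tendsto_const_nhds.add tendsto_half_pow
  · change upperDyadic n r ≤ r + (1 / 2) ^ n
    rw [upperDyadic_eq]; exact add_le_add_left (lowerDyadic_le n r) _

theorem tendsto_lowerDyadic (r : ℝ≥0) : Tendsto (fun n => lowerDyadic n r) atTop (𝓝 r) := by
  refine tendsto_of_tendsto_of_tendsto_of_le_of_le (g := fun n => r - (1 / 2) ^ n) ?_
    tendsto_const_nhds (fun n => ?_) fun n => lowerDyadic_le n r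
  · simpa using tendsto_const_nhds.sub tendsto_half_pow
  · change r - (1 / 2) ^ n ≤ lowerDyadic n r
    rw [tsub_le_iff_right, ← upperDyadic_eq]; exact (lt_upperDyadic n r).le

theorem measurable_eval_of_countable {Ω E ι : Type*} [MeasurableSpace Ω] [MeasurableSpace E]
    {Y : ι → Ω → E} (hY : ∀ t, Measurable (Y t)) {k : Ω → ℕ} (hk : Measurable k) (c : ℕ → ι) :
    Measurable fun w => Y (c (k w)) w := by
  have h : Measurable fun p : ℕ × Ω => Y (c p.1) p.2 :=
    measurable_from_prod_countable_right fun n => hY (c n)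
  exact h.comp (hk.prodMk measurable_id)

theorem measurable_dyadicFloor {Ω : Type*} [MeasurableSpace Ω] {σ : Ω → ℝ≥0} (hσ : Measurable σ)
    (n : ℕ) : Measurable fun w => ⌊2 ^ n * σ w⌋₊ :=
  Nat.measurable_floor.comp (hσ.const_mul _)

/-! ### The canonical process -/

theorem measurable_canon (t : ℝ≥0) : Measurable (canon t : BeliefPath X → Belief X) :=
  (stronglyMeasurable_canon t).measurable

theorem measurable_canon_filtration {s t : ℝ≥0} (h : s ≤ t) :
    Measurable[canonFiltration X t] (canon s : BeliefPath X → Belief X) := by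
  have h1 : StronglyAdapted (canonFiltration X) (fun t => (canon t : BeliefPath X → Belief X)) :=
    Filtration.stronglyAdapted_natural stronglyMeasurable_canon
  exact (h1 s).measurable.mono ((canonFiltration X).mono h) le_rfl

theorem tendsto_canon_of_ge (w : BeliefPath X) {ι : Type*} {l : Filter ι} {r : ι → ℝ≥0} {t : ℝ≥0}
    (hr : Tendsto r l (𝓝 t)) (hge : ∀ᶠ i in l, t ≤ r i) :
    Tendsto (fun i => canon (r i) w) l (𝓝 (canon t w)) :=
  ((w.2 t).1.tendsto).comp (tendsto_nhdsWithin_iff.2 ⟨hr, hge⟩)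

theorem measurable_canon_eval {σ : BeliefPath X → ℝ≥0} (hσ : Measurable σ) :
    Measurable fun w => canon (σ w) w := by
  refine measurable_of_tendsto_metrizable (f := fun n w => canon (upperDyadic n (σ w)) w)
    (fun n => ?_) ?_
  · exact measurable_eval_of_countable measurable_canon (measurable_dyadicFloor hσ n)
      fun k => ((k + 1 : ℕ) : ℝ≥0) / 2 ^ n
  · rw [tendsto_pi_nhds]
    exact fun w => tendsto_canon_of_ge w (tendsto_upperDyadic _)
      (Eventually.of_forall fun n => (lt_upperDyadic n _).le)

theorem measurable_of_isStoppingTime {τ : BeliefPath X → ℝ≥0∞}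
    (hτ : IsStoppingTime (canonFiltration X) τ) : Measurable τ := by
  refine measurable_of_Iic fun x => ?_
  induction x using ENNReal.recTopCoe with
  | top => simp
  | coe r => exact (canonFiltration X).le r _ (hτ r)

theorem measurable_stoppedBelief {τ : BeliefPath X → ℝ≥0∞} (hτ : Measurable τ) :
    Measurable (stoppedBelief τ) :=
  measurable_canon_eval hτ.ennreal_toNNReal

theorem integrable_comp_belief {Ω : Type*} [MeasurableSpace Ω] {P : Measure Ω}
    [IsFiniteMeasure P] {Z : Ω → Belief X} (hZ : Measurable Z) {φ : Belief X → ℝ} (hφ : Continuous φ) :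
    Integrable (fun w => φ (Z w)) P := by
  have := (integrable_map_measure (μ := P) hφ.aestronglyMeasurable hZ.aemeasurable).1
    (integrable_of_continuous (P.map Z) hφ)
  exact this

theorem exists_belief_bound {φ : Belief X → ℝ} (hφ : Continuous φ) : ∃ N, ∀ q, ‖φ q‖ ≤ N := by
  obtain ⟨N, hN⟩ := isCompact_univ.exists_bound_of_continuousOn (f := φ) hφ.continuousOn
  exact ⟨N, fun q => hN q trivial⟩

/-! ### Optional stopping -/

theorem martingale_setIntegral_coord {P : Measure (BeliefPath X)} [IsFiniteMeasure P]
    (hm : Martingale (fun t (w : BeliefPath X) => (canon t w).1) (canonFiltration X) P)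
    {s t : ℝ≥0} (hst : s ≤ t) {S : Set (BeliefPath X)} (hS : MeasurableSet[canonFiltration X s] S)
    (x : X) : ∫ w in S, (canon s w).1 x ∂P = ∫ w in S, (canon t w).1 x ∂P := by
  have h := congrFun (hm.setIntegral_eq hst hS) x
  rwa [eval_integral fun i =>
      (integrable_comp_belief (measurable_canon s) (continuous_coord i)).integrableOn,
    eval_integral fun i =>
      (integrable_comp_belief (measurable_canon t) (continuous_coord i)).integrableOn] at h

/-- Approximate `τ` from above by dyadic times truncated at `s + n`. On each dyadic cell the
martingale property links the cell's endpoint to `s + n`. Right-continuity and boundedness of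
beliefs give the limit, so almost sure finiteness of `τ` suffices. -/
theorem setIntegral_stoppedBelief {P : Measure (BeliefPath X)} [IsProbabilityMeasure P]
    (hm : Martingale (fun t (w : BeliefPath X) => (canon t w).1) (canonFiltration X) P)
    {τ : BeliefPath X → ℝ≥0∞} (hτ : IsStoppingTime (canonFiltration X) τ)
    (hfin : ∀ᵐ w ∂P, τ w < ∞) {s : ℝ≥0} {S : Set (BeliefPath X)}
    (hS : MeasurableSet[canonFiltration X s] S) (hSτ : S ⊆ {w | (s : ℝ≥0∞) ≤ τ w}) (x : X) :
    ∫ w in S, (stoppedBelief τ w).1 x ∂P = ∫ w in S, (canon s w).1 x ∂P := by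
  have hτm := measurable_of_isStoppingTime hτ
  have hSm : MeasurableSet S := (canonFiltration X).le s _ hS
  set σ : BeliefPath X → ℝ≥0 := fun w => (τ w).toNNReal with hσ
  have hσm : Measurable σ := hτm.ennreal_toNNReal
  have hcoord : ∀ t : ℝ≥0, Integrable (fun w : BeliefPath X => (canon t w).1 x) P := fun t =>
    integrable_comp_belief (measurable_canon t) (continuous_coord x)
  -- the approximating bounded stopping times
  let ρ : ℕ → BeliefPath X → ℝ≥0 := fun n w => min (upperDyadic n (σ w)) (s + n)
  have hρm : ∀ n, Measurable fun w => canon (ρ n w) w := by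
    intro n
    refine measurable_canon_eval (Measurable.min ?_ measurable_const)
    exact (measurable_from_nat (f := fun k : ℕ => ((k + 1 : ℕ) : ℝ≥0) / 2 ^ n)).comp
      (measurable_dyadicFloor hσm n)
  have key : ∀ n, ∫ w in S, (canon (ρ n w) w).1 x ∂P = ∫ w in S, (canon s w).1 x ∂P := by
    intro n
    let c : ℕ → ℝ≥0 := fun k => ((k + 1 : ℕ) : ℝ≥0) / 2 ^ n
    let E : ℕ → Set (BeliefPath X) := fun k =>
      S ∩ ({w | (((k : ℝ≥0) / 2 ^ n : ℝ≥0) : ℝ≥0∞) ≤ τ w} ∩ {w | τ w < (c k : ℝ≥0∞)})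
    have hmono : ∀ k : ℕ, ((k : ℝ≥0) / 2 ^ n : ℝ≥0) ≤ c k := fun k =>
      div_le_div_of_nonneg_right (by push_cast; exact le_self_add) zero_le
    have hE : ∀ k, s ≤ c k → MeasurableSet[canonFiltration X (c k)] (E k) := fun k hk =>
      ((canonFiltration X).mono hk _ hS).inter
        (((canonFiltration X).mono (hmono k) _ (hτ.measurableSet_ge _)).inter
          (hτ.measurableSet_lt _))
    -- Cells ending before `s` miss `S`, on which `τ ≥ s`. They need separate treatment because `S`
    -- need not be known by the time `c k`.
    have hE' : ∀ k, c k < s → E k = ∅ := fun k hk => by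
      refine Set.eq_empty_of_forall_notMem ?_
      rintro w ⟨h1, -, h2⟩
      have h3 : (c k : ℝ≥0∞) < s := by exact_mod_cast hk
      exact absurd (lt_of_le_of_lt (hSτ h1) h2) (not_lt.2 h3.le)
    have hEm : ∀ k, MeasurableSet (E k) := fun k => by
      rcases lt_or_ge (c k) s with h | h
      · rw [hE' k h]; exact MeasurableSet.empty
      · exact (canonFiltration X).le _ _ (hE k h)
    obtain ⟨N, hN⟩ : ∃ N : ℕ, ∀ k, c k < s + n → k < N := by
      refine ⟨⌈2 ^ n * (s + n)⌉₊, fun k hk => ?_⟩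
      rw [div_lt_iff₀ (two_pow_pos n), mul_comm] at hk
      have h1 := hk.trans_le (Nat.le_ceil _)
      have h2 : k + 1 < ⌈2 ^ n * (s + n)⌉₊ := by exact_mod_cast h1
      omega
    let J : Finset ℕ := (Finset.range N).filter fun k => c k < s + n
    have hDint : ∀ k, Integrable ((E k).indicator
        (fun w => (canon (c k) w).1 x - (canon (s + n) w).1 x)) P := fun k =>
      ((hcoord _).sub (hcoord _)).indicator (hEm k)
    -- Exactly one cell contains the path, so at most one summand survives; none does when
    -- truncation is active.
    have hdiff : ∀ᵐ w ∂P.restrict S, (canon (ρ n w) w).1 x =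
        (canon (s + n) w).1 x
          + ∑ k ∈ J, (E k).indicator (fun w => (canon (c k) w).1 x - (canon (s + n) w).1 x) w := by
      rw [ae_restrict_iff' hSm]
      filter_upwards [hfin] with w hw hwS
      have hτσ : τ w = (σ w : ℝ≥0∞) := (ENNReal.coe_toNNReal hw.ne).symm
      set k₀ := ⌊2 ^ n * σ w⌋₊ with hk₀
      have hup : upperDyadic n (σ w) = c k₀ := rfl
      have hmem : ∀ k, w ∈ E k ↔ k = k₀ := by
        intro k
        have h1 : (((k : ℝ≥0) / 2 ^ n : ℝ≥0) : ℝ≥0∞) ≤ τ w ↔ (k : ℝ≥0) ≤ 2 ^ n * σ w := by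
          rw [hτσ, ENNReal.coe_le_coe, div_le_iff₀ (two_pow_pos n), mul_comm]
        have h2 : τ w < (c k : ℝ≥0∞) ↔ 2 ^ n * σ w < (k + 1 : ℕ) := by
          rw [hτσ, ENNReal.coe_lt_coe, lt_div_iff₀ (two_pow_pos n), mul_comm]
        constructor
        · rintro ⟨-, h3, h4⟩
          have h3' := h1.1 h3
          have h4' := h2.1 h4
          rw [hk₀, eq_comm, Nat.floor_eq_iff zero_le]
          exact ⟨h3', by exact_mod_cast h4'⟩
        · rintro rfl
          refine ⟨hwS, h1.2 (Nat.floor_le zero_le), h2.2 ?_⟩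
          rw [hk₀]; exact_mod_cast Nat.lt_floor_add_one (2 ^ n * σ w)
      have hind : ∀ k, (E k).indicator
          (fun w => (canon (c k) w).1 x - (canon (s + n) w).1 x) w
          = if k = k₀ then (canon (c k) w).1 x - (canon (s + n) w).1 x else 0 := by
        intro k
        by_cases h : k = k₀
        · rw [Set.indicator_of_mem ((hmem k).2 h), if_pos h]
        · rw [Set.indicator_of_notMem (fun h' => h ((hmem k).1 h')), if_neg h]
      simp_rw [hind]
      rw [Finset.sum_ite_eq' J k₀]
      by_cases h : c k₀ < s + n
      · rw [if_pos (Finset.mem_filter.2 ⟨Finset.mem_range.2 (hN k₀ h), h⟩)]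
        have : ρ n w = c k₀ := by simp only [ρ, hup]; exact min_eq_left h.le
        rw [this]; ring
      · rw [if_neg fun h' => h ((Finset.mem_filter (s := Finset.range N) (p := fun k => c k < s + n)).1 h').2]
        have : ρ n w = s + n := by simp only [ρ, hup]; exact min_eq_right (not_lt.1 h)
        rw [this]; ring
    rw [integral_congr_ae hdiff, integral_add (hcoord _).integrableOn
      (integrable_finsetSum _ fun k _ => (hDint k).integrableOn),
      integral_finsetSum _ fun k _ => (hDint k).integrableOn,
      Finset.sum_eq_zero, add_zero, ← martingale_setIntegral_coord hm le_self_add hS x]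
    intro k hk
    have hck := (Finset.mem_filter.1 hk).2
    rw [setIntegral_indicator (hEm k)]
    have hsub : S ∩ E k = E k := Set.inter_eq_right.2 Set.inter_subset_left
    rw [hsub]
    rcases lt_or_ge (c k) s with h | h
    · rw [hE' k h]; simp
    · rw [integral_sub (hcoord _).integrableOn (hcoord _).integrableOn,
        martingale_setIntegral_coord hm hck.le (hE k h) x, sub_self]
  have hlim : Tendsto (fun n => ∫ w in S, (canon (ρ n w) w).1 x ∂P) atTop
      (𝓝 (∫ w in S, (stoppedBelief τ w).1 x ∂P)) := by
    obtain ⟨N, hN⟩ := exists_belief_bound (continuous_coord x)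
    refine tendsto_integral_of_dominated_convergence (fun _ => N)
      (fun n => ((continuous_coord x).measurable.comp (hρm n)).aestronglyMeasurable)
      (integrable_const _) (fun n => ae_of_all _ fun w => hN _) (ae_of_all _ fun w => ?_)
    have hlarge : ∀ᶠ n : ℕ in atTop, σ w + 1 ≤ s + n := by
      obtain ⟨m, hm⟩ := exists_nat_ge (σ w + 1)
      filter_upwards [eventually_ge_atTop m] with n hn
      exact hm.trans ((Nat.cast_le.2 hn).trans le_add_self)
    have hconv : Tendsto (fun n => ρ n w) atTop (𝓝 (σ w)) := by
      refine (tendsto_upperDyadic (σ w)).congr' ?_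
      have h1 : ∀ᶠ n in atTop, upperDyadic n (σ w) < σ w + 1 :=
        (tendsto_upperDyadic (σ w)).eventually_lt_const (by simp)
      filter_upwards [h1, hlarge] with n h1 h2
      exact (min_eq_left (h1.le.trans h2)).symm
    have hge : ∀ᶠ n in atTop, σ w ≤ ρ n w := by
      filter_upwards [hlarge] with n h2
      exact le_min (lt_upperDyadic n _).le (le_self_add.trans h2)
    exact ((continuous_coord x).tendsto _).comp (tendsto_canon_of_ge w hconv hge)
  simp_rw [key] at hlim
  exact tendsto_nhds_unique hlim tendsto_const_nhds

end Paths

section Policies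

variable {X A : Type*} [Fintype X] [Fintype A] [Nonempty A] {M : Model X A}
  {P : Measure (BeliefPath X)} {τ : BeliefPath X → ℝ≥0∞} {I : ℝ≥0 → BeliefPath X → ℝ}
  {q₀ : Belief X}

/-! ### The agent's stopping problem -/

/-- Stopping at a deterministic time on an event decided at that time. -/
noncomputable def stopEarly (τ : BeliefPath X → ℝ≥0∞) (s : ℝ≥0) (S : Set (BeliefPath X))
    (w : BeliefPath X) : ℝ≥0∞ :=
  open Classical in if w ∈ S then s else τ w

/-- Before `s` the membership in `S` is not yet known, but it does not matter: on `S` neither `s`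
nor `τ` has been reached. -/
theorem isStoppingTime_stopEarly (hτ : IsStoppingTime (canonFiltration X) τ) {s : ℝ≥0}
    {S : Set (BeliefPath X)} (hS : MeasurableSet[canonFiltration X s] S)
    (hSτ : S ⊆ {w | (s : ℝ≥0∞) ≤ τ w}) :
    IsStoppingTime (canonFiltration X) (stopEarly τ s S) := by
  intro t
  rcases le_or_gt s t with h | h
  · have : {w | stopEarly τ s S w ≤ (t : ℝ≥0∞)} = S ∪ {w | τ w ≤ (t : ℝ≥0∞)} := by
      ext w
      by_cases hw : w ∈ S
      · have : (s : ℝ≥0∞) ≤ t := by exact_mod_cast h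
        simp [stopEarly, hw, this]
      · simp [stopEarly, hw]
    exact this ▸ ((canonFiltration X).mono h _ hS).union (hτ t)
  · have : {w | stopEarly τ s S w ≤ (t : ℝ≥0∞)} = {w | τ w ≤ (t : ℝ≥0∞)} := by
      ext w
      by_cases hw : w ∈ S
      · have h1 : (t : ℝ≥0∞) < s := by exact_mod_cast h
        have h2 : (t : ℝ≥0∞) < τ w := h1.trans_le (hSτ hw)
        simp only [stopEarly, Set.mem_ofPred_eq, hw, if_true, not_le.2 h1, not_le.2 h2]
      · simp [stopEarly, hw]
    exact this ▸ hτ t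

theorem integrable_toReal_time [IsProbabilityMeasure P] (hτ : Measurable τ)
    (hint : ∫⁻ w, τ w ∂P ≠ ∞) : Integrable (fun w => (τ w).toReal) P :=
  integrable_toReal_of_lintegral_ne_top hτ.aemeasurable hint

/-- Obedience tested against the deviation that stops at `s` on `S` and follows `τ` elsewhere; the
payoffs off `S` cancel. -/
theorem Model.IsAgentOptimal.setIntegral_le [IsProbabilityMeasure P] (ho : M.IsAgentOptimal P τ)
    {s : ℝ≥0} {S : Set (BeliefPath X)} (hS : MeasurableSet[canonFiltration X s] S)
    (hSτ : S ⊆ {w | (s : ℝ≥0∞) ≤ τ w}) :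
    M.κ * ∫ w in S, ((τ w).toReal - s) ∂P
      ≤ (∫ w in S, M.uhat (stoppedBelief τ w) ∂P) - ∫ w in S, M.uhat (canon s w) ∂P := by
  have hτm := measurable_of_isStoppingTime ho.stopping
  have hSm : MeasurableSet S := (canonFiltration X).le s _ hS
  have hst := isStoppingTime_stopEarly ho.stopping hS hSτ
  have hle : ∀ w, stopEarly τ s S w ≤ τ w := fun w => by
    by_cases hw : w ∈ S
    · simpa [stopEarly, hw] using hSτ hw
    · simp [stopEarly, hw]
  have hfin : ∫⁻ w, stopEarly τ s S w ∂P ≠ ∞ :=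
    ne_top_of_le_ne_top ho.integrable (lintegral_mono hle)
  have h := ho.optimal _ hst hfin
  have hτi := integrable_toReal_time hτm ho.integrable
  have hu := integrable_comp_belief (P := P) (measurable_stoppedBelief hτm) M.continuous_uhat
  have hus := integrable_comp_belief (P := P) (measurable_canon s) M.continuous_uhat
  have hstm := measurable_of_isStoppingTime hst
  have hi1 : Integrable (fun w => M.uhat (stoppedBelief τ w) - M.κ * (τ w).toReal) P :=
    hu.sub (hτi.const_mul _)
  have hi2 : Integrable (fun w => M.uhat (stoppedBelief (stopEarly τ s S) w)
      - M.κ * (stopEarly τ s S w).toReal) P :=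
    (integrable_comp_belief (measurable_stoppedBelief hstm) M.continuous_uhat).sub
      ((integrable_toReal_time hstm hfin).const_mul _)
  unfold Model.agentPayoff at h
  rw [← integral_add_compl hSm hi1, ← integral_add_compl hSm hi2] at h
  have e1 : ∫ w in Sᶜ, (M.uhat (stoppedBelief (stopEarly τ s S) w)
      - M.κ * (stopEarly τ s S w).toReal) ∂P
      = ∫ w in Sᶜ, (M.uhat (stoppedBelief τ w) - M.κ * (τ w).toReal) ∂P := by
    refine setIntegral_congr_fun hSm.compl fun w hw => ?_
    have hw' : w ∉ S := hw
    simp [stoppedBelief, stopEarly, hw']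
  have e2 : ∫ w in S, (M.uhat (stoppedBelief (stopEarly τ s S) w)
      - M.κ * (stopEarly τ s S w).toReal) ∂P
      = ∫ w in S, (M.uhat (canon s w) - M.κ * s) ∂P := by
    refine setIntegral_congr_fun hSm fun w hw => ?_
    simp [stoppedBelief, stopEarly, hw]
  have e3 : ∫ w in S, (M.uhat (stoppedBelief τ w) - M.κ * (τ w).toReal) ∂P
      = ∫ w in S, M.uhat (stoppedBelief τ w) ∂P - M.κ * ∫ w in S, (τ w).toReal ∂P := by
    rw [integral_sub hu.integrableOn (hτi.const_mul _).integrableOn, integral_const_mul]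
  rw [e1, e2, e3, integral_sub hus.integrableOn (integrable_const _), integral_const] at h
  rw [integral_sub hτi.integrableOn (integrable_const _), integral_const]
  simp only [smul_eq_mul] at h ⊢
  linarith

/-! ### Accumulated information -/

theorem Model.IsAdmissible.capacity_bound (ha : M.IsAdmissible q₀ P I τ) :
    ∀ᵐ w ∂P, ∀ t : ℝ≥0, (t : ℝ≥0∞) ≤ τ w → 0 ≤ I t w ∧ I t w ≤ M.χ * t := by
  filter_upwards [ha.increasing, ha.start_info, ha.capacity] with w hm h0 hc t ht
  have h1 := hm (zero_le : 0 ≤ t)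
  have h2 := hc 0 t zero_le ht
  simp only [h0] at h1 h2
  exact ⟨h1, by simpa using h2⟩

/-- Up to `τ`, monotonicity and the capacity bound make `I` Lipschitz in time. The dyadic
approximation is from below because no modulus of continuity is available beyond `τ`. -/
theorem Model.IsAdmissible.aemeasurable_info (ha : M.IsAdmissible q₀ P I τ)
    {σ : BeliefPath X → ℝ≥0} (hσ : Measurable σ) (hστ : ∀ᵐ w ∂P, (σ w : ℝ≥0∞) ≤ τ w) :
    AEMeasurable (fun w => I (σ w) w) P := by
  refine aemeasurable_of_tendsto_metrizable_ae atTop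
    (f := fun n w => I (lowerDyadic n (σ w)) w) (fun n => ?_) ?_
  · exact (measurable_eval_of_countable
      (fun t => ((ha.adapted t).measurable.mono ((canonFiltration X).le t) le_rfl))
      (measurable_dyadicFloor hσ n) fun k => (k : ℝ≥0) / 2 ^ n).aemeasurable
  · filter_upwards [hστ, ha.increasing, ha.capacity] with w hw hm hc
    have h1 : Tendsto (fun n => I (σ w) w - M.χ * ((σ w : ℝ) - (lowerDyadic n (σ w) : ℝ))) atTop
        (𝓝 (I (σ w) w)) := by
      have h2 : Tendsto (fun n => ((lowerDyadic n (σ w) : ℝ≥0) : ℝ)) atTop (𝓝 (σ w : ℝ)) :=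
        NNReal.tendsto_coe.2 (tendsto_lowerDyadic (σ w))
      have h3 := ((h2.const_sub (σ w : ℝ)).const_mul M.χ).const_sub (I (σ w) w)
      simpa using h3
    refine tendsto_of_tendsto_of_tendsto_of_le_of_le h1 tendsto_const_nhds (fun n => ?_) fun n => ?_
    · have := hc _ _ (lowerDyadic_le n (σ w)) hw
      change _ ≤ I (lowerDyadic n (σ w)) w
      linarith
    · exact hm (lowerDyadic_le n (σ w))

theorem Model.IsAdmissible.integrable_info (hχ : 0 < M.χ) (ha : M.IsAdmissible q₀ P I τ)
    (hint : ∫⁻ w, τ w ∂P ≠ ∞) {σ : BeliefPath X → ℝ≥0} (hσ : Measurable σ)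
    (hστ : ∀ᵐ w ∂P, (σ w : ℝ≥0∞) ≤ τ w) : Integrable (fun w => I (σ w) w) P := by
  have := ha.prob
  refine Integrable.mono' ((integrable_toReal_time (measurable_of_isStoppingTime ha.stopping)
    hint).const_mul M.χ) (ha.aemeasurable_info hσ hστ).aestronglyMeasurable ?_
  filter_upwards [hστ, ha.capacity_bound, ha.finite] with w hw hb hf
  obtain ⟨h1, h2⟩ := hb _ hw
  rw [Real.norm_of_nonneg h1]
  refine h2.trans (mul_le_mul_of_nonneg_left ?_ hχ.le)
  have := ENNReal.toReal_mono hf.ne hw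
  simpa using this

theorem coe_truncTime_le (τ : BeliefPath X → ℝ≥0∞) (t : ℝ≥0) (w : BeliefPath X) :
    (truncTime τ t w : ℝ≥0∞) ≤ τ w := by
  unfold truncTime
  rw [ENNReal.coe_toNNReal (ne_top_of_le_ne_top ENNReal.coe_ne_top (min_le_left _ _))]
  exact min_le_right _ _

theorem measurable_truncTime (hτ : Measurable τ) (t : ℝ≥0) : Measurable (truncTime τ t) :=
  (measurable_const.min hτ).ennreal_toNNReal

/-- The expected gain in the generalized entropy equals the expected information acquired. -/
theorem Model.IsAdmissible.setIntegral_entropy (hχ : 0 < M.χ)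
    (hH : ContinuousOn M.H (stdSimplex ℝ X)) (ha : M.IsAdmissible q₀ P I τ)
    (hint : ∫⁻ w, τ w ∂P ≠ ∞) {s : ℝ≥0} {S : Set (BeliefPath X)}
    (hS : MeasurableSet[canonFiltration X s] S) (hSτ : S ⊆ {w | (s : ℝ≥0∞) ≤ τ w}) :
    (∫ w in S, M.H (stoppedBelief τ w).1 ∂P) - ∫ w in S, M.H (canon s w).1 ∂P
      = ∫ w in S, (I (τ w).toNNReal w - I s w) ∂P := by
  have := ha.prob
  have hτm := measurable_of_isStoppingTime ha.stopping
  have hSm : MeasurableSet S := (canonFiltration X).le s _ hS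
  have cH := M.continuous_H hH
  have htr : ∀ w ∈ S, truncTime τ s w = s := fun w hw => by
    unfold truncTime; rw [min_eq_left (hSτ hw), ENNReal.toNNReal_coe]
  have hHint : ∀ t, Integrable (fun w => M.H (canon (truncTime τ t w) w).1) P := fun t =>
    integrable_comp_belief (measurable_canon_eval (measurable_truncTime hτm t)) cH
  have hIint : ∀ t, Integrable (fun w => I (truncTime τ t w) w) P := fun t =>
    ha.integrable_info hχ hint (measurable_truncTime hτm t)
      (ae_of_all _ fun w => coe_truncTime_le τ t w)
  have hHd : ∀ t t', Integrable (fun w => M.H (canon (truncTime τ t w) w).1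
      - M.H (canon (truncTime τ t' w) w).1) P := fun t t' => (hHint t).sub (hHint t')
  have hId : ∀ t t', Integrable (fun w => I (truncTime τ t w) w - I (truncTime τ t' w) w) P :=
    fun t t' => (hIint t).sub (hIint t')
  -- The law of motion is integrated on `[s, s + n]` and `n` is sent to infinity. Truncation is
  -- eventually inactive; `H` is bounded and information is dominated by a multiple of `τ`.
  have hstep : ∀ n : ℕ, ∫ w in S, (M.H (canon (truncTime τ (s + n) w) w).1
      - M.H (canon (truncTime τ s w) w).1) ∂P
      = ∫ w in S, (I (truncTime τ (s + n) w) w - I (truncTime τ s w) w) ∂P := fun n => by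
    rw [← setIntegral_condExp ((canonFiltration X).le s) (hHd _ _) hS,
      ← setIntegral_condExp ((canonFiltration X).le s) (hId _ _) hS]
    exact setIntegral_congr_ae hSm ((ha.cumulative s (s + n) le_self_add).mono fun w hw _ => hw)
  have hev : ∀ᵐ w ∂P, ∀ᶠ n : ℕ in atTop, truncTime τ (s + n) w = (τ w).toNNReal := by
    filter_upwards [ha.finite] with w hw
    obtain ⟨m, hm⟩ := exists_nat_ge (τ w).toNNReal
    filter_upwards [eventually_ge_atTop m] with n hn
    unfold truncTime
    rw [min_eq_right]
    rw [← ENNReal.coe_toNNReal hw.ne, ENNReal.coe_le_coe]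
    exact hm.trans ((Nat.cast_le.2 hn).trans le_add_self)
  have hl1 : Tendsto (fun n : ℕ => ∫ w in S, (M.H (canon (truncTime τ (s + n) w) w).1
      - M.H (canon (truncTime τ s w) w).1) ∂P) atTop
      (𝓝 (∫ w in S, (M.H (stoppedBelief τ w).1 - M.H (canon (truncTime τ s w) w).1) ∂P)) := by
    obtain ⟨N, hN⟩ := exists_belief_bound cH
    refine tendsto_integral_of_dominated_convergence (fun _ => N + N)
      (fun n => (hHd _ _).integrableOn.aestronglyMeasurable)
      (integrable_const _) (fun n => ae_of_all _ fun w =>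
        (norm_sub_le _ _).trans (add_le_add (hN _) (hN _))) (ae_restrict_of_ae ?_)
    filter_upwards [hev] with w hw
    refine tendsto_nhds_of_eventually_eq ?_
    filter_upwards [hw] with n hn
    rw [hn]; rfl
  have hl2 : Tendsto (fun n : ℕ => ∫ w in S, (I (truncTime τ (s + n) w) w
      - I (truncTime τ s w) w) ∂P) atTop
      (𝓝 (∫ w in S, (I (τ w).toNNReal w - I (truncTime τ s w) w) ∂P)) := by
    have hd := ((integrable_toReal_time hτm hint).const_mul M.χ)
    refine tendsto_integral_of_dominated_convergence
      (fun w => M.χ * (τ w).toReal + M.χ * (τ w).toReal)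
      (fun n => (hId _ _).integrableOn.aestronglyMeasurable)
      (hd.add hd).integrableOn (fun n => ae_restrict_of_ae ?_) (ae_restrict_of_ae ?_)
    · have hb : ∀ᵐ w ∂P, ∀ t : ℝ≥0, ‖I (truncTime τ t w) w‖ ≤ M.χ * (τ w).toReal := by
        filter_upwards [ha.capacity_bound, ha.finite] with w hb hf t
        obtain ⟨h1, h2⟩ := hb _ (coe_truncTime_le τ t w)
        rw [Real.norm_of_nonneg h1]
        refine h2.trans (mul_le_mul_of_nonneg_left ?_ hχ.le)
        have := ENNReal.toReal_mono hf.ne (coe_truncTime_le τ t w)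
        simpa using this
      filter_upwards [hb] with w hw
      exact (norm_sub_le _ _).trans (add_le_add (hw _) (hw _))
    · filter_upwards [hev] with w hw
      refine tendsto_nhds_of_eventually_eq ?_
      filter_upwards [hw] with n hn
      rw [hn]
  simp_rw [hstep] at hl1
  have h := tendsto_nhds_unique hl1 hl2
  rw [integral_sub (integrable_comp_belief (measurable_stoppedBelief hτm) cH).integrableOn
    (hHint _).integrableOn] at h
  have e1 : ∫ w in S, M.H (canon (truncTime τ s w) w).1 ∂P = ∫ w in S, M.H (canon s w).1 ∂P :=
    setIntegral_congr_fun hSm fun w hw => by simp only [htr w hw]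
  have e2 : ∫ w in S, (I (τ w).toNNReal w - I (truncTime τ s w) w) ∂P
      = ∫ w in S, (I (τ w).toNNReal w - I s w) ∂P :=
    setIntegral_congr_fun hSm fun w hw => by simp only [htr w hw]
  rw [← e1, ← e2]; exact h

/-! ### The law of the belief at the stopping time -/

theorem coe_toNNReal_time_le (w : BeliefPath X) : ((τ w).toNNReal : ℝ≥0∞) ≤ τ w :=
  ENNReal.coe_toNNReal_le_self

theorem integral_start [IsProbabilityMeasure P] (hs : ∀ᵐ w ∂P, canon 0 w = q₀)
    (φ : Belief X → ℝ) : ∫ w, φ (canon 0 w) ∂P = φ q₀ := by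
  rw [integral_congr_ae (g := fun _ => φ q₀) (hs.mono fun w hw => by simp only [hw])]
  simp

theorem integral_stopped_law (hτ : Measurable τ) {φ : Belief X → ℝ} (hφ : Continuous φ) :
    ∫ q, φ q ∂(P.map (stoppedBelief τ)) = ∫ w, φ (stoppedBelief τ w) ∂P :=
  integral_map (measurable_stoppedBelief hτ).aemeasurable hφ.aestronglyMeasurable

theorem Model.IsAdmissible.isBayesPlausible_law (ha : M.IsAdmissible q₀ P I τ) :
    IsBayesPlausible q₀ (P.map (stoppedBelief τ)) := by
  have := ha.prob
  have hτm := measurable_of_isStoppingTime ha.stopping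
  refine ⟨Measure.isProbabilityMeasure_map (measurable_stoppedBelief hτm).aemeasurable,
    fun x => ?_⟩
  rw [integral_stopped_law hτm (continuous_coord x)]
  have h := setIntegral_stoppedBelief ha.martingale ha.stopping ha.finite (s := 0)
    (S := Set.univ) MeasurableSet.univ (by simp) x
  simp only [Measure.restrict_univ] at h
  rw [h, integral_start ha.start fun q => q.1 x]

theorem Model.IsAdmissible.integral_info (hχ : 0 < M.χ)
    (hH : ContinuousOn M.H (stdSimplex ℝ X)) (ha : M.IsAdmissible q₀ P I τ)
    (hint : ∫⁻ w, τ w ∂P ≠ ∞) :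
    ∫ w, I (τ w).toNNReal w ∂P = ∫ q, M.H q.1 ∂(P.map (stoppedBelief τ)) - M.H q₀.1 := by
  have := ha.prob
  have hτm := measurable_of_isStoppingTime ha.stopping
  rw [integral_stopped_law hτm (M.continuous_H hH)]
  have h := ha.setIntegral_entropy hχ hH hint (s := 0) (S := Set.univ) MeasurableSet.univ (by simp)
  simp only [Measure.restrict_univ] at h
  rw [integral_start ha.start fun q => M.H q.1] at h
  rw [h]
  exact integral_congr_ae (ha.start_info.mono fun w hw => by simp only [hw, sub_zero])

theorem Model.IsAdmissible.integral_info_le (hχ : 0 < M.χ) (ha : M.IsAdmissible q₀ P I τ)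
    (hint : ∫⁻ w, τ w ∂P ≠ ∞) :
    ∫ w, I (τ w).toNNReal w ∂P ≤ M.χ * ∫ w, (τ w).toReal ∂P := by
  have := ha.prob
  have hτm := measurable_of_isStoppingTime ha.stopping
  rw [← integral_const_mul]
  refine integral_mono_ae (ha.integrable_info hχ hint hτm.ennreal_toNNReal
    (ae_of_all _ fun w => coe_toNNReal_time_le w))
    ((integrable_toReal_time hτm hint).const_mul _) ?_
  filter_upwards [ha.capacity_bound] with w hw
  exact (hw _ (coe_toNNReal_time_le w)).2

theorem Model.IsAdmissible.cost_le (ha : M.IsAdmissible q₀ P I τ) (ho : M.IsAgentOptimal P τ) :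
    M.κ * ∫ w, (τ w).toReal ∂P
      ≤ ∫ q, M.uhat q ∂(P.map (stoppedBelief τ)) - M.uhat q₀ := by
  have := ha.prob
  have hτm := measurable_of_isStoppingTime ha.stopping
  rw [integral_stopped_law hτm M.continuous_uhat]
  have h := ho.setIntegral_le (s := 0) (S := Set.univ) MeasurableSet.univ (by simp)
  simp only [Measure.restrict_univ] at h
  rw [integral_start ha.start M.uhat] at h
  simpa using h

theorem integral_netValue (hH : ContinuousOn M.H (stdSimplex ℝ X)) (π : Measure (Belief X))
    [IsFiniteMeasure π] :
    ∫ q, M.netValue q ∂π = ∫ q, M.uhat q ∂π - M.κ / M.χ * ∫ q, M.H q.1 ∂π := by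
  unfold Model.netValue
  rw [integral_sub (integrable_of_continuous π M.continuous_uhat)
    ((integrable_of_continuous π (M.continuous_H hH)).const_mul _), integral_const_mul]

/-- The chain is `κ/χ` times the entropy gain `= κ/χ · E[I_τ] ≤ κ E[τ] ≤` the gain in `uhat`: law of
motion, capacity, and the deviation to stopping at once. -/
theorem Model.IsAdmissible.isRelaxedFeasible_law (hκ : 0 < M.κ) (hχ : 0 < M.χ)
    (hH : ContinuousOn M.H (stdSimplex ℝ X)) (ha : M.IsAdmissible q₀ P I τ)
    (ho : M.IsAgentOptimal P τ) : M.IsRelaxedFeasible q₀ (P.map (stoppedBelief τ)) := by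
  rw [M.isRelaxedFeasible_iff hH]
  have hp := ha.isBayesPlausible_law
  have := hp.prob
  refine ⟨hp, ?_⟩
  have h1 := ha.integral_info hχ hH ho.integrable
  have h2 := ha.integral_info_le hχ ho.integrable
  have h3 := ha.cost_le ho
  rw [integral_netValue hH]
  unfold Model.netValue
  rw [h1] at h2
  have h4 := mul_le_mul_of_nonneg_left h2 (div_pos hκ hχ).le
  have h5 : M.κ / M.χ * (M.χ * ∫ w, (τ w).toReal ∂P) = M.κ * ∫ w, (τ w).toReal ∂P := by
    field_simp
  linarith

/-- When the participation constraint binds, the agent's capacity is fully used. -/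
theorem Model.IsAdmissible.info_eq_capacity (hκ : 0 < M.κ) (hχ : 0 < M.χ)
    (hH : ContinuousOn M.H (stdSimplex ℝ X)) (ha : M.IsAdmissible q₀ P I τ)
    (ho : M.IsAgentOptimal P τ)
    (hbind : ∫ q, M.netValue q ∂(P.map (stoppedBelief τ)) = M.netValue q₀) :
    ∀ᵐ w ∂P, I (τ w).toNNReal w = M.χ * (τ w).toReal := by
  have := ha.prob
  have hp := ha.isBayesPlausible_law
  have := hp.prob
  have hτm := measurable_of_isStoppingTime ha.stopping
  have h1 := ha.integral_info hχ hH ho.integrable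
  have h2 := ha.integral_info_le hχ ho.integrable
  have h3 := ha.cost_le ho
  rw [integral_netValue hH] at hbind
  unfold Model.netValue at hbind
  have hτi := (integrable_toReal_time hτm ho.integrable).const_mul M.χ
  have hI := ha.integrable_info hχ ho.integrable hτm.ennreal_toNNReal
    (ae_of_all _ fun w => coe_toNNReal_time_le w)
  have h5 : M.κ / M.χ * (M.χ * ∫ w, (τ w).toReal ∂P) = M.κ * ∫ w, (τ w).toReal ∂P := by
    field_simp
  -- The binding constraint reverses the capacity inequality in mean. The pointwise slack is
  -- nonnegative, so it vanishes almost surely.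
  have h6 : M.χ * ∫ w, (τ w).toReal ∂P ≤ ∫ w, I (τ w).toNNReal w ∂P := by
    refine le_of_mul_le_mul_left ?_ (div_pos hκ hχ)
    rw [h5, h1]; linarith
  have h7 : ∫ w, (M.χ * (τ w).toReal - I (τ w).toNNReal w) ∂P = 0 := by
    rw [integral_sub hτi hI, integral_const_mul]; linarith
  have h8 : 0 ≤ᵐ[P] fun w => M.χ * (τ w).toReal - I (τ w).toNNReal w := by
    filter_upwards [ha.capacity_bound] with w hw
    exact sub_nonneg.2 (hw _ (coe_toNNReal_time_le w)).2
  filter_upwards [(integral_eq_zero_iff_of_nonneg_ae h8 (hτi.sub hI)).1 h7] with w hw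
  simp only [Pi.zero_apply] at hw
  linarith

end Policies

/-! ### Exponential waiting times -/

section Exponential

variable {r : ℝ}

theorem measurable_exponentialPDF (r : ℝ) : Measurable (exponentialPDF r) :=
  (measurable_exponentialPDFReal r).ennreal_ofReal

theorem setIntegral_expMeasure (r : ℝ) {c : ℝ} (hr : 0 < r) (hc : 0 ≤ c) (f : ℝ → ℝ) :
    ∫ T in Set.Ioi c, f T ∂(expMeasure r)
      = ∫ T in Set.Ioi c, r * Real.exp (-(r * T)) * f T := by
  change ∫ T in Set.Ioi c, f T ∂(volume.withDensity (exponentialPDF r)) = _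
  rw [setIntegral_withDensity_eq_setIntegral_toReal_smul
    (measurable_exponentialPDF r) (by simp [exponentialPDF]) _
    measurableSet_Ioi]
  refine setIntegral_congr_fun measurableSet_Ioi fun T hT => ?_
  have : 0 ≤ T := hc.trans (le_of_lt hT)
  simp only [smul_eq_mul]
  rw [exponentialPDF_of_nonneg this, ENNReal.toReal_ofReal (by positivity)]

theorem integrableOn_expMeasure_iff (hr : 0 < r) {c : ℝ} (hc : 0 ≤ c) (f : ℝ → ℝ) :
    IntegrableOn f (Set.Ioi c) (expMeasure r)
      ↔ IntegrableOn (fun T => r * Real.exp (-(r * T)) * f T) (Set.Ioi c) := by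
  change IntegrableOn f (Set.Ioi c) (volume.withDensity (exponentialPDF r)) ↔ _
  rw [IntegrableOn, restrict_withDensity measurableSet_Ioi,
    integrable_withDensity_iff_integrable_smul' (measurable_exponentialPDF r)
      (by simp [exponentialPDF])]
  refine integrable_congr ?_
  rw [EventuallyEq, ae_restrict_iff' measurableSet_Ioi]
  refine ae_of_all _ fun T hT => ?_
  have : 0 ≤ T := hc.trans (le_of_lt hT)
  rw [exponentialPDF_of_nonneg this, ENNReal.toReal_ofReal (by positivity), smul_eq_mul]

theorem hasDerivAt_exp_survival (r T : ℝ) :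
    HasDerivAt (fun T => -Real.exp (-(r * T))) (r * Real.exp (-(r * T))) T := by
  have h : HasDerivAt (fun T => -Real.exp (-(r * T))) (-(Real.exp (-(r * T)) * -(r * 1))) T :=
    (((hasDerivAt_id' T).const_mul r).neg.exp).neg
  exact h.congr_deriv (by ring)

theorem tendsto_exp_survival (hr : 0 < r) :
    Tendsto (fun T : ℝ => Real.exp (-(r * T))) atTop (𝓝 0) :=
  Real.tendsto_exp_neg_atTop_nhds_zero.comp (tendsto_id.const_mul_atTop hr)

theorem integral_exp_survival (hr : 0 < r) {c : ℝ} (hc : 0 ≤ c) :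
    ∫ _ in Set.Ioi c, (1 : ℝ) ∂(expMeasure r) = Real.exp (-(r * c)) := by
  rw [setIntegral_expMeasure r hr hc]
  simp only [mul_one]
  rw [integral_Ioi_of_hasDerivAt_of_nonneg' (fun T _ => hasDerivAt_exp_survival r T)
    (fun T _ => by positivity) (by simpa using (tendsto_exp_survival hr).neg)]
  ring

/-- This primitive vanishes at infinity, which yields both the integrability and the value of the
mean excess. -/
theorem hasDerivAt_exp_excess (hr : 0 < r) (c T : ℝ) :
    HasDerivAt (fun T => -((T - c + 1 / r) * Real.exp (-(r * T))))
      (r * Real.exp (-(r * T)) * (T - c)) T := by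
  have h1 : HasDerivAt (fun T => T - c + 1 / r) 1 T :=
    ((hasDerivAt_id T).sub_const c).add_const _
  have h := h1.mul (hasDerivAt_exp_survival r T)
  have heq : (fun T => -((T - c + 1 / r) * Real.exp (-(r * T))))
      = (fun T => T - c + 1 / r) * fun T => -Real.exp (-(r * T)) := by
    funext T; simp only [Pi.mul_apply]; ring
  rw [heq]
  refine h.congr_deriv ?_
  have : 1 / r * r = 1 := div_mul_cancel₀ _ hr.ne'
  linear_combination Real.exp (-(r * T)) * this

theorem tendsto_exp_excess (hr : 0 < r) (c : ℝ) :
    Tendsto (fun T : ℝ => -((T - c + 1 / r) * Real.exp (-(r * T)))) atTop (𝓝 0) := by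
  have h1 : Tendsto (fun T : ℝ => T * Real.exp (-(r * T))) atTop (𝓝 0) := by
    have h := (Real.tendsto_pow_mul_exp_neg_atTop_nhds_zero 1).comp
      (tendsto_id.const_mul_atTop hr)
    have h2 := h.const_mul (1 / r)
    simp only [mul_zero] at h2
    refine h2.congr fun T => ?_
    simp only [Function.comp, id, pow_one]
    field_simp
  have h3 := (h1.add ((tendsto_exp_survival hr).const_mul (1 / r - c))).neg
  simp only [mul_zero, add_zero, neg_zero] at h3
  exact h3.congr fun T => by ring

theorem integrableOn_exp_excess (hr : 0 < r) {c : ℝ} (hc : 0 ≤ c) :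
    IntegrableOn (fun T => T - c) (Set.Ioi c) (expMeasure r) := by
  rw [integrableOn_expMeasure_iff hr hc]
  exact integrableOn_Ioi_deriv_of_nonneg' (fun T _ => hasDerivAt_exp_excess hr c T)
    (fun T hT => mul_nonneg (by positivity) (sub_nonneg.2 (le_of_lt hT)))
    (tendsto_exp_excess hr c)

/-- Memorylessness: given survival to `c`, the remaining waiting time still has mean `1 / r`. The
obedience of the jump policy rests on this. -/
theorem integral_exp_excess (hr : 0 < r) {c : ℝ} (hc : 0 ≤ c) :
    ∫ T in Set.Ioi c, (T - c) ∂(expMeasure r) = Real.exp (-(r * c)) / r := by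
  rw [setIntegral_expMeasure r hr hc,
    integral_Ioi_of_hasDerivAt_of_nonneg' (fun T _ => hasDerivAt_exp_excess hr c T)
    (fun T hT => mul_nonneg (by positivity) (sub_nonneg.2 (le_of_lt hT)))
    (tendsto_exp_excess hr c)]
  field_simp
  ring

theorem ae_pos_expMeasure (r : ℝ) : ∀ᵐ T ∂(expMeasure r), 0 < T := by
  have h : expMeasure r (Set.Iic 0) = 0 := by
    change volume.withDensity (exponentialPDF r) (Set.Iic 0) = 0
    rw [withDensity_apply _ measurableSet_Iic, setLIntegral_congr Iio_ae_eq_Iic.symm]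
    exact lintegral_exponentialPDF_of_nonpos le_rfl
  rw [ae_iff]
  convert h using 2
  ext T; simp

theorem expMeasure_restrict_Ioi (r : ℝ) :
    (expMeasure r).restrict (Set.Ioi 0) = expMeasure r :=
  Measure.restrict_eq_self_of_ae_mem (ae_pos_expMeasure r)

theorem integrable_expMeasure_id (hr : 0 < r) : Integrable (fun T : ℝ => T) (expMeasure r) := by
  have h := integrableOn_exp_excess hr le_rfl
  rw [IntegrableOn, expMeasure_restrict_Ioi] at h
  simpa using h

theorem integral_expMeasure_id (hr : 0 < r) : ∫ T, T ∂(expMeasure r) = 1 / r := by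
  have h := integral_exp_excess hr le_rfl
  rw [expMeasure_restrict_Ioi] at h
  simpa using h

end Exponential

section JumpPolicy

variable {X A : Type*} [Fintype X]

/-! ### Stopping times see only the past -/

/-- The natural filtration at `s` is generated by the restriction of the path to `[0, s]`. -/
theorem mem_iff_of_agree {s : ℝ≥0} {S : Set (BeliefPath X)}
    (hS : MeasurableSet[canonFiltration X s] S) {w w' : BeliefPath X}
    (h : ∀ t ≤ s, canon t w = canon t w') : w ∈ S ↔ w' ∈ S := by
  unfold canonFiltration at hS
  rw [Filtration.natural_eq_comap] at hS
  obtain ⟨B, -, rfl⟩ := hS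
  have : (fun j : Set.Iic s => canon j.1 w) = fun j : Set.Iic s => canon j.1 w' :=
    funext fun j => h j.1 j.2
  simp only [Set.mem_preimage]
  exact Iff.of_eq (congrArg (· ∈ B) this)

/-! ### The time of the first jump away from a belief -/

/-- The path leaves `q₀` by a jump at time `t`. -/
def JumpsAt (q₀ : Belief X) (w : BeliefPath X) (t : ℝ≥0) : Prop :=
  canon t w ≠ q₀ ∧ ∀ s < t, canon s w = q₀

theorem JumpsAt.unique {q₀ : Belief X} {w : BeliefPath X} {s t : ℝ≥0} (hs : JumpsAt q₀ w s)
    (ht : JumpsAt q₀ w t) : s = t := by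
  rcases lt_trichotomy s t with h | h | h
  · exact absurd (ht.2 s h) hs.1
  · exact h
  · exact absurd (hs.2 t h) ht.1

/-- The time at which the path leaves `q₀` by a jump, infinite if it does not. -/
noncomputable def jumpTime (q₀ : Belief X) (w : BeliefPath X) : ℝ≥0∞ :=
  ⨅ (t : ℝ≥0) (_ : JumpsAt q₀ w t), (t : ℝ≥0∞)

theorem JumpsAt.jumpTime_eq {q₀ : Belief X} {w : BeliefPath X} {t : ℝ≥0} (h : JumpsAt q₀ w t) :
    jumpTime q₀ w = t :=
  le_antisymm (iInf₂_le t h) (le_iInf₂ fun s hs => by rw [h.unique hs])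

theorem jumpTime_le_iff {q₀ : Belief X} {w : BeliefPath X} {t : ℝ≥0} :
    jumpTime q₀ w ≤ t ↔ ∃ s ≤ t, JumpsAt q₀ w s := by
  constructor
  · intro h
    by_cases hex : ∃ s, JumpsAt q₀ w s
    · obtain ⟨s, hs⟩ := hex
      rw [hs.jumpTime_eq] at h
      exact ⟨s, by exact_mod_cast h, hs⟩
    · exfalso
      have : jumpTime q₀ w = ⊤ := by
        unfold jumpTime
        simp only [iInf_eq_top]
        exact fun s hs => absurd ⟨s, hs⟩ hex
      rw [this] at h
      simp at h
  · rintro ⟨s, hs, h⟩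
    rw [h.jumpTime_eq]; exact_mod_cast hs

theorem exists_right_interval (w : BeliefPath X) (t : ℝ≥0) {U : Set (Belief X)} (hU : IsOpen U)
    (h : canon t w ∈ U) : ∃ b, t < b ∧ ∀ s, t ≤ s → s < b → canon s w ∈ U := by
  have h1 := (w.2 t).1.eventually_mem (hU.mem_nhds h)
  obtain ⟨b, hb, hsub⟩ := (mem_nhdsGE_iff_exists_Ico_subset' (lt_add_one t)).1 h1
  exact ⟨b, hb, fun s h2 h3 => hsub ⟨h2, h3⟩⟩

/-- A characterization of jumps by countably many times. -/
theorem exists_jumpsAt_iff (q₀ : Belief X) (w : BeliefPath X) (t : ℝ≥0) {d : ℕ → ℝ≥0}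
    (hd : DenseRange d) :
    (∃ s ≤ t, JumpsAt q₀ w s) ↔ ∃ i : Option ℕ, ∃ n : ℕ, ∃ p, p = i.elim t d ∧ p ≤ t ∧
      canon p w ≠ q₀ ∧ ∀ k, d k ≤ p →
        (∀ j, d j ≤ d k → canon (d j) w = q₀) ∨ 1 / ((n : ℝ) + 1) < dist (canon (d k) w) q₀ := by
  have hbetween : ∀ {a b : ℝ≥0}, a < b → ∃ k, a < d k ∧ d k < b := fun h => by
    obtain ⟨k, hk⟩ := hd.exists_mem_open isOpen_Ioo (Set.nonempty_Ioo.2 h)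
    exact ⟨k, hk⟩
  constructor
  · rintro ⟨s, hst, hne, hbefore⟩
    -- The index `n` records a lower bound on the displacement, which persists just after the jump
    -- by right-continuity.
    obtain ⟨n, hn⟩ := exists_nat_one_div_lt (dist_pos.2 hne)
    have hopen : IsOpen {q : Belief X | 1 / ((n : ℝ) + 1) < dist q q₀} :=
      isOpen_lt continuous_const (continuous_id.dist continuous_const)
    obtain ⟨b, hb, hfar⟩ := exists_right_interval w s hopen hn
    have hpos : (0 : ℝ) < 1 / ((n : ℝ) + 1) := by positivity
    have main : ∀ p, s ≤ p → p < b → ∀ k, d k ≤ p →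
        (∀ j, d j ≤ d k → canon (d j) w = q₀) ∨
          1 / ((n : ℝ) + 1) < dist (canon (d k) w) q₀ := by
      intro p _ hpb k hk
      rcases lt_or_ge (d k) s with h | h
      · exact Or.inl fun j hj => hbefore _ (hj.trans_lt h)
      · exact Or.inr (hfar _ h (hk.trans_lt hpb))
    -- If the jump is at `t` itself, no later date up to `t` is available as a witness; this is why
    -- `none` stands for `t`.
    rcases hst.eq_or_lt with rfl | hlt
    · exact ⟨none, n, s, rfl, le_rfl, hne, main s le_rfl hb⟩
    · obtain ⟨k, hk1, hk2⟩ := hbetween (lt_min hlt hb)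
      refine ⟨some k, n, d k, rfl, (hk2.trans_le (min_le_left _ _)).le, ?_,
        main _ hk1.le (hk2.trans_le (min_le_right _ _))⟩
      exact dist_pos.1 (hpos.trans (hfar _ hk1.le (hk2.trans_le (min_le_right _ _))))
  · rintro ⟨-, n, p, -, hpt, hpne, hall⟩
    set Z : Set ℝ≥0 := {u | canon u w ≠ q₀} with hZ
    have hZne : Z.Nonempty := ⟨p, hpne⟩
    set s := sInf Z with hs
    have hsp : s ≤ p := csInf_le (OrderBot.bddBelow Z) hpne
    have hbefore : ∀ u < s, canon u w = q₀ := fun u hu => by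
      by_contra h
      exact absurd (csInf_le (OrderBot.bddBelow Z) h) (not_le.2 hu)
    -- Were the path still at `q₀` at the infimum `s`, it would remain within `1/(n+1)` just after,
    -- yet leave `q₀` at dense dates arbitrarily close to `s`, against the dichotomy.
    refine ⟨s, hsp.trans hpt, fun hsq => ?_, hbefore⟩
    have hlt : s < p := lt_of_le_of_ne hsp fun h => hpne (h ▸ hsq)
    have hpos : (0 : ℝ) < 1 / ((n : ℝ) + 1) := by positivity
    have hopen : IsOpen {q : Belief X | dist q q₀ < 1 / ((n : ℝ) + 1)} :=
      isOpen_lt (continuous_id.dist continuous_const) continuous_const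
    obtain ⟨b, hb, hnear⟩ := exists_right_interval w s hopen (by simpa [hsq] using hpos)
    obtain ⟨u, huZ, hub⟩ := exists_lt_of_csInf_lt hZne (lt_min hb hlt)
    have hsu : s ≤ u := csInf_le (OrderBot.bddBelow Z) huZ
    obtain ⟨b', hb', hne'⟩ := exists_right_interval w u (U := {q₀}ᶜ) isOpen_compl_singleton huZ
    obtain ⟨k, hk1, hk2⟩ := hbetween (lt_min hub hb')
    have hkb : d k < min b p := hk2.trans_le (min_le_left _ _)
    have hkne : canon (d k) w ≠ q₀ := hne' _ hk1.le (hk2.trans_le (min_le_right _ _))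
    rcases hall k (hkb.trans_le (min_le_right _ _)).le with h | h
    · exact hkne (h k le_rfl)
    · exact absurd (hnear _ (hsu.trans hk1.le) (hkb.trans_le (min_le_left _ _))) (not_lt.2 h.le)

/-- The filtration is raw, so a continuous departure from `q₀` need not be visible at the date at
which it starts. A jump is visible at its own date, and the countable characterization uses only
coordinates up to `t`. -/
theorem isStoppingTime_jumpTime (q₀ : Belief X) :
    IsStoppingTime (canonFiltration X) (jumpTime q₀) := by
  intro t
  let d := TopologicalSpace.denseSeq ℝ≥0
  have hd : DenseRange d := TopologicalSpace.denseRange_denseSeq ℝ≥0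
  have hset : {w | jumpTime q₀ w ≤ (t : ℝ≥0∞)} = {w | ∃ i : Option ℕ, ∃ n : ℕ, ∃ p,
      p = i.elim t d ∧ p ≤ t ∧ canon p w ≠ q₀ ∧ ∀ k, d k ≤ p →
        (∀ j, d j ≤ d k → canon (d j) w = q₀) ∨
          1 / ((n : ℝ) + 1) < dist (canon (d k) w) q₀} := by
    ext w
    exact jumpTime_le_iff.trans (exists_jumpsAt_iff q₀ w t hd)
  change MeasurableSet[canonFiltration X t] {w | jumpTime q₀ w ≤ (t : ℝ≥0∞)}
  rw [hset]
  have heq : ∀ u ≤ t, MeasurableSet[canonFiltration X t] {w : BeliefPath X | canon u w = q₀} :=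
    fun u hu => measurable_canon_filtration hu (measurableSet_singleton q₀)
  have hfar : ∀ u ≤ t, ∀ a : ℝ,
      MeasurableSet[canonFiltration X t] {w : BeliefPath X | a < dist (canon u w) q₀} :=
    fun u hu a => measurable_canon_filtration hu
      (isOpen_lt continuous_const (continuous_id.dist continuous_const)).measurableSet
  simp only [Set.ofPred_exists]
  refine MeasurableSet.iUnion fun i => MeasurableSet.iUnion fun n => ?_
  have : (⋃ p, {w : BeliefPath X | p = i.elim t d ∧ p ≤ t ∧ canon p w ≠ q₀ ∧ ∀ k, d k ≤ p →
        (∀ j, d j ≤ d k → canon (d j) w = q₀) ∨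
          1 / ((n : ℝ) + 1) < dist (canon (d k) w) q₀})
      = {w : BeliefPath X | i.elim t d ≤ t ∧ canon (i.elim t d) w ≠ q₀ ∧ ∀ k, d k ≤ i.elim t d →
        (∀ j, d j ≤ d k → canon (d j) w = q₀) ∨
          1 / ((n : ℝ) + 1) < dist (canon (d k) w) q₀} := by
    ext w; simp
  rw [this]
  by_cases hp : i.elim t d ≤ t
  · simp only [hp, true_and, Set.ofPred_and, Set.ofPred_forall, Set.ofPred_or]
    refine (heq _ hp).compl.inter (MeasurableSet.iInter fun k => MeasurableSet.iInter fun hk => ?_)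
    exact (MeasurableSet.iInter fun j => MeasurableSet.iInter fun hj =>
      heq _ (hj.trans (hk.trans hp))).union (hfar _ (hk.trans hp) _)
  · simp [hp]

end JumpPolicy

section JumpPath

variable {X A : Type*} [Fintype X]

/-! ### The law of a path that jumps once, at an exponential time -/

/-- The path that stays at `q₀` before the time `p.1` and at `p.2` from then on. -/
noncomputable def jumpPath (q₀ : Belief X) (p : ℝ × Belief X) : BeliefPath X :=
  ⟨fun t => if (t : ℝ) < p.1 then q₀ else p.2, fun t => by
    have hcont : Continuous fun s : ℝ≥0 => (s : ℝ) := NNReal.continuous_coe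
    constructor
    · rcases lt_or_ge (t : ℝ) p.1 with h | h
      · refine ContinuousAt.continuousWithinAt ?_
        refine (continuousAt_const (y := q₀)).congr ?_
        filter_upwards [hcont.continuousAt.eventually_lt continuousAt_const h] with s hs
        rw [if_pos hs]
      · refine (continuousWithinAt_const (b := p.2)).congr (fun s hs => ?_) ?_
        · have : (t : ℝ) ≤ s := by exact_mod_cast hs
          rw [if_neg (not_lt.2 (h.trans this))]
        · rw [if_neg (not_lt.2 h)]
    · rcases le_or_gt (t : ℝ) p.1 with h | h
      · refine ⟨q₀, tendsto_const_nhds.congr' ?_⟩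
        filter_upwards [self_mem_nhdsWithin] with s hs
        have : (s : ℝ) < t := by exact_mod_cast hs
        rw [if_pos (this.trans_le h)]
      · refine ⟨p.2, tendsto_const_nhds.congr' ?_⟩
        have := continuousAt_const.eventually_lt hcont.continuousAt h
        filter_upwards [mem_nhdsWithin_of_mem_nhds this] with s hs
        rw [if_neg (not_lt.2 (le_of_lt hs))]⟩

theorem canon_jumpPath (q₀ : Belief X) (p : ℝ × Belief X) (t : ℝ≥0) :
    canon t (jumpPath q₀ p) = if (t : ℝ) < p.1 then q₀ else p.2 := rfl

theorem measurable_jumpPath (q₀ : Belief X) : Measurable (jumpPath q₀) := by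
  refine Measurable.subtype_mk (measurable_pi_lambda _ fun t => ?_)
  exact Measurable.ite (measurableSet_lt measurable_const measurable_fst) measurable_const
    measurable_snd

theorem jumpTime_jumpPath {q₀ : Belief X} {p : ℝ × Belief X} (h0 : 0 < p.1) (hne : p.2 ≠ q₀) :
    jumpTime q₀ (jumpPath q₀ p) = ENNReal.ofReal p.1 := by
  have hT : (p.1.toNNReal : ℝ) = p.1 := Real.coe_toNNReal _ h0.le
  refine JumpsAt.jumpTime_eq (t := p.1.toNNReal) ⟨?_, fun s hs => ?_⟩
  · rw [canon_jumpPath, hT, if_neg (lt_irrefl _)]; exact hne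
  · have : (s : ℝ) < p.1 := by rw [← hT]; exact_mod_cast hs
    rw [canon_jumpPath, if_pos this]

/-- The path jumps from `q₀` at an exponential time of rate `r`, to a belief drawn from `π`. -/
noncomputable def jumpLaw (q₀ : Belief X) (r : ℝ) (π : Measure (Belief X)) :
    Measure (BeliefPath X) :=
  ((expMeasure r).prod π).map (jumpPath q₀)

variable {q₀ : Belief X} {r : ℝ} {π : Measure (Belief X)}

theorem ae_jumpLaw_iff {Q : BeliefPath X → Prop} (h : ∀ᵐ p ∂((expMeasure r).prod π),
    Q (jumpPath q₀ p)) (hQ : MeasurableSet {w | Q w}) : ∀ᵐ w ∂(jumpLaw q₀ r π), Q w :=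
  (ae_map_iff (measurable_jumpPath q₀).aemeasurable hQ).2 h

/-- An integral over an event decided at time `s` vanishes as soon as the integral over the paths
that have not jumped yet vanishes. -/
theorem setIntegral_jump_eq_zero {s : ℝ≥0} {S : Set (BeliefPath X)}
    (hS : MeasurableSet[canonFiltration X s] S) {h : ℝ × Belief X → ℝ}
    (h0 : ∀ p : ℝ × Belief X, p.1 ≤ s → h p = 0)
    (hint : ∫ p in Set.Ioi (s : ℝ) ×ˢ Set.univ, h p ∂((expMeasure r).prod π) = 0) :
    ∫ p in jumpPath q₀ ⁻¹' S, h p ∂((expMeasure r).prod π) = 0 := by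
  have hSm : MeasurableSet (jumpPath q₀ ⁻¹' S) :=
    measurable_jumpPath q₀ ((canonFiltration X).le s _ hS)
  have e : ∫ p in jumpPath q₀ ⁻¹' S, h p ∂((expMeasure r).prod π)
      = ∫ p in jumpPath q₀ ⁻¹' S ∩ Set.Ioi (s : ℝ) ×ˢ Set.univ, h p ∂((expMeasure r).prod π) := by
    refine setIntegral_eq_of_subset_of_forall_sdiff_eq_zero hSm Set.inter_subset_left ?_
    rintro p ⟨hp1, hp2⟩
    refine h0 p (not_lt.1 fun hlt => hp2 ⟨hp1, hlt, trivial⟩)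
  -- Paths that have not jumped by `s` coincide up to `s`, so `S` contains all of them or none;
  -- below, the one jumping at `s + 1` decides which.
  have hagree : ∀ p p' : ℝ × Belief X, (s : ℝ) < p.1 → (s : ℝ) < p'.1 →
      (jumpPath q₀ p ∈ S ↔ jumpPath q₀ p' ∈ S) := fun p p' hp hp' =>
    mem_iff_of_agree hS fun t ht => by
      have : (t : ℝ) ≤ s := by exact_mod_cast ht
      rw [canon_jumpPath, canon_jumpPath, if_pos (this.trans_lt hp), if_pos (this.trans_lt hp')]
  rw [e]
  by_cases hmem : jumpPath q₀ ((s : ℝ) + 1, q₀) ∈ S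
  · have : jumpPath q₀ ⁻¹' S ∩ Set.Ioi (s : ℝ) ×ˢ Set.univ = Set.Ioi (s : ℝ) ×ˢ Set.univ := by
      refine Set.inter_eq_right.2 ?_
      rintro p ⟨hp, -⟩
      exact (hagree _ p (by simp) hp).1 hmem
    rw [this, hint]
  · have : jumpPath q₀ ⁻¹' S ∩ Set.Ioi (s : ℝ) ×ˢ Set.univ = ∅ := by
      refine Set.eq_empty_of_forall_notMem ?_
      rintro p ⟨hp1, hp, -⟩
      exact hmem ((hagree p _ hp (by simp)).1 hp1)
    rw [this, setIntegral_empty]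

theorem integral_belief_after [IsProbabilityMeasure π] (hr : 0 < r) {c : ℝ} (hc : 0 ≤ c)
    {φ : Belief X → ℝ} (hφ : Continuous φ) (a : ℝ) :
    ∫ p in Set.Ioi c ×ˢ Set.univ, (φ p.2 - a) ∂((expMeasure r).prod π)
      = Real.exp (-(r * c)) * ((∫ q, φ q ∂π) - a) := by
  have := isProbabilityMeasure_expMeasure hr
  have h := setIntegral_prod_mul (μ := expMeasure r) (ν := π) (fun _ : ℝ => (1 : ℝ))
    (fun q => φ q - a) (Set.Ioi c) Set.univ
  simp only [one_mul, Measure.restrict_univ] at h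
  rw [h, integral_exp_survival hr hc, integral_sub_const π hφ]

theorem integral_excess_after [IsProbabilityMeasure π] (hr : 0 < r) {c : ℝ} (hc : 0 ≤ c) :
    ∫ p in Set.Ioi c ×ˢ Set.univ, (p.1 - c) ∂((expMeasure r).prod π)
      = Real.exp (-(r * c)) / r := by
  have := isProbabilityMeasure_expMeasure hr
  have h := setIntegral_prod_mul (μ := expMeasure r) (ν := π) (fun T : ℝ => T - c)
    (fun _ => (1 : ℝ)) (Set.Ioi c) Set.univ
  simp only [mul_one, Measure.restrict_univ, integral_const, probReal_univ, smul_eq_mul] at h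
  rw [h, integral_exp_excess hr hc]

theorem setIntegral_indicator_after {s t : ℝ} (hst : s ≤ t) (F : ℝ × Belief X → ℝ) :
    ∫ p in Set.Ioi s ×ˢ Set.univ, (Set.Ioi t ×ˢ Set.univ).indicator F p ∂((expMeasure r).prod π)
      = ∫ p in Set.Ioi t ×ˢ Set.univ, F p ∂((expMeasure r).prod π) := by
  rw [setIntegral_indicator (measurableSet_Ioi.prod MeasurableSet.univ)]
  congr 2
  rw [Set.prod_inter_prod, Set.Ioi_inter_Ioi, Set.univ_inter, max_eq_right hst]

theorem integrable_fst_prod [IsProbabilityMeasure π] (hr : 0 < r) :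
    Integrable (fun p : ℝ × Belief X => p.1) ((expMeasure r).prod π) := by
  have := isProbabilityMeasure_expMeasure hr
  exact (integrable_expMeasure_id hr).comp_fst π

theorem integral_fst_prod [IsProbabilityMeasure π] (hr : 0 < r) :
    ∫ p : ℝ × Belief X, p.1 ∂((expMeasure r).prod π) = 1 / r := by
  have := isProbabilityMeasure_expMeasure hr
  have h := integral_prod_mul (μ := expMeasure r) (ν := π) (fun T : ℝ => T) (fun _ => (1 : ℝ))
  simp only [mul_one, integral_const, probReal_univ, smul_eq_mul] at h
  rw [h, integral_expMeasure_id hr]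

theorem integrable_belief_prod [IsProbabilityMeasure π] (hr : 0 < r) {φ : Belief X → ℝ}
    (hφ : Continuous φ) (a : ℝ) :
    Integrable (fun p : ℝ × Belief X => φ p.2 - a) ((expMeasure r).prod π) := by
  have := isProbabilityMeasure_expMeasure hr
  exact (integrable_comp_belief measurable_snd hφ).sub (integrable_const _)

/-- Increments of functions of the belief between two dates. -/
theorem integral_belief_increment [IsProbabilityMeasure π] (hr : 0 < r) {s t : ℝ≥0} (hst : s ≤ t)
    {φ : Belief X → ℝ} (hφ : Continuous φ) :
    ∫ p in Set.Ioi (s : ℝ) ×ˢ Set.univ, (φ (canon t (jumpPath q₀ p)) - φ (canon s (jumpPath q₀ p)))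
        ∂((expMeasure r).prod π)
      = (Real.exp (-(r * s)) - Real.exp (-(r * t))) * ((∫ q, φ q ∂π) - φ q₀) := by
  have := isProbabilityMeasure_expMeasure hr
  have hst' : (s : ℝ) ≤ t := by exact_mod_cast hst
  have hi := integrable_belief_prod (π := π) hr hφ (φ q₀)
  have e : ∀ p ∈ Set.Ioi (s : ℝ) ×ˢ (Set.univ : Set (Belief X)),
      φ (canon t (jumpPath q₀ p)) - φ (canon s (jumpPath q₀ p))
        = (φ p.2 - φ q₀) - (Set.Ioi (t : ℝ) ×ˢ (Set.univ : Set (Belief X))).indicator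
            (fun p => φ p.2 - φ q₀) p := by
    rintro p ⟨hp, -⟩
    have hp' : (s : ℝ) < p.1 := hp
    rw [canon_jumpPath, canon_jumpPath, if_pos hp']
    by_cases h : (t : ℝ) < p.1
    · rw [if_pos h, Set.indicator_of_mem (show p ∈ Set.Ioi (t : ℝ) ×ˢ Set.univ from ⟨h, trivial⟩)]
      ring
    · rw [if_neg h, Set.indicator_of_notMem fun h' => h h'.1]; ring
  rw [setIntegral_congr_fun (measurableSet_Ioi.prod MeasurableSet.univ) e,
    integral_sub hi.integrableOn
      (hi.indicator (measurableSet_Ioi.prod MeasurableSet.univ)).integrableOn,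
    setIntegral_indicator_after hst', integral_belief_after hr s.coe_nonneg hφ,
    integral_belief_after hr t.coe_nonneg hφ]
  ring

/-- The time factor is the same as in `integral_belief_increment`, so a single choice of `r` matches
entropy gains with capacity at every date. -/
theorem integral_time_increment [IsProbabilityMeasure π] (hr : 0 < r) {s t : ℝ≥0} (hst : s ≤ t) :
    ∫ p in Set.Ioi (s : ℝ) ×ˢ Set.univ, (min (t : ℝ) p.1 - min (s : ℝ) p.1)
        ∂((expMeasure r).prod π)
      = (Real.exp (-(r * s)) - Real.exp (-(r * t))) / r := by
  have := isProbabilityMeasure_expMeasure hr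
  have hst' : (s : ℝ) ≤ t := by exact_mod_cast hst
  have hi : ∀ c : ℝ, Integrable (fun p : ℝ × Belief X => p.1 - c) ((expMeasure r).prod π) :=
    fun c => (integrable_fst_prod hr).sub (integrable_const _)
  have e : ∀ p ∈ Set.Ioi (s : ℝ) ×ˢ (Set.univ : Set (Belief X)),
      min (t : ℝ) p.1 - min (s : ℝ) p.1
        = (p.1 - s) - (Set.Ioi (t : ℝ) ×ˢ (Set.univ : Set (Belief X))).indicator
            (fun p => p.1 - t) p := by
    rintro p ⟨hp, -⟩
    have hp' : (s : ℝ) < p.1 := hp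
    rw [min_eq_left hp'.le]
    by_cases h : (t : ℝ) < p.1
    · rw [min_eq_left h.le,
        Set.indicator_of_mem (show p ∈ Set.Ioi (t : ℝ) ×ˢ Set.univ from ⟨h, trivial⟩)]
      ring
    · rw [min_eq_right (not_lt.1 h), Set.indicator_of_notMem fun h' => h h'.1]; ring
  rw [setIntegral_congr_fun (measurableSet_Ioi.prod MeasurableSet.univ) e,
    integral_sub (hi _).integrableOn
      ((hi _).indicator (measurableSet_Ioi.prod MeasurableSet.univ)).integrableOn,
    setIntegral_indicator_after hst', integral_excess_after hr s.coe_nonneg, integral_excess_after hr t.coe_nonneg]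
  ring

theorem isProbabilityMeasure_jumpLaw [IsProbabilityMeasure π] (hr : 0 < r) :
    IsProbabilityMeasure (jumpLaw q₀ r π) := by
  have := isProbabilityMeasure_expMeasure hr
  exact Measure.isProbabilityMeasure_map (measurable_jumpPath q₀).aemeasurable

theorem ae_prod_regular [IsProbabilityMeasure π] (hr : 0 < r) (hne : ∀ᵐ q ∂π, q ≠ q₀) :
    ∀ᵐ p ∂((expMeasure r).prod π), 0 < p.1 ∧ p.2 ≠ q₀ := by
  have := isProbabilityMeasure_expMeasure hr
  exact (Measure.quasiMeasurePreserving_fst.ae (ae_pos_expMeasure r)).and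
    (Measure.quasiMeasurePreserving_snd.ae hne)

theorem setIntegral_jumpLaw {S : Set (BeliefPath X)} (hS : MeasurableSet S)
    {f : BeliefPath X → ℝ} (hf : AEStronglyMeasurable f (jumpLaw q₀ r π)) :
    ∫ w in S, f w ∂(jumpLaw q₀ r π)
      = ∫ p in jumpPath q₀ ⁻¹' S, f (jumpPath q₀ p) ∂((expMeasure r).prod π) :=
  setIntegral_map hS hf (measurable_jumpPath q₀).aemeasurable

/-- After the jump the belief is frozen; before it, the target has mean `q₀`, so increments
integrate to zero over the paths still waiting. -/
theorem martingale_jumpLaw (hr : 0 < r) (hπ : IsBayesPlausible q₀ π) :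
    Martingale (fun t (w : BeliefPath X) => (canon t w).1) (canonFiltration X)
      (jumpLaw q₀ r π) := by
  have := hπ.prob
  have := isProbabilityMeasure_expMeasure hr
  have := isProbabilityMeasure_jumpLaw (q₀ := q₀) (π := π) hr
  have hmeas : ∀ t, Measurable[canonFiltration X t] fun w : BeliefPath X => (canon t w).1 :=
    fun t => measurable_subtype_coe.comp (measurable_canon_filtration le_rfl)
  have hc : ∀ t x, Integrable (fun w : BeliefPath X => (canon t w).1 x) (jumpLaw q₀ r π) :=
    fun t x => integrable_comp_belief (measurable_canon t) (continuous_coord x)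
  have hi : ∀ t, Integrable (fun w : BeliefPath X => (canon t w).1) (jumpLaw q₀ r π) :=
    fun t => Integrable.of_eval (hc t)
  refine ⟨fun t => (hmeas t).stronglyMeasurable, fun s t hst => ?_⟩
  refine (ae_eq_condExp_of_forall_setIntegral_eq ((canonFiltration X).le s) (hi t)
    (fun S _ _ => (hi s).integrableOn) (fun S hS _ => ?_)
    (hmeas s).stronglyMeasurable.aestronglyMeasurable).symm
  have hSm := (canonFiltration X).le s _ hS
  ext x
  rw [eval_integral fun i => (hc s i).integrableOn, eval_integral fun i => (hc t i).integrableOn]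
  have h := setIntegral_jump_eq_zero (r := r) (π := π) (q₀ := q₀) hS
    (h := fun p => (canon t (jumpPath q₀ p)).1 x - (canon s (jumpPath q₀ p)).1 x)
    (fun p hp => by
      have h2 : (s : ℝ) ≤ t := by exact_mod_cast hst
      rw [canon_jumpPath, canon_jumpPath, if_neg (not_lt.2 hp), if_neg (not_lt.2 (hp.trans h2)),
        sub_self])
    (by
      rw [integral_belief_increment hr hst (continuous_coord x), hπ.mean x]; simp)
  have hip : ∀ u, Integrable (fun p => (canon u (jumpPath q₀ p)).1 x) ((expMeasure r).prod π) :=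
    fun u => integrable_comp_belief ((measurable_canon u).comp (measurable_jumpPath q₀))
      (continuous_coord x)
  rw [integral_sub (hip t).integrableOn (hip s).integrableOn] at h
  rw [setIntegral_jumpLaw hSm (hc s x).aestronglyMeasurable,
    setIntegral_jumpLaw hSm (hc t x).aestronglyMeasurable]
  linarith

end JumpPath

section JumpPolicy

variable {X A : Type*} [Fintype X] [Fintype A] [Nonempty A] {M : Model X A}
  {q₀ : Belief X} {r : ℝ} {π : Measure (Belief X)}

/-! ### The jump policy is admissible and obedient -/

theorem ae_jumpTime_eq [IsProbabilityMeasure π] (hr : 0 < r) (hne : ∀ᵐ q ∂π, q ≠ q₀) :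
    ∀ᵐ p ∂((expMeasure r).prod π), 0 < p.1 ∧
      jumpTime q₀ (jumpPath q₀ p) = ENNReal.ofReal p.1 := by
  filter_upwards [ae_prod_regular hr hne] with p hp
  exact ⟨hp.1, jumpTime_jumpPath hp.1 hp.2⟩

theorem truncTime_jumpPath {p : ℝ × Belief X} (h0 : 0 < p.1)
    (h : jumpTime q₀ (jumpPath q₀ p) = ENNReal.ofReal p.1) (t : ℝ≥0) :
    (truncTime (jumpTime q₀) t (jumpPath q₀ p) : ℝ) = min (t : ℝ) p.1 := by
  unfold truncTime
  rw [h, ← ENNReal.ofReal_coe_nnreal, ← ENNReal.ofReal_min]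
  exact ENNReal.toReal_ofReal (le_min t.coe_nonneg h0.le)

theorem canon_truncTime_jumpPath {p : ℝ × Belief X} (h0 : 0 < p.1)
    (h : jumpTime q₀ (jumpPath q₀ p) = ENNReal.ofReal p.1) (t : ℝ≥0) :
    canon (truncTime (jumpTime q₀) t (jumpPath q₀ p)) (jumpPath q₀ p)
      = canon t (jumpPath q₀ p) := by
  rw [canon_jumpPath, canon_jumpPath, truncTime_jumpPath h0 h]
  simp

theorem measurable_jumpTime (q₀ : Belief X) : Measurable (jumpTime q₀) :=
  measurable_of_isStoppingTime (isStoppingTime_jumpTime q₀)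

theorem lintegral_jumpTime [IsProbabilityMeasure π] (hr : 0 < r) (hne : ∀ᵐ q ∂π, q ≠ q₀) :
    ∫⁻ w, jumpTime q₀ w ∂(jumpLaw q₀ r π) = ENNReal.ofReal (1 / r) := by
  rw [jumpLaw, lintegral_map (measurable_jumpTime q₀) (measurable_jumpPath q₀),
    lintegral_congr_ae ((ae_jumpTime_eq hr hne).mono fun p hp => hp.2),
    ← ofReal_integral_eq_lintegral_ofReal (integrable_fst_prod hr)
      ((ae_prod_regular hr hne).mono fun p hp => hp.1.le), integral_fst_prod hr]

/-- The condition `hcap` equates the entropy gained in the jump with `χ` times the mean waiting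
time. By memorylessness this holds from every date before the jump, so the deterministic process `χ
t` is the information acquired. -/
theorem isAdmissible_jumpLaw (hH : ContinuousOn M.H (stdSimplex ℝ X)) (hr : 0 < r)
    (hχ : 0 < M.χ) (hπ : IsBayesPlausible q₀ π) (hne : ∀ᵐ q ∂π, q ≠ q₀)
    (hcap : (∫ q, M.H q.1 ∂π) - M.H q₀.1 = M.χ / r) :
    M.IsAdmissible q₀ (jumpLaw q₀ r π) (fun t _ => M.χ * t) (jumpTime q₀) := by
  have := hπ.prob
  have := isProbabilityMeasure_expMeasure hr
  have := isProbabilityMeasure_jumpLaw (q₀ := q₀) (π := π) hr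
  have hτm := measurable_jumpTime q₀
  refine ⟨inferInstance, martingale_jumpLaw hr hπ, ?_, fun t => stronglyMeasurable_const, ?_, ?_,
    isStoppingTime_jumpTime q₀, ?_, ?_, ?_⟩
  · refine ae_jumpLaw_iff ?_ (measurable_canon 0 (measurableSet_singleton q₀))
    filter_upwards [ae_prod_regular hr hne] with p hp
    rw [canon_jumpPath, if_pos (by simpa using hp.1)]
  · exact ae_of_all _ fun w s t hst =>
      mul_le_mul_of_nonneg_left (by exact_mod_cast hst) hχ.le
  · exact ae_of_all _ fun w => by simp
  · refine ae_jumpLaw_iff ?_ (measurableSet_lt hτm measurable_const)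
    filter_upwards [ae_jumpTime_eq hr hne] with p hp
    rw [hp.2]; exact ENNReal.ofReal_lt_top
  · intro s t hst
    have hHi : ∀ u, Integrable (fun w => M.H (canon (truncTime (jumpTime q₀) u w) w).1)
        (jumpLaw q₀ r π) := fun u =>
      integrable_comp_belief (measurable_canon_eval (measurable_truncTime hτm u))
        (M.continuous_H hH)
    have hIi : ∀ u, Integrable (fun w => M.χ * (truncTime (jumpTime q₀) u w : ℝ))
        (jumpLaw q₀ r π) := fun u => by
      refine Integrable.of_bound ((measurable_truncTime hτm u).coe_nnreal_real.const_mul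
        _).aestronglyMeasurable (M.χ * u) (ae_of_all _ fun w => ?_)
      rw [Real.norm_of_nonneg (by positivity)]
      refine mul_le_mul_of_nonneg_left ?_ hχ.le
      have : truncTime (jumpTime q₀) u w ≤ u := by
        unfold truncTime
        simpa using ENNReal.toNNReal_mono ENNReal.coe_ne_top (min_le_left (u : ℝ≥0∞) _)
      exact_mod_cast this
    have hd1 : Integrable (fun w => M.H (canon (truncTime (jumpTime q₀) t w) w).1
        - M.H (canon (truncTime (jumpTime q₀) s w) w).1) (jumpLaw q₀ r π) :=
      (hHi t).sub (hHi s)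
    have hd2 : Integrable (fun w => M.χ * (truncTime (jumpTime q₀) t w : ℝ)
        - M.χ * (truncTime (jumpTime q₀) s w : ℝ)) (jumpLaw q₀ r π) :=
      (hIi t).sub (hIi s)
    refine (ae_eq_condExp_of_forall_setIntegral_eq ((canonFiltration X).le s) hd1
      (fun S _ _ => integrable_condExp.integrableOn) (fun S hS _ => ?_)
      stronglyMeasurable_condExp.aestronglyMeasurable).symm
    have hSm := (canonFiltration X).le s _ hS
    rw [setIntegral_condExp _ hd2 hS, setIntegral_jumpLaw hSm hd2.aestronglyMeasurable,
      setIntegral_jumpLaw hSm hd1.aestronglyMeasurable]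
    have hHp : Integrable (fun p => M.H (canon t (jumpPath q₀ p)).1
        - M.H (canon s (jumpPath q₀ p)).1) ((expMeasure r).prod π) :=
      (integrable_comp_belief ((measurable_canon t).comp (measurable_jumpPath q₀))
        (M.continuous_H hH)).sub (integrable_comp_belief
          ((measurable_canon s).comp (measurable_jumpPath q₀)) (M.continuous_H hH))
    have hTp : Integrable (fun p : ℝ × Belief X => M.χ * (min (t : ℝ) p.1 - min (s : ℝ) p.1))
        ((expMeasure r).prod π) :=
      (((integrable_const _).inf (integrable_fst_prod hr)).sub
        ((integrable_const _).inf (integrable_fst_prod hr))).const_mul _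
    have h := setIntegral_jump_eq_zero (r := r) (π := π) (q₀ := q₀) hS
      (h := fun p => (M.H (canon t (jumpPath q₀ p)).1 - M.H (canon s (jumpPath q₀ p)).1)
        - M.χ * (min (t : ℝ) p.1 - min (s : ℝ) p.1))
      (fun p hp => by
        have h2 : (s : ℝ) ≤ t := by exact_mod_cast hst
        rw [canon_jumpPath, canon_jumpPath, if_neg (not_lt.2 hp), if_neg (not_lt.2 (hp.trans h2)),
          min_eq_right hp, min_eq_right (hp.trans h2)]
        simp)
      (by
        rw [integral_sub hHp.integrableOn hTp.integrableOn, integral_const_mul,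
          integral_belief_increment hr hst (M.continuous_H hH), integral_time_increment hr hst,
          hcap]
        ring)
    rw [integral_sub hHp.integrableOn hTp.integrableOn] at h
    have e1 : ∫ p in jumpPath q₀ ⁻¹' S,
        (M.H (canon (truncTime (jumpTime q₀) t (jumpPath q₀ p)) (jumpPath q₀ p)).1
          - M.H (canon (truncTime (jumpTime q₀) s (jumpPath q₀ p)) (jumpPath q₀ p)).1)
          ∂((expMeasure r).prod π)
        = ∫ p in jumpPath q₀ ⁻¹' S, (M.H (canon t (jumpPath q₀ p)).1
          - M.H (canon s (jumpPath q₀ p)).1) ∂((expMeasure r).prod π) := by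
      refine integral_congr_ae (ae_restrict_of_ae ?_)
      filter_upwards [ae_jumpTime_eq hr hne] with p hp
      rw [canon_truncTime_jumpPath hp.1 hp.2, canon_truncTime_jumpPath hp.1 hp.2]
    have e2 : ∫ p in jumpPath q₀ ⁻¹' S,
        (M.χ * (truncTime (jumpTime q₀) t (jumpPath q₀ p) : ℝ)
          - M.χ * (truncTime (jumpTime q₀) s (jumpPath q₀ p) : ℝ)) ∂((expMeasure r).prod π)
        = ∫ p in jumpPath q₀ ⁻¹' S, M.χ * (min (t : ℝ) p.1 - min (s : ℝ) p.1)
          ∂((expMeasure r).prod π) := by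
      refine integral_congr_ae (ae_restrict_of_ae ?_)
      filter_upwards [ae_jumpTime_eq hr hne] with p hp
      rw [truncTime_jumpPath hp.1 hp.2, truncTime_jumpPath hp.1 hp.2]; ring
    rw [e1, e2]
    linarith
  · exact ae_of_all _ fun w s t _ _ => by rw [mul_sub]

/-- A stopping time is, before the jump, the constant it is on the path that never jumps; otherwise
it does not precede the jump. -/
theorem stoppingTime_jumpPath {τ' : BeliefPath X → ℝ≥0∞}
    (hτ' : IsStoppingTime (canonFiltration X) τ') {p : ℝ × Belief X} (h0 : 0 < p.1) :
    (τ' (jumpPath q₀ (0, q₀)) < ENNReal.ofReal p.1 →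
        τ' (jumpPath q₀ p) = τ' (jumpPath q₀ (0, q₀))) ∧
      (ENNReal.ofReal p.1 ≤ τ' (jumpPath q₀ (0, q₀)) → ENNReal.ofReal p.1 ≤ τ' (jumpPath q₀ p)) := by
  -- A jump from `q₀` to itself leaves the constant path, the reference for "no jump yet".
  have hconst : ∀ t, canon t (jumpPath q₀ (0, q₀)) = q₀ := fun t => by
    rw [canon_jumpPath]; simp
  have hiff : ∀ d : ℝ≥0, (d : ℝ≥0∞) < ENNReal.ofReal p.1 →
      (τ' (jumpPath q₀ p) ≤ d ↔ τ' (jumpPath q₀ (0, q₀)) ≤ d) := fun d hd =>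
    mem_iff_of_agree (hτ' d) fun t ht => by
      have h1 : (d : ℝ) < p.1 := by
        rw [← ENNReal.ofReal_coe_nnreal] at hd
        exact (ENNReal.ofReal_lt_ofReal_iff h0).1 hd
      have h2 : (t : ℝ) ≤ d := by exact_mod_cast ht
      rw [hconst, canon_jumpPath, if_pos (h2.trans_lt h1)]
  refine ⟨fun hc => ?_, fun hc => ?_⟩
  · refine le_antisymm ?_ ?_
    · lift τ' (jumpPath q₀ (0, q₀)) to ℝ≥0 using hc.ne_top with d hd
      exact (hiff d hc).2 le_rfl
    · by_contra hlt
      have hlt' := not_le.1 hlt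
      have h3 := hlt'.trans hc
      lift τ' (jumpPath q₀ p) to ℝ≥0 using hlt'.ne_top with d hd
      exact hlt ((hiff d h3).1 le_rfl)
  · by_contra hlt
    have hlt' := not_le.1 hlt
    lift τ' (jumpPath q₀ p) to ℝ≥0 using hlt'.ne_top with d hd
    exact absurd (hc.trans ((hiff d hlt').1 le_rfl)) (not_le.2 hlt')

/-- After the jump, waiting is costly and teaches nothing. Before it, a stopping time is a constant
`c`, and stopping there forgoes `exp(-r c)` times the gain in `uhat` less `κ / r`, which `hcost`
makes nonnegative. -/
theorem isAgentOptimal_jumpLaw (hκ : 0 < M.κ) (hr : 0 < r) (hπ : IsBayesPlausible q₀ π)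
    (hne : ∀ᵐ q ∂π, q ≠ q₀) (hcost : M.κ / r ≤ (∫ q, M.uhat q ∂π) - M.uhat q₀) :
    M.IsAgentOptimal (jumpLaw q₀ r π) (jumpTime q₀) := by
  have := hπ.prob
  have := isProbabilityMeasure_expMeasure hr
  have := isProbabilityMeasure_jumpLaw (q₀ := q₀) (π := π) hr
  have hJ := measurable_jumpPath q₀
  refine ⟨isStoppingTime_jumpTime q₀, by rw [lintegral_jumpTime hr hne]; simp, ?_⟩
  intro τ' hτ' hfin
  have hpay : ∀ {σ : BeliefPath X → ℝ≥0∞}, Measurable σ → ∫⁻ w, σ w ∂(jumpLaw q₀ r π) ≠ ∞ →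
      Integrable (fun w => M.uhat (stoppedBelief σ w) - M.κ * (σ w).toReal) (jumpLaw q₀ r π) :=
    fun hσ hσi => (integrable_comp_belief (measurable_stoppedBelief hσ) M.continuous_uhat).sub
      ((integrable_toReal_time hσ hσi).const_mul _)
  have hτm := measurable_of_isStoppingTime hτ'
  have hτfin : ∀ᵐ p ∂((expMeasure r).prod π), τ' (jumpPath q₀ p) < ∞ :=
    ae_of_ae_map hJ.aemeasurable (ae_lt_top hτm hfin)
  have hpay' := hpay hτm hfin
  have hpayJ := hpay (measurable_jumpTime q₀) (by rw [lintegral_jumpTime hr hne]; simp)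
  unfold Model.agentPayoff
  rw [jumpLaw, integral_map hJ.aemeasurable hpay'.aestronglyMeasurable,
    integral_map hJ.aemeasurable hpayJ.aestronglyMeasurable]
  set Q := (expMeasure r).prod π with hQ
  have hui : Integrable (fun p : ℝ × Belief X => M.uhat p.2 - M.uhat q₀) Q :=
    integrable_belief_prod hr M.continuous_uhat _
  have hui' : Integrable (fun p : ℝ × Belief X => M.uhat p.2) Q :=
    integrable_comp_belief measurable_snd M.continuous_uhat
  have hTi : Integrable (fun p : ℝ × Belief X => p.1) Q := integrable_fst_prod hr
  have eJ : ∫ p, (M.uhat (stoppedBelief (jumpTime q₀) (jumpPath q₀ p))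
      - M.κ * (jumpTime q₀ (jumpPath q₀ p)).toReal) ∂Q = ∫ p, (M.uhat p.2 - M.κ * p.1) ∂Q := by
    refine integral_congr_ae ?_
    filter_upwards [ae_jumpTime_eq hr hne] with p hp
    have hT : ((jumpTime q₀ (jumpPath q₀ p)).toNNReal : ℝ) = p.1 := by
      rw [hp.2]; exact ENNReal.toReal_ofReal hp.1.le
    have h1 : stoppedBelief (jumpTime q₀) (jumpPath q₀ p) = p.2 := by
      unfold stoppedBelief
      rw [canon_jumpPath, hT, if_neg (lt_irrefl _)]
    rw [h1]
    exact congrArg (fun a => M.uhat p.2 - M.κ * a) hT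
  rw [eJ]
  have hlate : ∀ p : ℝ × Belief X, 0 < p.1 → τ' (jumpPath q₀ p) < ∞ →
      ENNReal.ofReal p.1 ≤ τ' (jumpPath q₀ p) →
      M.uhat (stoppedBelief τ' (jumpPath q₀ p)) - M.κ * (τ' (jumpPath q₀ p)).toReal
        ≤ M.uhat p.2 - M.κ * p.1 := by
    intro p h0 hf hle
    have h1 : p.1 ≤ (τ' (jumpPath q₀ p)).toReal :=
      (ENNReal.ofReal_le_iff_le_toReal hf.ne).1 hle
    have h2 : stoppedBelief τ' (jumpPath q₀ p) = p.2 := by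
      unfold stoppedBelief
      exact if_neg (not_lt.2 h1)
    rw [h2]
    have := mul_le_mul_of_nonneg_left h1 hκ.le
    linarith
  have hp'i : Integrable (fun p => M.uhat (stoppedBelief τ' (jumpPath q₀ p))
      - M.κ * (τ' (jumpPath q₀ p)).toReal) Q :=
    (integrable_map_measure hpay'.aestronglyMeasurable hJ.aemeasurable).1 hpay'
  have hbase : Integrable (fun p : ℝ × Belief X => M.uhat p.2 - M.κ * p.1) Q :=
    hui'.sub (hTi.const_mul _)
  rcases eq_or_ne (τ' (jumpPath q₀ (0, q₀))) ∞ with htop | hctop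
  · refine integral_mono_ae hp'i hbase ?_
    filter_upwards [ae_prod_regular hr hne, hτfin] with p hp hf
    exact hlate p hp.1 hf ((stoppingTime_jumpPath hτ' hp.1).2 (by rw [htop]; exact le_top))
  · obtain ⟨c, hc⟩ : ∃ c : ℝ≥0, (c : ℝ≥0∞) = τ' (jumpPath q₀ (0, q₀)) :=
      ⟨_, ENNReal.coe_toNNReal hctop⟩
    -- the loss from stopping at `c` when the jump has not occurred yet
    let F : ℝ × Belief X → ℝ := fun p => (M.uhat p.2 - M.uhat q₀) - M.κ * (p.1 - c)
    have hFi : Integrable F Q := hui.sub ((hTi.sub (integrable_const _)).const_mul _)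
    have hset : MeasurableSet (Set.Ioi (c : ℝ) ×ˢ (Set.univ : Set (Belief X))) :=
      measurableSet_Ioi.prod MeasurableSet.univ
    have hFnn : 0 ≤ ∫ p, (Set.Ioi (c : ℝ) ×ˢ Set.univ).indicator F p ∂Q := by
      rw [integral_indicator hset]
      have e : ∫ p in Set.Ioi (c : ℝ) ×ˢ Set.univ, F p ∂Q
          = Real.exp (-(r * c)) * ((∫ q, M.uhat q ∂π) - M.uhat q₀)
            - M.κ * (Real.exp (-(r * c)) / r) := by
        rw [← integral_belief_after hr c.coe_nonneg M.continuous_uhat,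
          ← integral_excess_after (π := π) hr c.coe_nonneg, ← integral_const_mul]
        exact integral_sub hui.integrableOn
          ((hTi.sub (integrable_const _)).const_mul _).integrableOn
      rw [e]
      have := mul_le_mul_of_nonneg_left hcost (Real.exp_pos (-(r * c))).le
      have e2 : Real.exp (-(r * c)) * (M.κ / r) = M.κ * (Real.exp (-(r * c)) / r) := by ring
      linarith
    have hle : ∫ p, (M.uhat (stoppedBelief τ' (jumpPath q₀ p))
        - M.κ * (τ' (jumpPath q₀ p)).toReal) ∂Q
        ≤ ∫ p, ((M.uhat p.2 - M.κ * p.1) - (Set.Ioi (c : ℝ) ×ˢ Set.univ).indicator F p) ∂Q := by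
      refine integral_mono_ae hp'i (hbase.sub (hFi.indicator hset)) ?_
      filter_upwards [ae_prod_regular hr hne, hτfin] with p hp hf
      obtain ⟨h1, h2⟩ := stoppingTime_jumpPath (q₀ := q₀) hτ' hp.1
      rw [← hc] at h1 h2
      rcases lt_or_ge (c : ℝ) p.1 with h | h
      · have hc1 : (c : ℝ≥0∞) < ENNReal.ofReal p.1 := by
          rw [← ENNReal.ofReal_coe_nnreal]
          exact (ENNReal.ofReal_lt_ofReal_iff hp.1).2 h
        have h3 : stoppedBelief τ' (jumpPath q₀ p) = q₀ := by
          unfold stoppedBelief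
          rw [h1 hc1, canon_jumpPath, ENNReal.toNNReal_coe, if_pos h]
        rw [h3, h1 hc1,
          Set.indicator_of_mem (show p ∈ Set.Ioi (c : ℝ) ×ˢ Set.univ from ⟨h, trivial⟩)]
        simp only [F, ENNReal.coe_toReal]
        linarith
      · have hc1 : ENNReal.ofReal p.1 ≤ (c : ℝ≥0∞) := by
          rw [← ENNReal.ofReal_coe_nnreal]
          exact ENNReal.ofReal_le_ofReal h
        rw [Set.indicator_of_notMem fun h' => not_lt.2 h h'.1, sub_zero]
        exact hlate p hp.1 hf (h2 hc1)
    rw [integral_sub hbase (hFi.indicator hset)] at hle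
    linarith

theorem engagement_jumpLaw (hr : 0 < r) [IsProbabilityMeasure π] (hne : ∀ᵐ q ∂π, q ≠ q₀) :
    M.engagement (jumpLaw q₀ r π) (fun t _ => M.χ * t) (jumpTime q₀) = M.ρ * (M.χ / r) := by
  unfold Model.engagement
  have hmeas : Measurable fun w => M.χ * (((jumpTime q₀ w).toNNReal : ℝ≥0) : ℝ) :=
    (measurable_jumpTime q₀).ennreal_toNNReal.coe_nnreal_real.const_mul _
  rw [jumpLaw, integral_map (measurable_jumpPath q₀).aemeasurable hmeas.aestronglyMeasurable]
  have e : ∫ p, M.χ * (((jumpTime q₀ (jumpPath q₀ p)).toNNReal : ℝ≥0) : ℝ)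
      ∂((expMeasure r).prod π) = ∫ p : ℝ × Belief X, M.χ * p.1 ∂((expMeasure r).prod π) := by
    refine integral_congr_ae ?_
    filter_upwards [ae_jumpTime_eq hr hne] with p hp
    rw [hp.2]
    exact congrArg (M.χ * ·) (ENNReal.toReal_ofReal hp.1.le)
  rw [e, integral_const_mul, integral_fst_prod hr]
  ring

/-! ### Attaining the value of the relaxed problem -/

/-- Discarding an atom at the prior keeps feasibility and does not lower the objective. -/
theorem exists_feasible_without_atom (hH : ContinuousOn M.H (stdSimplex ℝ X))
    (hπ : M.IsRelaxedFeasible q₀ π) (hpos : M.H q₀.1 < ∫ q, M.H q.1 ∂π) :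
    ∃ π', M.IsRelaxedFeasible q₀ π' ∧ (∀ᵐ q ∂π', q ≠ q₀) ∧
      ∫ q, M.H q.1 ∂π ≤ ∫ q, M.H q.1 ∂π' := by
  have hf := (M.isRelaxedFeasible_iff hH).1 hπ
  have := hf.1.prob
  have cH := M.continuous_H hH
  set B : Set (Belief X) := {q₀}ᶜ with hB
  have hBm : MeasurableSet B := (measurableSet_singleton q₀).compl
  -- centered integrals ignore the atom
  have hcent : ∀ φ : Belief X → ℝ, Continuous φ →
      ∫ q in B, (φ q - φ q₀) ∂π = (∫ q, φ q ∂π) - φ q₀ := fun φ hφ => by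
    rw [← integral_sub_const π hφ]
    refine setIntegral_eq_integral_of_forall_compl_eq_zero fun q hq => ?_
    have : q = q₀ := by simpa [hB] using hq
    rw [this, sub_self]
  have hB0 : π B ≠ 0 := fun h => by
    have h1 := hcent _ cH
    rw [Measure.restrict_eq_zero.2 h, integral_zero_measure] at h1
    linarith
  set b := (π B).toReal with hb
  have hbpos : 0 < b := ENNReal.toReal_pos hB0 (measure_ne_top _ _)
  have hb1 : b ≤ 1 := ENNReal.toReal_le_of_le_ofReal zero_le_one (by simpa using prob_le_one)
  -- Conditioning away from the prior multiplies every deviation from the value at the prior by `1/b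
  -- ≥ 1`: the barycenter stays, the net gain stays nonnegative, and the entropy gain does not fall.
  have hint : ∀ φ : Belief X → ℝ, Continuous φ →
      ∫ q, φ q ∂(ProbabilityTheory.cond π B) = φ q₀ + b⁻¹ * ((∫ q, φ q ∂π) - φ q₀) := by
    intro φ hφ
    have := cond_isProbabilityMeasure hB0
    have h1 := integral_sub_const (ProbabilityTheory.cond π B) hφ (φ q₀)
    have h2 : ∫ q, (φ q - φ q₀) ∂(ProbabilityTheory.cond π B)
        = b⁻¹ * ((∫ q, φ q ∂π) - φ q₀) := by
      rw [ProbabilityTheory.cond, integral_smul_measure, hcent φ hφ, ENNReal.toReal_inv,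
        smul_eq_mul]
    linarith
  have hbinv : 1 ≤ b⁻¹ := (one_le_inv₀ hbpos).2 hb1
  refine ⟨ProbabilityTheory.cond π B, ?_, ?_, ?_⟩
  · rw [M.isRelaxedFeasible_iff hH]
    refine ⟨⟨cond_isProbabilityMeasure hB0, fun x => ?_⟩, ?_⟩
    · rw [hint _ (continuous_coord x), hf.1.mean]; simp
    · rw [hint _ (M.continuous_netValue hH)]
      have := mul_nonneg (inv_nonneg.2 hbpos.le) (sub_nonneg.2 hf.2)
      linarith
  · filter_upwards [ae_cond_mem hBm] with q hq
    simpa [hB] using hq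
  · rw [hint _ cH]
    have := mul_le_mul_of_nonneg_right hbinv (sub_nonneg.2 hpos.le)
    linarith

/-- Every value of the relaxed problem is attained by an obedient admissible policy. -/
theorem exists_policy_of_feasible (hκ : 0 < M.κ) (hχ : 0 < M.χ) (hρ : 0 < M.ρ)
    (hH : ContinuousOn M.H (stdSimplex ℝ X)) (hπ : M.IsRelaxedFeasible q₀ π)
    (hpos : M.H q₀.1 < ∫ q, M.H q.1 ∂π) :
    ∃ (P : Measure (BeliefPath X)) (I : ℝ≥0 → BeliefPath X → ℝ) (τ : BeliefPath X → ℝ≥0∞),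
      M.IsAdmissible q₀ P I τ ∧ M.IsAgentOptimal P τ ∧
        M.ρ * ((∫ q, M.H q.1 ∂π) - M.H q₀.1) ≤ M.engagement P I τ := by
  -- A jump onto the prior would be invisible to `jumpTime`, hence the removal of the atom.
  obtain ⟨π', hfeas, hne, hle⟩ := exists_feasible_without_atom hH hπ hpos
  have hf := (M.isRelaxedFeasible_iff hH).1 hfeas
  have := hf.1.prob
  set a := (∫ q, M.H q.1 ∂π') - M.H q₀.1 with ha
  have hapos : 0 < a := by linarith
  -- At rate `χ / a` the mean waiting time is the time needed to process the entropy gain `a` at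
  -- full capacity.
  have hr : 0 < M.χ / a := div_pos hχ hapos
  have hχr : M.χ / (M.χ / a) = a := by field_simp
  refine ⟨_, _, _, isAdmissible_jumpLaw hH hr hχ hf.1 hne (by rw [hχr]),
    isAgentOptimal_jumpLaw hκ hr hf.1 hne ?_, ?_⟩
  · have h := hf.2
    rw [integral_netValue hH] at h
    unfold Model.netValue at h
    have e : M.κ / (M.χ / a) = M.κ / M.χ * a := by field_simp
    rw [e, ha]
    linarith
  · rw [engagement_jumpLaw hr hne, hχr]
    exact mul_le_mul_of_nonneg_left (by linarith) hρ.le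

end JumpPolicy

/-! ### Solutions of the principal's problem: the stopped law and the remaining time -/

section Solutions

variable {X A : Type*} [Fintype X] [Fintype A] [Nonempty A] {M : Model X A}
  {P : Measure (BeliefPath X)} {τ : BeliefPath X → ℝ≥0∞} {I : ℝ≥0 → BeliefPath X → ℝ}
  {q₀ : Belief X}

/-- The law of the belief at the stopping time of a solution solves the relaxed problem. -/
theorem Model.IsPrincipalSolution.isRelaxedSolution_law (hκ : 0 < M.κ) (hχ : 0 < M.χ)
    (hρ : 0 < M.ρ) (hH : ContinuousOn M.H (stdSimplex ℝ X)) (h : M.IsPrincipalSolution q₀ P I τ) :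
    M.IsRelaxedSolution q₀ (P.map (stoppedBelief τ)) := by
  have ha := h.admissible
  have ho := h.incentive
  have hfeas := ha.isRelaxedFeasible_law hκ hχ hH ho
  have := hfeas.plausible.prob
  refine ⟨hfeas, fun π' hπ' => mul_le_mul_of_nonneg_left ?_ hρ.le⟩
  have := hπ'.plausible.prob
  rw [integral_sub_const _ (M.continuous_H hH), integral_sub_const _ (M.continuous_H hH)]
  have hI := ha.integral_info hχ hH ho.integrable
  -- A competitor without entropy gain cannot beat the nonnegative `E[I_τ]`; any other is compared
  -- through its jump policy.
  rcases lt_or_ge (M.H q₀.1) (∫ q, M.H q.1 ∂π') with hlt | hge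
  · obtain ⟨P', I', τ', ha', ho', hval⟩ := exists_policy_of_feasible hκ hχ hρ hH hπ' hlt
    have h1 := hval.trans (h.optimal P' I' τ' ha' ho')
    unfold Model.engagement at h1
    rw [hI] at h1
    exact le_of_mul_le_mul_left h1 hρ
  · have h1 : 0 ≤ ∫ w, I (τ w).toNNReal w ∂P :=
      integral_nonneg_of_ae (ha.capacity_bound.mono fun w hw => (hw _ (coe_toNNReal_time_le w)).1)
    linarith

/-- Continuing until the stopping time never lowers the expected net value. -/
theorem Model.IsAdmissible.setIntegral_netValue_le (hκ : 0 < M.κ) (hχ : 0 < M.χ)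
    (hH : ContinuousOn M.H (stdSimplex ℝ X)) (ha : M.IsAdmissible q₀ P I τ)
    (ho : M.IsAgentOptimal P τ) {s : ℝ≥0} {S : Set (BeliefPath X)}
    (hS : MeasurableSet[canonFiltration X s] S) (hSτ : S ⊆ {w | (s : ℝ≥0∞) ≤ τ w}) :
    ∫ w in S, M.netValue (canon s w) ∂P ≤ ∫ w in S, M.netValue (stoppedBelief τ w) ∂P := by
  have := ha.prob
  have hτm := measurable_of_isStoppingTime ha.stopping
  have hSm : MeasurableSet S := (canonFiltration X).le s _ hS
  have h1 := ho.setIntegral_le hS hSτ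
  have h2 := ha.setIntegral_entropy hχ hH ho.integrable hS hSτ
  have hsplit : ∀ Z : BeliefPath X → Belief X, Measurable Z →
      ∫ w in S, M.netValue (Z w) ∂P
        = ∫ w in S, M.uhat (Z w) ∂P - M.κ / M.χ * ∫ w in S, M.H (Z w).1 ∂P := by
    intro Z hZ
    unfold Model.netValue
    rw [integral_sub (integrable_comp_belief hZ M.continuous_uhat).integrableOn
      ((integrable_comp_belief hZ (M.continuous_H hH)).const_mul _).integrableOn,
      integral_const_mul]
  rw [hsplit _ (measurable_canon s), hsplit _ (measurable_stoppedBelief hτm)]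
  have hτi := integrable_toReal_time (P := P) hτm ho.integrable
  have hIτ := ha.integrable_info hχ ho.integrable hτm.ennreal_toNNReal
    (ae_of_all _ fun w => coe_toNNReal_time_le w)
  -- Capacity bounds the information still to come by the remaining time, whose cost obedience
  -- bounds by the gain in `uhat`.
  have h3 : ∫ w in S, (I (τ w).toNNReal w - I s w) ∂P
      ≤ M.χ * ∫ w in S, ((τ w).toReal - s) ∂P := by
    rw [← integral_const_mul]
    refine integral_mono_of_nonneg ?_
      ((hτi.sub (integrable_const _)).const_mul _).integrableOn ?_
    · rw [EventuallyLE, ae_restrict_iff' hSm]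
      filter_upwards [ha.increasing, ha.finite] with w hm hf hw
      exact sub_nonneg.2 (hm ((ENNReal.le_toNNReal_of_coe_le (hSτ hw) hf.ne)))
    · rw [EventuallyLE, ae_restrict_iff' hSm]
      filter_upwards [ha.capacity, ha.finite] with w hc hf hw
      exact hc _ _ (ENNReal.le_toNNReal_of_coe_le (hSτ hw) hf.ne) (coe_toNNReal_time_le w)
  rw [← h2] at h3
  have h4 := mul_le_mul_of_nonneg_left h3 (div_pos hκ hχ).le
  have h5 : M.κ / M.χ * (M.χ * ∫ w in S, ((τ w).toReal - s) ∂P)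
      = M.κ * ∫ w in S, ((τ w).toReal - s) ∂P := by field_simp
  rw [h5] at h4
  linarith

/-- If `H + θ g` is an affine function on the support of the stopped belief, then the gap between
the two bounds the expected remaining time. -/
theorem Model.IsAdmissible.setIntegral_remaining_time_le (hκ : 0 < M.κ) (hχ : 0 < M.χ)
    (hH : ContinuousOn M.H (stdSimplex ℝ X)) (ha : M.IsAdmissible q₀ P I τ)
    (ho : M.IsAgentOptimal P τ)
    (hfull : ∀ᵐ w ∂P, I (τ w).toNNReal w = M.χ * (τ w).toReal)
    {c : X → ℝ} {θ : ℝ} (hθ : 0 ≤ θ)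
    (haff : ∀ᵐ w ∂P, M.H (stoppedBelief τ w).1 + θ * M.netValue (stoppedBelief τ w)
      = ∑ x, c x * (stoppedBelief τ w).1 x) {s : ℝ≥0} {S : Set (BeliefPath X)}
    (hS : MeasurableSet[canonFiltration X s] S) (hSτ : S ⊆ {w | (s : ℝ≥0∞) ≤ τ w}) :
    M.χ * ∫ w in S, ((τ w).toReal - s) ∂P
      ≤ ∫ w in S, (∑ x, c x * (canon s w).1 x - θ * M.netValue (canon s w)
          - M.H (canon s w).1) ∂P := by
  have := ha.prob
  have hτm := measurable_of_isStoppingTime ha.stopping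
  have hSm : MeasurableSet S := (canonFiltration X).le s _ hS
  have cH := M.continuous_H hH
  have cg := M.continuous_netValue hH
  have hτi := integrable_toReal_time (P := P) hτm ho.integrable
  have hIτ := ha.integrable_info hχ ho.integrable hτm.ennreal_toNNReal
    (ae_of_all _ fun w => coe_toNNReal_time_le w)
  have hZ := measurable_stoppedBelief hτm
  have hcoord : ∀ (Z : BeliefPath X → Belief X), Measurable Z → ∀ x,
      Integrable (fun w => c x * (Z w).1 x) (P.restrict S) := fun Z hZ x =>
    ((integrable_comp_belief hZ (continuous_coord x)).const_mul _).integrableOn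
  have h1 := ha.setIntegral_entropy hχ hH ho.integrable hS hSτ
  have h2 := ha.setIntegral_netValue_le hκ hχ hH ho hS hSτ
  -- Since `I_τ = χ τ` and `I_s ≤ χ s`, at least `χ (τ - s)` remains to be acquired after `s`.
  have h3 : M.χ * ∫ w in S, ((τ w).toReal - s) ∂P
      ≤ ∫ w in S, (I (τ w).toNNReal w - I s w) ∂P := by
    rw [← integral_const_mul]
    refine integral_mono_of_nonneg ?_ ?_ ?_
    · rw [EventuallyLE, ae_restrict_iff' hSm]
      filter_upwards [ha.finite] with w hf hw
      refine mul_nonneg hχ.le (sub_nonneg.2 ?_)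
      exact_mod_cast ENNReal.toReal_mono hf.ne (hSτ hw)
    · have hIs : Integrable (fun w => I (truncTime τ s w) w) P :=
        ha.integrable_info hχ ho.integrable (measurable_truncTime hτm s)
          (ae_of_all _ fun w => coe_truncTime_le τ s w)
      refine (hIτ.sub hIs).integrableOn.congr ?_
      rw [EventuallyEq, ae_restrict_iff' hSm]
      refine ae_of_all _ fun w hw => ?_
      have : truncTime τ s w = s := by
        unfold truncTime; rw [min_eq_left (hSτ hw), ENNReal.toNNReal_coe]
      simp only [Pi.sub_apply, this]
    · rw [EventuallyLE, ae_restrict_iff' hSm]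
      filter_upwards [ha.capacity_bound, hfull] with w hb hf hw
      have := (hb s (hSτ hw)).2
      rw [hf]; linarith
  -- On the support, `H` is the affine part minus `θ g`. Optional stopping carries the affine part
  -- back to `s`; for `g` the inequality `h2` has the right direction because `θ ≥ 0`.
  have h4 : ∫ w in S, M.H (stoppedBelief τ w).1 ∂P
      = (∑ x, ∫ w in S, c x * (stoppedBelief τ w).1 x ∂P)
        - θ * ∫ w in S, M.netValue (stoppedBelief τ w) ∂P := by
    rw [← integral_finsetSum _ fun x _ => hcoord _ hZ x, ← integral_const_mul,
      ← integral_sub (integrable_finsetSum _ fun x _ => hcoord _ hZ x)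
        ((integrable_comp_belief hZ cg).const_mul _).integrableOn]
    refine integral_congr_ae (ae_restrict_of_ae ?_)
    filter_upwards [haff] with w hw
    linarith
  have h5 : ∀ x, ∫ w in S, c x * (stoppedBelief τ w).1 x ∂P
      = ∫ w in S, c x * (canon s w).1 x ∂P := fun x => by
    rw [integral_const_mul, integral_const_mul,
      setIntegral_stoppedBelief ha.martingale ha.stopping ha.finite hS hSτ x]
  have hc := measurable_canon (X := X) s
  have h6 : ∫ w in S, (∑ x, c x * (canon s w).1 x - θ * M.netValue (canon s w)
      - M.H (canon s w).1) ∂P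
      = (∑ x, ∫ w in S, c x * (canon s w).1 x ∂P) - θ * ∫ w in S, M.netValue (canon s w) ∂P
        - ∫ w in S, M.H (canon s w).1 ∂P := by
    have i1 := integrable_finsetSum Finset.univ fun x _ => hcoord _ hc x
    have i2 : Integrable (fun w => θ * M.netValue (canon s w)) (P.restrict S) :=
      ((integrable_comp_belief hc cg).const_mul _).integrableOn
    have i3 : Integrable (fun w => ∑ x, c x * (canon s w).1 x - θ * M.netValue (canon s w))
        (P.restrict S) := i1.sub i2
    rw [integral_sub i3 (integrable_comp_belief hc cH).integrableOn, integral_sub i1 i2,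
      integral_finsetSum _ fun x _ => hcoord _ hc x, integral_const_mul]
  rw [h6]
  simp_rw [h5] at h4
  have := mul_le_mul_of_nonneg_left h2 hθ
  linarith

/-! ### Avoidance of the zeros of the gap function before stopping -/

/-- A maximal inequality: a continuous function of the belief that bounds the expected remaining
time cannot vanish before the stopping time. -/
theorem ae_forall_ne_zero_of_remaining_time_le [IsProbabilityMeasure P]
    (hτ : IsStoppingTime (canonFiltration X) τ) (hint : ∫⁻ w, τ w ∂P ≠ ∞)
    (hfin : ∀ᵐ w ∂P, τ w < ∞) {a : ℝ} (ha : 0 < a) {Γ : Belief X → ℝ} (hΓ : Continuous Γ)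
    (hrem : ∀ (s : ℝ≥0) (S : Set (BeliefPath X)), MeasurableSet[canonFiltration X s] S →
      S ⊆ {w | (s : ℝ≥0∞) ≤ τ w} →
      a * ∫ w in S, ((τ w).toReal - s) ∂P ≤ ∫ w in S, Γ (canon s w) ∂P) :
    ∀ᵐ w ∂P, ∀ t : ℝ≥0, (t : ℝ≥0∞) < τ w → Γ (canon t w) ≠ 0 := by
  have hτm := measurable_of_isStoppingTime hτ
  have hτi := integrable_toReal_time (P := P) hτm hint
  let u : ℕ → ℕ → ℝ≥0 := fun n k => (k : ℝ≥0) / 2 ^ n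
  have humono : ∀ n, Monotone (u n) := fun n i j hij =>
    div_le_div_of_nonneg_right (by exact_mod_cast hij) zero_le
  -- paths along which the function is small at a grid time that is at least `δ` before `τ`
  let D : ℝ → ℝ → ℕ → Set (BeliefPath X) := fun δ ε n =>
    {w | τ w < ∞ ∧ ∃ k, (u n k : ℝ) + δ ≤ (τ w).toReal ∧ Γ (canon (u n k) w) ≤ ε}
  -- The grids are nested, as `k / 2^n = 2k / 2^(n+1)`; bounds uniform in `n` thus pass to the
  -- union.
  have hDmono : ∀ δ ε, Monotone (D δ ε) := fun δ ε => monotone_nat_of_le_succ fun n => by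
    rintro w ⟨hf, k, h1, h2⟩
    have hu : u (n + 1) (2 * k) = u n k := by
      simp only [u]
      rw [pow_succ', Nat.cast_mul, Nat.cast_ofNat, mul_div_mul_left _ _ two_ne_zero]
    exact ⟨hf, 2 * k, by rwa [hu], by rwa [hu]⟩
  have hDle : ∀ δ > 0, ∀ ε > 0, ∀ n, P (D δ ε n) ≤ ENNReal.ofReal (ε / (a * δ)) := by
    intro δ hδ ε hε n
    let B : ℕ → Set (BeliefPath X) := fun k =>
      {w | (u n k : ℝ≥0∞) ≤ τ w} ∩ {w | Γ (canon (u n k) w) ≤ ε}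
    have hB : ∀ k, MeasurableSet[canonFiltration X (u n k)] (B k) := fun k =>
      (hτ.measurableSet_ge _).inter (measurable_canon_filtration le_rfl
        (isClosed_le hΓ continuous_const).measurableSet)
    -- Decomposition by the first grid time, not after `τ`, at which the function is at most `ε`.
    let E : ℕ → Set (BeliefPath X) := fun k => B k \ ⋃ j ∈ Finset.range k, B j
    have hE : ∀ k, MeasurableSet[canonFiltration X (u n k)] (E k) := fun k =>
      (hB k).diff (Finset.measurableSet_biUnion _ fun j hj =>
        (canonFiltration X).mono (humono n (Finset.mem_range.1 hj).le) _ (hB j))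
    have hEm : ∀ k, MeasurableSet (E k) := fun k => (canonFiltration X).le _ _ (hE k)
    have hEdisj : Pairwise (Function.onFun Disjoint E) := by
      have : ∀ i j, i < j → Disjoint (E i) (E j) := fun i j hij => by
        refine Set.disjoint_left.2 fun w hi hj => hj.2 ?_
        exact Set.mem_biUnion (Finset.mem_coe.2 (Finset.mem_range.2 hij)) hi.1
      intro i j hij
      rcases lt_or_gt_of_ne hij with h | h
      · exact this i j h
      · exact (this j i h).symm
    have hEτ : ∀ k, E k ⊆ {w | (u n k : ℝ≥0∞) ≤ τ w} := fun k w hw => hw.1.1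
    -- The first such time is no later than the witness in `D`, so `τ` is still at least `δ` away
    -- from it.
    let F : ℕ → Set (BeliefPath X) := fun k =>
      E k ∩ {w | τ w < ∞ ∧ δ ≤ (τ w).toReal - u n k}
    have hsub : D δ ε n ⊆ ⋃ k, F k := by
      classical
      rintro w ⟨hf, hk⟩
      have hex : ∃ k, w ∈ B k := by
        obtain ⟨k, h1, h2⟩ := hk
        refine ⟨k, ?_, h2⟩
        change (u n k : ℝ≥0∞) ≤ τ w
        rw [← ENNReal.ofReal_coe_nnreal, ENNReal.ofReal_le_iff_le_toReal hf.ne]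
        linarith
      obtain ⟨k, h1, h2⟩ := hk
      refine Set.mem_iUnion.2 ⟨Nat.find hex, ⟨Nat.find_spec hex, ?_⟩, hf, ?_⟩
      · simp only [Set.mem_iUnion, Finset.mem_range, not_exists]
        exact fun j hj => Nat.find_min hex hj
      · have hkB : w ∈ B k := by
          refine ⟨?_, h2⟩
          change (u n k : ℝ≥0∞) ≤ τ w
          rw [← ENNReal.ofReal_coe_nnreal, ENNReal.ofReal_le_iff_le_toReal hf.ne]
          linarith
        have h3 : (u n (Nat.find hex) : ℝ) ≤ u n k := by
          exact_mod_cast humono n (Nat.find_min' hex hkB)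
        linarith
    have hFle : ∀ k, P (F k) ≤ ENNReal.ofReal (ε / (a * δ)) * P (E k) := by
      intro k
      have hFm : MeasurableSet (F k) := (hEm k).inter
        ((measurableSet_lt hτm measurable_const).inter
          (measurableSet_le measurable_const (hτm.ennreal_toReal.sub_const _)))
      have h1 := hrem (u n k) (E k) (hE k) (hEτ k)
      have h2 : ∫ w in E k, Γ (canon (u n k) w) ∂P ≤ ε * P.real (E k) := by
        have : ∫ w in E k, Γ (canon (u n k) w) ∂P ≤ ∫ _ in E k, ε ∂P :=
          setIntegral_mono_on (integrable_comp_belief (measurable_canon _) hΓ).integrableOn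
            (integrable_const _).integrableOn (hEm k) fun w hw => hw.1.2
        rwa [setIntegral_const, smul_eq_mul, mul_comm] at this
      have h3 : δ * P.real (F k) ≤ ∫ w in E k, ((τ w).toReal - u n k) ∂P := by
        have h4 : ∫ _ in F k, δ ∂P ≤ ∫ w in F k, ((τ w).toReal - u n k) ∂P :=
          setIntegral_mono_on (integrable_const _).integrableOn
            (hτi.sub (integrable_const _)).integrableOn hFm fun w hw => hw.2.2
        have h5 : ∫ w in F k, ((τ w).toReal - u n k) ∂P
            ≤ ∫ w in E k, ((τ w).toReal - u n k) ∂P := by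
          refine setIntegral_mono_set (hτi.sub (integrable_const _)).integrableOn ?_
            (ae_of_all _ fun w hw => hw.1)
          rw [EventuallyLE, ae_restrict_iff' (hEm k)]
          filter_upwards [hfin] with w hf hw
          refine sub_nonneg.2 ?_
          exact_mod_cast ENNReal.toReal_mono hf.ne (hEτ k hw)
        rw [setIntegral_const, smul_eq_mul, mul_comm] at h4
        exact h4.trans h5
      -- Markov's inequality: `a δ P(F k) ≤ a E[τ - u; E k] ≤ E[Γ; E k] ≤ ε P(E k)`.
      have h6 : P.real (F k) ≤ ε / (a * δ) * P.real (E k) := by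
        have := mul_le_mul_of_nonneg_left h3 ha.le
        rw [div_mul_eq_mul_div, le_div_iff₀ (mul_pos ha hδ)]
        linarith
      rw [← ofReal_measureReal (measure_ne_top P (F k)),
        ← ofReal_measureReal (measure_ne_top P (E k)),
        ← ENNReal.ofReal_mul (by positivity)]
      exact ENNReal.ofReal_le_ofReal h6
    calc P (D δ ε n) ≤ P (⋃ k, F k) := measure_mono hsub
      _ ≤ ∑' k, P (F k) := measure_iUnion_le _
      _ ≤ ∑' k, ENNReal.ofReal (ε / (a * δ)) * P (E k) := ENNReal.tsum_le_tsum hFle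
      _ = ENNReal.ofReal (ε / (a * δ)) * P (⋃ k, E k) := by
          rw [ENNReal.tsum_mul_left, measure_iUnion hEdisj hEm]
      _ ≤ ENNReal.ofReal (ε / (a * δ)) := by
          conv_rhs => rw [← mul_one (ENNReal.ofReal (ε / (a * δ)))]
          gcongr
          exact prob_le_one
  have hnull : ∀ m : ℕ, P (⋂ j : ℕ, ⋃ n, D (1 / ((m : ℝ) + 1)) (1 / ((j : ℝ) + 1)) n) = 0 := by
    intro m
    have hδ : (0 : ℝ) < 1 / ((m : ℝ) + 1) := by positivity
    have hle : ∀ j : ℕ, P (⋂ j : ℕ, ⋃ n, D (1 / ((m : ℝ) + 1)) (1 / ((j : ℝ) + 1)) n)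
        ≤ ENNReal.ofReal (1 / ((j : ℝ) + 1) / (a * (1 / ((m : ℝ) + 1)))) := fun j => by
      refine (measure_mono (Set.iInter_subset _ j)).trans ?_
      rw [(hDmono _ _).measure_iUnion]
      exact iSup_le fun n => hDle _ hδ _ (by positivity) n
    have hlim : Tendsto (fun j : ℕ =>
        ENNReal.ofReal (1 / ((j : ℝ) + 1) / (a * (1 / ((m : ℝ) + 1))))) atTop (𝓝 0) := by
      have := ENNReal.tendsto_ofReal
        (tendsto_one_div_add_atTop_nhds_zero_nat.div_const (a * (1 / ((m : ℝ) + 1))))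
      simpa using this
    exact le_antisymm (ge_of_tendsto' hlim hle) zero_le
  have hnull' := ae_all_iff.2 fun m => (measure_eq_zero_iff_ae_notMem.1 (hnull m))
  filter_upwards [hnull', hfin] with w hw hf t ht hzero
  have ht' : (t : ℝ) < (τ w).toReal := by
    rw [← ENNReal.ofReal_coe_nnreal] at ht
    exact (ENNReal.ofReal_lt_iff_lt_toReal t.coe_nonneg hf.ne).1 ht
  obtain ⟨m, hm⟩ := exists_nat_one_div_lt (sub_pos.2 ht')
  -- If `Γ` vanished at `t < τ`, right-continuity would make it small at a slightly later grid time
  -- still `1/(m+1)` before `τ`, for every threshold; that event is null.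
  refine hw m (Set.mem_iInter.2 fun j => Set.mem_iUnion.2 ?_)
  have h1 : Tendsto (fun n => (upperDyadic n t : ℝ)) atTop (𝓝 (t : ℝ)) :=
    NNReal.tendsto_coe.2 (tendsto_upperDyadic t)
  have h2 : Tendsto (fun n => Γ (canon (upperDyadic n t) w)) atTop (𝓝 (Γ (canon t w))) :=
    (hΓ.tendsto _).comp (tendsto_canon_of_ge w (tendsto_upperDyadic t)
      (Eventually.of_forall fun n => (lt_upperDyadic n t).le))
  have e1 := h1.eventually_lt_const (show (t : ℝ) < (τ w).toReal - 1 / ((m : ℝ) + 1) by linarith)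
  have e2 := h2.eventually_lt_const
    (show Γ (canon t w) < 1 / ((j : ℝ) + 1) by rw [hzero]; positivity)
  obtain ⟨n, hn1, hn2⟩ := (e1.and e2).exists
  exact ⟨n, hf, ⌊2 ^ n * t⌋₊ + 1, (le_sub_iff_add_le.1 hn1.le), hn2.le⟩

/-! ### Localization of beliefs before stopping -/

theorem ae_le_of_forall_setIntegral_le {Ω : Type*} {m m0 : MeasurableSpace Ω} {μ : Measure Ω}
    [IsFiniteMeasure μ] (hm : m ≤ m0) {f g : Ω → ℝ} (hf : StronglyMeasurable[m] f)
    (hg : StronglyMeasurable[m] g) (hfi : Integrable f μ) (hgi : Integrable g μ) {B : Set Ω}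
    (hB : MeasurableSet[m] B)
    (h : ∀ S, MeasurableSet[m] S → S ⊆ B → ∫ x in S, f x ∂μ ≤ ∫ x in S, g x ∂μ) :
    ∀ᵐ x ∂μ, x ∈ B → f x ≤ g x := by
  have hS : MeasurableSet[m] (B ∩ {x | g x < f x}) := hB.inter (hg.measurableSet_lt hf)
  set S := B ∩ {x | g x < f x} with hSdef
  have h1 := h S hS Set.inter_subset_left
  have hnn : 0 ≤ᵐ[μ.restrict S] fun x => f x - g x := by
    rw [EventuallyLE, ae_restrict_iff' (hm _ hS)]
    exact ae_of_all _ fun x hx => sub_nonneg.2 (le_of_lt hx.2)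
  have h2 : ∫ x in S, (f x - g x) ∂μ = 0 := by
    refine le_antisymm ?_ (integral_nonneg_of_ae hnn)
    rw [integral_sub hfi.integrableOn hgi.integrableOn]
    linarith
  have h3 := (integral_eq_zero_iff_of_nonneg_ae hnn (hfi.sub hgi).integrableOn).1 h2
  rw [EventuallyEq, ae_restrict_iff' (hm _ hS)] at h3
  filter_upwards [h3] with x hx hxB
  by_contra hlt
  have hlt' := not_le.1 hlt
  have := hx ⟨hxB, hlt'⟩
  simp only [Pi.zero_apply] at this
  linarith

/-- At each date before the stopping time, continuing on the support of the stopped belief is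
worthwhile. -/
theorem Model.IsAdmissible.ae_mem_worthwhile (hκ : 0 < M.κ) (hχ : 0 < M.χ)
    (hH : ContinuousOn M.H (stdSimplex ℝ X)) (ha : M.IsAdmissible q₀ P I τ)
    (ho : M.IsAgentOptimal P τ) (s : ℝ≥0) :
    ∀ᵐ w ∂P, (s : ℝ≥0∞) ≤ τ w →
      canon s w ∈ M.worthwhile (P.map (stoppedBelief τ)).support := by
  have := ha.prob
  have hτm := measurable_of_isStoppingTime ha.stopping
  have hZ := measurable_stoppedBelief hτm
  have cg := M.continuous_netValue hH
  set K := (P.map (stoppedBelief τ)).support with hK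
  set C := convexHull ℝ ((fun q' : Belief X => (q'.1, M.netValue q')) '' K) with hC
  have hCc : IsCompact C := M.isCompact_graph_hull hH Measure.isClosed_support
  -- The conditional mean of this pair replaces a conditional law of the stopped belief: it stays in
  -- the closed convex set `C`.
  let Y : BeliefPath X → (X → ℝ) × ℝ := fun w =>
    ((stoppedBelief τ w).1, M.netValue (stoppedBelief τ w))
  have hci : ∀ x, Integrable (fun w => (stoppedBelief τ w).1 x) P := fun x =>
    integrable_comp_belief hZ (continuous_coord x)
  have hgi : Integrable (fun w => M.netValue (stoppedBelief τ w)) P :=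
    integrable_comp_belief hZ cg
  have hYi : Integrable Y P := (Integrable.of_eval hci).prodMk hgi
  have hmem : ∀ᵐ w ∂P, Y w ∈ C := by
    have h1 : ∀ᵐ w ∂P, stoppedBelief τ w ∈ K :=
      ae_of_ae_map hZ.aemeasurable Measure.support_mem_ae
    filter_upwards [h1] with w hw
    exact subset_convexHull ℝ _ ⟨_, hw, rfl⟩
  have hle := (canonFiltration X).le s
  have hcond := (convex_convexHull ℝ _).condExp_mem hle hYi hCc.isClosed hmem
  have hB : MeasurableSet[canonFiltration X s] {w | (s : ℝ≥0∞) ≤ τ w} :=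
    ha.stopping.measurableSet_ge s
  have hcomp : ∀ (L : ((X → ℝ) × ℝ) →L[ℝ] ℝ), ∀ᵐ w ∂P,
      L (P[Y | canonFiltration X s] w) = P[fun w => L (Y w) | canonFiltration X s] w := fun L =>
    L.comp_condExp_comm hYi
  have hcs : ∀ φ : Belief X → ℝ, Continuous φ →
      StronglyMeasurable[canonFiltration X s] fun w => φ (canon s w) := fun φ hφ =>
    (hφ.measurable.comp (measurable_canon_filtration le_rfl)).stronglyMeasurable
  have hx : ∀ x, ∀ᵐ w ∂P, (s : ℝ≥0∞) ≤ τ w →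
      (P[Y | canonFiltration X s] w).1 x = (canon s w).1 x := by
    intro x
    have hset : ∀ S, MeasurableSet[canonFiltration X s] S → S ⊆ {w | (s : ℝ≥0∞) ≤ τ w} →
        ∫ w in S, P[fun w => (stoppedBelief τ w).1 x | canonFiltration X s] w ∂P
          = ∫ w in S, (canon s w).1 x ∂P := fun S hS hSτ => by
      rw [setIntegral_condExp hle (hci x) hS,
        setIntegral_stoppedBelief ha.martingale ha.stopping ha.finite hS hSτ x]
    have hi := integrable_comp_belief (P := P) (measurable_canon s) (continuous_coord x)
    have h1 := ae_le_of_forall_setIntegral_le hle stronglyMeasurable_condExp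
      (hcs _ (continuous_coord x)) integrable_condExp hi hB fun S hS hSτ => (hset S hS hSτ).le
    have h2 := ae_le_of_forall_setIntegral_le hle (hcs _ (continuous_coord x))
      stronglyMeasurable_condExp hi integrable_condExp hB fun S hS hSτ => (hset S hS hSτ).ge
    filter_upwards [h1, h2, hcomp ((ContinuousLinearMap.proj x).comp
      (ContinuousLinearMap.fst ℝ (X → ℝ) ℝ))] with w a1 a2 a3 hw
    exact a3.trans (le_antisymm (a1 hw) (a2 hw))
  have hg : ∀ᵐ w ∂P, (s : ℝ≥0∞) ≤ τ w →
      M.netValue (canon s w) ≤ (P[Y | canonFiltration X s] w).2 := by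
    have h1 := ae_le_of_forall_setIntegral_le hle (hcs _ cg)
      (stronglyMeasurable_condExp (f := fun w => M.netValue (stoppedBelief τ w)) (μ := P))
      (integrable_comp_belief (measurable_canon s) cg) integrable_condExp hB fun S hS hSτ => by
        rw [setIntegral_condExp hle hgi hS]
        exact ha.setIntegral_netValue_le hκ hχ hH ho hS hSτ
    filter_upwards [h1, hcomp (ContinuousLinearMap.snd ℝ (X → ℝ) ℝ)] with w a1 a2 hw
    exact (a1 hw).trans (le_of_eq a2.symm)
  filter_upwards [hcond, ae_all_iff.2 hx, hg] with w h1 h2 h3 hw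
  refine ⟨_, h3 hw, ?_⟩
  have : (canon s w).1 = (P[Y | canonFiltration X s] w).1 := funext fun x => (h2 x hw).symm
  rw [this]
  exact h1

/-- Strict inequality `t < τ` leaves room for dyadic dates in `(t, τ)` decreasing to `t`; closedness
and right-continuity pass from them to `t`, with one null set for all dates. -/
theorem ae_forall_mem_of_isClosed {W : Set (Belief X)} (hW : IsClosed W)
    (h : ∀ s : ℝ≥0, ∀ᵐ w ∂P, (s : ℝ≥0∞) ≤ τ w → canon s w ∈ W) :
    ∀ᵐ w ∂P, ∀ t : ℝ≥0, (t : ℝ≥0∞) < τ w → canon t w ∈ W := by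
  have hall : ∀ᵐ w ∂P, ∀ n k : ℕ, (((k : ℝ≥0) / 2 ^ n : ℝ≥0) : ℝ≥0∞) ≤ τ w →
      canon ((k : ℝ≥0) / 2 ^ n) w ∈ W := ae_all_iff.2 fun n => ae_all_iff.2 fun k => h _
  filter_upwards [hall] with w hw t ht
  have h1 : Tendsto (fun n => ((upperDyadic n t : ℝ≥0) : ℝ≥0∞)) atTop (𝓝 (t : ℝ≥0∞)) :=
    ENNReal.tendsto_coe.2 (tendsto_upperDyadic t)
  refine hW.mem_of_tendsto (tendsto_canon_of_ge w (tendsto_upperDyadic t)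
    (Eventually.of_forall fun n => (lt_upperDyadic n t).le)) ?_
  filter_upwards [h1.eventually_lt_const ht] with n hn
  exact hw n (⌊2 ^ n * t⌋₊ + 1) hn.le

end Solutions

end Engagement

/-! ### The proposition -/

theorem proposition3 {X A : Type*} [Fintype X] [DecidableEq X] [Fintype A] [Nonempty A]
    (M : Engagement.Model X A)
    (hκ : 0 < M.κ) (hχ : 0 < M.χ) (hρ : 0 < M.ρ)
    -- the generalized entropy function: nonnegative, strongly convex, regular
    (hH_nonneg : ∀ q ∈ stdSimplex ℝ X, 0 ≤ M.H q)
    (hH_convex : ∃ m : ℝ, 0 < m ∧ StrongConvexOn (stdSimplex ℝ X) m M.H)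
    (hH_cont : ContinuousOn M.H (stdSimplex ℝ X))
    (hH_diff : ContDiffOn ℝ 2 M.H (intrinsicInterior ℝ (stdSimplex ℝ X)))
    (q₀ : Engagement.Belief X)
    -- learning the state perfectly is prohibitively costly
    (h_imperfect : ∑ x, q₀.1 x * (M.uhat (Engagement.pointBelief x)
        - M.κ / M.χ * M.H (Engagement.pointBelief x).1) < M.uhat q₀ - M.κ / M.χ * M.H q₀.1)
    (P : Measure (Engagement.BeliefPath X)) (I : ℝ≥0 → Engagement.BeliefPath X → ℝ)
    (τ : Engagement.BeliefPath X → ℝ≥0∞)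
    (h_sol : M.IsPrincipalSolution q₀ P I τ) :
    -- almost surely, at all times before stopping, beliefs are suspensive
    (∀ᵐ w ∂P, ∀ t : ℝ≥0, (t : ℝ≥0∞) < τ w →
      Engagement.canon t w ∈ ⋃ π ∈ M.relaxedSolutions q₀, M.suspensive π) ∧
    -- topological support of the belief at time `t` on the event that `t` is before stopping
    (∀ t : ℝ≥0, ((P.restrict {w | (t : ℝ≥0∞) < τ w}).map (Engagement.canon t)).support ⊆
      ⋃ π ∈ M.relaxedSolutions q₀, (M.suspensive π ∪ Engagement.decisive π)) ∧
    -- at the stopping time, beliefs are decisive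
    (P.map (Engagement.stoppedBelief τ)).support ⊆
      ⋃ π ∈ M.relaxedSolutions q₀, Engagement.decisive π := by
  have hκχ : 0 < M.κ / M.χ := div_pos hκ hχ
  have ha := h_sol.admissible
  have ho := h_sol.incentive
  have := ha.prob
  set π := P.map (Engagement.stoppedBelief τ) with hπdef
  have hτm := Engagement.measurable_of_isStoppingTime ha.stopping
  have hπ : M.IsRelaxedSolution q₀ π := h_sol.isRelaxedSolution_law hκ hχ hρ hH_cont
  have hbind := hπ.binding hκχ hH_cont hρ h_imperfect
  have hfull := ha.info_eq_capacity hκ hχ hH_cont ho hbind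
  obtain ⟨c, θ, hθ, haff⟩ := hπ.first_order hH_cont hρ
  have hWclosed : IsClosed (M.worthwhile π.support) :=
    M.isClosed_worthwhile hH_cont Measure.isClosed_support
  have hW := ha.ae_mem_worthwhile hκ hχ hH_cont ho
  have hsupp : ∀ᵐ w ∂P, Engagement.stoppedBelief τ w ∈ π.support :=
    ae_of_ae_map (Engagement.measurable_stoppedBelief hτm).aemeasurable Measure.support_mem_ae
  have hΓ : Continuous fun q : Engagement.Belief X =>
      ∑ x, c x * q.1 x - θ * M.netValue q - M.H q.1 :=
    ((continuous_finsetSum _ fun x _ =>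
      continuous_const.mul (Engagement.continuous_coord x)).sub
        (continuous_const.mul (M.continuous_netValue hH_cont))).sub (M.continuous_H hH_cont)
  -- The gap `ℓ - θ g - H` vanishes on the support of `π` and dominates the expected remaining time,
  -- so the support is not reached before `τ`.
  have havoid := Engagement.ae_forall_ne_zero_of_remaining_time_le ha.stopping ho.integrable
    ha.finite hχ hΓ fun s S hS hSτ => ha.setIntegral_remaining_time_le hκ hχ hH_cont ho hfull hθ
      (hsupp.mono fun w hw => haff _ hw) hS hSτ
  refine ⟨?_, fun t => ?_, ?_⟩
  · filter_upwards [Engagement.ae_forall_mem_of_isClosed hWclosed hW, havoid] with w h1 h2 t ht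
    refine Set.mem_biUnion hπ (M.mem_suspensive_of_worthwhile hH_cont (h1 t ht) fun hmem => ?_)
    exact h2 t ht (by have := haff _ hmem; linarith)
  -- The topological support only inherits the closed condition `worthwhile`; limit points may fall
  -- in the support of `π`, whence the union with decisive beliefs.
  · have hsub : ((P.restrict {w | (t : ℝ≥0∞) < τ w}).map (Engagement.canon t)).support
        ⊆ M.worthwhile π.support := by
      refine Measure.support_subset_of_isClosed hWclosed ?_
      rw [mem_ae_map_iff (Engagement.measurable_canon t).aemeasurable hWclosed.measurableSet]
      refine (ae_restrict_iff' (measurableSet_lt measurable_const hτm)).2 ?_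
      filter_upwards [hW t] with w hw ht
      exact hw (le_of_lt ht)
    refine fun q hq => Set.mem_biUnion hπ ?_
    by_cases hmem : q ∈ π.support
    · exact Or.inr hmem
    · exact Or.inl (M.mem_suspensive_of_worthwhile hH_cont (hsub hq) hmem)
  · exact fun q hq => Set.mem_biUnion hπ hq
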